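/- Let $\mathbf T^3=(\mathbf R/\mathbf Z)^3$ with Lebesgue measure (total mass $1$). For $\delta>1$ let $B_\delta$ be the space of real continuous functions $g$ on $\mathbf T^3$ with $$|g|_\delta:=\sum_{k\in\mathbf Z^3}|\mathcal F g(k)|\,\delta^{|k|}<\infty ,$$ where $\mathcal F g(k)$ are the Fourier coefficients of $g$ and $|k|$ is the Euclidean norm; a vector field is in $B_\delta$ when its components are. Let $(M,\mu)$ be a probability space, $\delta_0>\delta_1>1$, $C_0>0$, and let $(\rho_\theta(0))_{\theta\in M}$ and $(\xi_\theta(0))_{\theta\in M}$ be families of functions, respectively of vector fields with values in $\mathbf R^3$, on $\mathbf T^3$, in $B_{\delta_0}$, such that $\theta\mapsto\rho_\theta(0,x)$ and $\theta\mapsto\xi_\theta(0,x)$ are measurable for every $x$, $$\sup_\theta|\rho_\theta(0)|_{\delta_0}\le C_0,\qquad \sup_\theta|\xi_\theta(0)|_{\delta_0}\le C_0$$ (for each component of $\xi_\theta(0)$), and $$\int_M\int_{\mathbf T^3}\rho_\theta(0,x)\,dx\,\mu(d\theta)=1 .$$ **Theorem.** There are a time $T_0>0$, families $(\rho_\theta)_\theta$,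 $(\xi_\theta)_\theta$ in $C([0,T_0],B_{\delta_1})$, measurable in $\theta$ and bounded in $B_{\delta_1}$ uniformly in $\theta\in M$ and $t\in[0,T_0]$, and a potential $\phi(t,x)$, of class $C^2$ in $x$, which solve the multifluid Vlasov–Poisson system in the classical sense on $[0,T_0]\times\mathbf T^3$: $$\partial_t\rho_\theta+\nabla_x\cdot(\xi_\theta\rho_\theta)=0,\qquad \partial_t\xi_\theta+(\xi_\theta\cdot\nabla_x)\xi_\theta=-\nabla_x\phi\qquad(\theta\in M),$$ $$-\Delta\phi=\int_M\rho_\theta\,\mu(d\theta)-1,$$ with initial data $(\rho_\theta(0),\xi_\theta(0))_\theta$. Moreover, if $\rho_\theta(0)\ge0$ for all $\theta$, then $\rho_\theta(t)\ge0$ for all $\theta\in M$, $t\in[0,T_0]$, and $$f(t,dx,d\xi)=\Big(\int_M\rho_\theta(t,x)\,\delta(\xi-\xi_\theta(t,x))\,\mu(d\theta)\Big)dx$$ is a suitable weak solution of the Vlasov–Poisson system on $[0,T_0)$ with initial datum $f^0=f(0)$. Here $f$ is a *weak solution* on $[0,T)$ with initial datum $f^0$ and potential $\phi$ if * $f(0)=f^0$,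 and $f\in C([0,T),\mathcal P_2(\mathbf T^3\times\mathbf R^3))$, where $\mathcal P_2$ is the set of probability measures with $\int|\xi|^2<\infty$, with the weak-$*$ topology (tested against bounded continuous functions); * $\nabla_x\phi\in L^1(0,T;C(\mathbf T^3))$, and for all $\psi\in C_c^\infty([0,T)\times\mathbf T^3\times\mathbf R^3)$, $$\int_0^T\!\!\int(\partial_t\psi+\xi\cdot\nabla_x\psi-\nabla_x\phi\cdot\nabla_\xi\psi)\,f(t,dx,d\xi)\,dt=-\int\psi|_{t=0}\,f^0(dx,d\xi);$$ * for all $t\in[0,T)$, $-\Delta\phi(t)=\rho(t)-1$ in the sense of distributions on $\mathbf T^3$, where $\rho=\int_{\mathbf R^3}f(\cdot,\cdot,d\xi)$; * for all $t\in[0,T)$, the current $j=\int_{\mathbf R^3}\xi f(\cdot,\cdot,d\xi)$ satisfies $\partial_tj+\nabla_x\cdot\int_{\mathbf R^3}\xi\otimes\xi\,f(\cdot,\cdot,d\xi)=-\rho\,\nabla_x\phi$, tested against smooth functions of $x$; and it is *suitable* if moreover $$\|\rho\|_{L^\infty(0,T;L^1\cap L^\infty(\mathbf T^3))}<\infty,\qquad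 \Big\|\int_{\mathbf R^3}|\xi|^4f(t,x,d\xi)\Big\|_{L^\infty(0,T;L^1(\mathbf T^3))}<\infty .$$ -/

import Mathlib

open Set Filter Topology MeasureTheory
open scoped NNReal ENNReal ContDiff

noncomputable section

namespace VlasovPoisson

/-- The three-dimensional flat torus `(ℝ/ℤ)³`. -/
abbrev T3 : Type := UnitAddTorus (Fin 3)

/-- The momentum space `ℝ³` with its Euclidean norm. -/
abbrev R3 : Type := EuclideanSpace ℝ (Fin 3)

/-- Lebesgue measure on the torus, of total mass one. It is the measure that Mathlib's
Fourier coefficients `UnitAddTorus.mFourierCoeff` are computed with. -/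
def torusMeasure : Measure T3 := Measure.pi fun _ => AddCircle.haarAddCircle

/-- The covering map `ℝ³ → (ℝ/ℤ)³`. -/
def torusProj (v : Fin 3 → ℝ) : T3 := fun i => (v i : UnitAddCircle)

/-- `g` is of class `C^n` on the torus: its periodic lift to `ℝ³` is of class `C^n`. -/
def TorusContDiff (n : WithTop ℕ∞) (g : T3 → ℝ) : Prop :=
  ContDiff ℝ n fun v : Fin 3 → ℝ => g (torusProj v)

/-- The partial derivative `∂ᵢ g` of a function on the torus. -/
def torusPartial (i : Fin 3) (g : T3 → ℝ) (x : T3) : ℝ :=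
  deriv (fun s : ℝ => g (x + Pi.single i (s : UnitAddCircle))) 0

/-- The Laplacian `Δ g = ∑ᵢ ∂ᵢ ∂ᵢ g` on the torus. -/
def torusLaplacian (g : T3 → ℝ) (x : T3) : ℝ :=
  ∑ i, torusPartial i (torusPartial i g) x

/-! ### The analytic spaces `B_δ` -/

/-- The Euclidean length `|k|` of a frequency `k ∈ ℤ³`. -/
def freqNorm (k : Fin 3 → ℤ) : ℝ := Real.sqrt (∑ i, (k i : ℝ) ^ 2)

/-- The terms `|𝓕 g (k)| δ^|k|` of the series that defines the norm of `B_δ`. -/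
def bTerm (δ : ℝ) (g : C(T3, ℝ)) (k : Fin 3 → ℤ) : ℝ :=
  ‖UnitAddTorus.mFourierCoeff (fun x : T3 => ((g x : ℝ) : ℂ)) k‖ * δ ^ freqNorm k

/-- Membership in `B_δ` (every element of `B_δ` has a continuous representative). -/
def MemB (δ : ℝ) (g : C(T3, ℝ)) : Prop := Summable (bTerm δ g)

/-- The norm `|g|_δ = ∑ₖ |𝓕 g (k)| δ^|k|` for `g ∈ B_δ`. -/
def bNorm (δ : ℝ) (g : C(T3, ℝ)) : ℝ := ∑' k, bTerm δ g k

/-- `u ∈ C([0,T], B_δ)`, continuity being meant for the norm of `B_δ`. -/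
def ContinuousInB (T δ : ℝ) (u : ℝ → C(T3, ℝ)) : Prop :=
  (∀ t ∈ Icc 0 T, MemB δ (u t)) ∧
    ∀ t₀ ∈ Icc 0 T, Tendsto (fun t => bNorm δ (u t - u t₀)) (𝓝[Icc 0 T] t₀) (𝓝 0)

/-! ### The multifluid system -/

section Multifluid

variable {M : Type*} [MeasurableSpace M]

/-- Classical solutions on `[0,T]` of the multifluid Vlasov–Poisson system
`∂ₜ ρ_θ + ∇·(ξ_θ ρ_θ) = 0`, `∂ₜ ξ_θ + (ξ_θ·∇) ξ_θ = -∇φ`, `-Δφ = ∫ ρ_θ dμ(θ) - 1`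
with initial data `(ρ0_θ, ξ0_θ)`. Here `ξ θ t j` is the `j`-th component of `ξ_θ(t)`. -/
structure IsMultifluidSolution (μ : Measure M) (T : ℝ)
    (ρ0 : M → C(T3, ℝ)) (ξ0 : M → Fin 3 → C(T3, ℝ))
    (ρ : M → ℝ → C(T3, ℝ)) (ξ : M → ℝ → Fin 3 → C(T3, ℝ)) (φ : ℝ → C(T3, ℝ)) : Prop where
  measurable_density : ∀ t ∈ Icc 0 T, ∀ x, Measurable fun θ => ρ θ t x
  measurable_momentum : ∀ t ∈ Icc 0 T, ∀ j x, Measurable fun θ => ξ θ t j x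
  integrable_density : ∀ t ∈ Icc 0 T, ∀ x, Integrable (fun θ => ρ θ t x) μ
  contDiff_density : ∀ θ, ∀ t ∈ Icc 0 T, TorusContDiff 1 (ρ θ t)
  contDiff_momentum : ∀ θ, ∀ t ∈ Icc 0 T, ∀ j, TorusContDiff 1 (ξ θ t j)
  contDiff_potential : ∀ t ∈ Icc 0 T, TorusContDiff 2 (φ t)
  continuity : ∀ θ, ∀ t ∈ Icc 0 T, ∀ x,
    HasDerivWithinAt (fun s => ρ θ s x)
      (-∑ i, torusPartial i (fun y => ξ θ t i y * ρ θ t y) x) (Icc 0 T) t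
  momentum : ∀ θ, ∀ t ∈ Icc 0 T, ∀ j x,
    HasDerivWithinAt (fun s => ξ θ s j x)
      (-(∑ i, ξ θ t i x * torusPartial i (ξ θ t j) x) - torusPartial j (φ t) x) (Icc 0 T) t
  poisson : ∀ t ∈ Icc 0 T, ∀ x, -torusLaplacian (φ t) x = (∫ θ, ρ θ t x ∂μ) - 1
  initial_density : ∀ θ, ρ θ 0 = ρ0 θ
  initial_momentum : ∀ θ, ξ θ 0 = ξ0 θ

/-- The measure `∫_M r_θ(x) δ(ξ - u_θ(x)) μ(dθ) dx` on phase space: the image of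
`r_θ(x) μ(dθ) dx` under `(θ, x) ↦ (x, u_θ(x))`. -/
def multifluidMeasure (μ : Measure M) (r : M → C(T3, ℝ)) (u : M → Fin 3 → C(T3, ℝ)) :
    Measure (T3 × R3) :=
  ((μ.prod torusMeasure).withDensity fun p => ENNReal.ofReal (r p.1 p.2)).map
    fun p => (p.2, WithLp.toLp 2 fun j => u p.1 j p.2)

end Multifluid

/-! ### Measure-valued weak solutions -/

/-- Membership in `𝒫₂`: probability measures on phase space with finite second moment. -/
def IsP2 (m : Measure (T3 × R3)) : Prop :=
  IsProbabilityMeasure m ∧ Integrable (fun z : T3 × R3 => ‖z.2‖ ^ 2) m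

/-- Test functions in `C_c^∞([0,T) × 𝕋³ × ℝ³)`, given as restrictions to `t ≥ 0` of smooth
functions. -/
def IsTestFunction (T : ℝ) (ψ : ℝ → T3 → R3 → ℝ) : Prop :=
  ContDiff ℝ ∞ (fun p : ℝ × (Fin 3 → ℝ) × R3 => ψ p.1 (torusProj p.2.1) p.2.2) ∧
    ∃ T' < T, ∃ R : ℝ, ∀ t, 0 ≤ t → ∀ x ξ, (T' ≤ t ∨ R ≤ ‖ξ‖) → ψ t x ξ = 0

/-- Weak solutions of the Vlasov–Poisson system on `[0,T)` with initial datum `f0`.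
The field `E = -∇φ` is in `L¹(0,T; C(𝕋³))`; the Poisson equation and the conservation law
`∂ₜ j + ∇·⟨f, ξ ⊗ ξ⟩ = -∇φ ρ` for the current hold at every time, tested against smooth functions
of `x`. -/
structure IsWeakSolution (T : ℝ) (f0 : Measure (T3 × R3))
    (f : ℝ → Measure (T3 × R3)) (φ : ℝ → C(T3, ℝ)) : Prop where
  initial_mem : IsP2 f0
  mem : ∀ t ∈ Ico 0 T, IsP2 (f t)
  initial : f 0 = f0
  continuous : ∀ g : BoundedContinuousFunction (T3 × R3) ℝ,
    ContinuousOn (fun t => ∫ z, g z ∂(f t)) (Ico 0 T)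
  contDiff_potential : ∀ t ∈ Ico 0 T, TorusContDiff 1 (φ t)
  vlasov : ∃ E : ℝ → C(T3, R3),
    (∀ t ∈ Ico 0 T, ∀ x j, E t x j = -torusPartial j (φ t) x) ∧
    IntegrableOn E (Ico 0 T) ∧
    ∀ ψ : ℝ → T3 → R3 → ℝ, IsTestFunction T ψ →
      ∫ t in Ico 0 T, ∫ z : T3 × R3,
          (deriv (fun s => ψ s z.1 z.2) t
            + ∑ i, z.2 i * torusPartial i (fun y => ψ t y z.2) z.1
            + fderiv ℝ (ψ t z.1) z.2 (E t z.1)) ∂(f t)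
        = -∫ z, ψ 0 z.1 z.2 ∂f0
  poisson : ∀ t ∈ Ico 0 T, ∀ χ : C(T3, ℝ), TorusContDiff ∞ χ →
    -∫ x, φ t x * torusLaplacian χ x ∂torusMeasure
      = (∫ z, χ z.1 ∂(f t)) - ∫ x, χ x ∂torusMeasure
  current : ∀ t ∈ Ico 0 T, ∀ j, ∀ χ : C(T3, ℝ), TorusContDiff ∞ χ →
    HasDerivWithinAt (fun s => ∫ z, z.2 j * χ z.1 ∂(f s))
      (∫ z, ((∑ i, z.2 i * z.2 j * torusPartial i χ z.1)
        - torusPartial j (φ t) z.1 * χ z.1) ∂(f t)) (Ico 0 T) t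

/-- Suitable weak solutions: the macroscopic density is bounded in `L^∞(0,T; L¹ ∩ L^∞(𝕋³))`, and
the fourth moment `∫ |ξ|⁴ f(t,x,dξ)` is bounded in `L^∞(0,T; L¹(𝕋³))`. -/
structure IsSuitableSolution (T : ℝ) (f0 : Measure (T3 × R3))
    (f : ℝ → Measure (T3 × R3)) (φ : ℝ → C(T3, ℝ)) : Prop where
  weak : IsWeakSolution T f0 f φ
  bounded_density : ∃ C : ℝ≥0, ∀ᵐ t ∂(volume.restrict (Ico 0 T)),
    ∃ r : T3 → ℝ, Measurable r ∧ (∀ x, 0 ≤ r x) ∧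
      (f t).map Prod.fst = torusMeasure.withDensity (fun x => ENNReal.ofReal (r x)) ∧
      eLpNorm r 1 torusMeasure ≤ C ∧ eLpNorm r ∞ torusMeasure ≤ C
  bounded_moment : ∃ C : ℝ≥0, ∀ᵐ t ∂(volume.restrict (Ico 0 T)),
    ∫⁻ z, ‖z.2‖ₑ ^ 4 ∂(f t) ≤ C

end VlasovPoisson

end

/-!
With `r = log δ`, the norm of `B_δ` is `∑ₖ |𝓕 g (k)| e^{r|k|}`. In these norms products and the
operator `∇(-Δ)⁻¹` are bounded without any loss, and a derivative costs a factor `O(1/η)` for a loss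
`η` in the radius `r`. The system determines the Taylor coefficients in time of a solution
recursively, and induction bounds the `n`-th one by `B Rⁿ Cₙ ε⁻ⁿ` after a total loss `ε`, where the
Catalan numbers `Cₙ ≤ 4ⁿ` absorb the convolutions coming from the quadratic nonlinearities. Since
`B`, `R` and `ε` do not depend on the fluid, the Taylor series converge on a common time interval,
and their sums solve the system.

The densities remain nonnegative by the minimum principle for the transport equation. For the
kinetic equation, `∂ₜ(ρ_θ Ψ(t, x, ξ_θ))` is, up to a divergence in `x`, the product of `ρ_θ` and the
derivative of `Ψ` along the characteristics of the Vlasov equation. Divergences integrate to zero on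
the torus, and averaging over `θ` gives the weak formulation for general `Ψ`, and the equation of
the current for `Ψ = ξⱼ χ(x)`.
-/
open UnitAddTorus
open scoped ComplexConjugate

noncomputable section

namespace VlasovPoisson

/-! ### Fourier coefficients of real functions -/

section FourierCoefficients

variable {d : Type*}

/-- `c (-k) = conj (c k)`: the condition under which the Fourier series with coefficients `c` is
real, and under which the Fourier multiplier with symbol `c` preserves real functions. -/
def ConjSymmetric (c : (d → ℤ) → ℂ) : Prop := ∀ k, c (-k) = conj (c k)

lemma ConjSymmetric.mul {b c : (d → ℤ) → ℂ} (hb : ConjSymmetric b) (hc : ConjSymmetric c) :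
    ConjSymmetric fun k => b k * c k := fun k => by
  simp only [hb k, hc k, map_mul]

/-- The inclusion of real functions into complex functions. -/
def toComplex : C(UnitAddTorus d, ℝ) →L[ℝ] C(UnitAddTorus d, ℂ) :=
  Complex.ofRealCLM.compLeftContinuous ℝ _

@[simp] lemma toComplex_apply (g : C(UnitAddTorus d, ℝ)) (x : UnitAddTorus d) :
    toComplex g x = (g x : ℂ) := rfl

lemma toComplex_mul (f g : C(UnitAddTorus d, ℝ)) :
    toComplex (f * g) = toComplex f * toComplex g := by
  ext x; simp

variable [Fintype d]

/-- The Haar measure of total mass one on the torus `(ℝ/ℤ)^d`; `torusMeasure` is the case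
`d = Fin 3`. -/
abbrev torusHaar (d : Type*) [Fintype d] : Measure (UnitAddTorus d) :=
  Measure.pi fun _ => AddCircle.haarAddCircle

lemma integrable_of_continuous_torus {E : Type*} [NormedAddCommGroup E] {f : UnitAddTorus d → E}
    (hf : Continuous f) : Integrable f (torusHaar d) :=
  hf.integrable_of_hasCompactSupport (.of_compactSpace f)

lemma norm_mFourier_apply (k : d → ℤ) (x : UnitAddTorus d) : ‖mFourier k x‖ = 1 := by
  simp only [mFourier, fourier_apply, ContinuousMap.coe_mk, norm_prod, Circle.norm_coe,
    Finset.prod_const_one]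

/-- The Fourier coefficient of index `k` as a continuous functional on `C(𝕋^d, ℂ)`. -/
def complexFourierCoeff (k : d → ℤ) : C(UnitAddTorus d, ℂ) →L[ℂ] ℂ :=
  innerSL ℂ (mFourierLp 2 k) ∘L ContinuousMap.toLp 2 (torusHaar d) ℂ

lemma complexFourierCoeff_apply (k : d → ℤ) (f : C(UnitAddTorus d, ℂ)) :
    complexFourierCoeff k f = mFourierCoeff f k := by
  rw [← mFourierCoeff_toLp, ← mFourierBasis_repr, HilbertBasis.repr_apply_apply, coe_mFourierBasis]
  rfl

lemma complexFourierCoeff_mFourier (k l : d → ℤ) :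
    complexFourierCoeff k (mFourier l) = if k = l then 1 else 0 := by
  classical exact orthonormal_iff_ite.1 (orthonormal_mFourier (d := d)) k l

/-- The Fourier coefficient of index `k` as a continuous functional on real functions. -/
def realFourierCoeff (k : d → ℤ) : C(UnitAddTorus d, ℝ) →L[ℝ] ℂ :=
  (complexFourierCoeff k).restrictScalars ℝ ∘L toComplex

lemma realFourierCoeff_apply (k : d → ℤ) (g : C(UnitAddTorus d, ℝ)) :
    realFourierCoeff k g = mFourierCoeff (fun x => (g x : ℂ)) k :=
  complexFourierCoeff_apply k (toComplex g)

lemma realFourierCoeff_eq_integral (k : d → ℤ) (g : C(UnitAddTorus d, ℝ)) :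
    realFourierCoeff k g = ∫ x, mFourier (-k) x * (g x : ℂ) ∂torusHaar d :=
  realFourierCoeff_apply k g

lemma realFourierCoeff_zero (g : C(UnitAddTorus d, ℝ)) :
    realFourierCoeff 0 g = ((∫ x, g x ∂torusHaar d : ℝ) : ℂ) := by
  rw [realFourierCoeff_eq_integral, ← integral_complex_ofReal]
  simp [mFourier_zero]

lemma realFourierCoeff_const (k : d → ℤ) (c : ℝ) :
    realFourierCoeff k (ContinuousMap.const _ c) = if k = 0 then (c : ℂ) else 0 := by
  have h : toComplex (ContinuousMap.const _ c) = (c : ℂ) • mFourier (0 : d → ℤ) := by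
    ext x; simp [mFourier_zero]
  calc realFourierCoeff k (ContinuousMap.const _ c)
      = complexFourierCoeff k ((c : ℂ) • mFourier 0) := congrArg (complexFourierCoeff k) h
    _ = if k = 0 then (c : ℂ) else 0 := by
        simp [complexFourierCoeff_mFourier]

lemma conjSymmetric_realFourierCoeff (g : C(UnitAddTorus d, ℝ)) :
    ConjSymmetric fun k => realFourierCoeff k g := fun k => by
  simp only [realFourierCoeff_eq_integral]
  rw [← integral_conj]
  refine integral_congr_ae (ae_of_all _ fun x => ?_)
  simp only [map_mul, Complex.conj_ofReal, ← mFourier_neg]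

/-- The real part of the Fourier series with coefficients `c`. -/
def reFourierSeries (c : (d → ℤ) → ℂ) : C(UnitAddTorus d, ℝ) :=
  Complex.reCLM.compLeftContinuous ℝ _ (∑' k, c k • mFourier k)

lemma enorm_smul_mFourier (c : ℂ) (k : d → ℤ) : ‖c • mFourier k‖ₑ = ‖c‖ₑ := by
  rw [← ofReal_norm, norm_smul, mFourier_norm, mul_one, ofReal_norm]

lemma summable_smul_mFourier {c : (d → ℤ) → ℂ} (hc : Summable c) :
    Summable fun k => c k • mFourier k := by
  refine .of_norm ?_
  simpa only [norm_smul, mFourier_norm, mul_one] using hc.norm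

lemma conj_fourierSeries_apply {c : (d → ℤ) → ℂ} (hc : Summable c) (hsymm : ConjSymmetric c)
    (x : UnitAddTorus d) :
    conj ((∑' k, c k • mFourier k : C(UnitAddTorus d, ℂ)) x) =
      (∑' k, c k • mFourier k : C(UnitAddTorus d, ℂ)) x := by
  have happly : (∑' k, c k • mFourier k : C(UnitAddTorus d, ℂ)) x = ∑' k, c k * mFourier k x := by
    simpa using (ContinuousMap.evalCLM ℂ x).map_tsum (summable_smul_mFourier hc)
  rw [happly, Complex.conj_tsum, ← (Equiv.neg (d → ℤ)).tsum_eq]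
  refine tsum_congr fun k => ?_
  rw [Equiv.neg_apply, hsymm, map_mul, Complex.conj_conj, ← mFourier_neg, neg_neg]

lemma toComplex_reFourierSeries {c : (d → ℤ) → ℂ} (hc : Summable c) (hsymm : ConjSymmetric c) :
    toComplex (reFourierSeries c) = ∑' k, c k • mFourier k := by
  ext x
  exact Complex.conj_eq_iff_re.1 (conj_fourierSeries_apply hc hsymm x)

lemma realFourierCoeff_reFourierSeries {c : (d → ℤ) → ℂ} (hc : Summable c)
    (hsymm : ConjSymmetric c) (k : d → ℤ) : realFourierCoeff k (reFourierSeries c) = c k := by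
  calc realFourierCoeff k (reFourierSeries c)
      = complexFourierCoeff k (∑' l, c l • mFourier l) :=
        congrArg (complexFourierCoeff k) (toComplex_reFourierSeries hc hsymm)
    _ = c k := by
        rw [(complexFourierCoeff k).map_tsum (summable_smul_mFourier hc)]
        simp [complexFourierCoeff_mFourier]

lemma hasSum_smul_mFourier {g : C(UnitAddTorus d, ℝ)}
    (hg : Summable fun k => realFourierCoeff k g) :
    HasSum (fun k => realFourierCoeff k g • mFourier k) (toComplex g) := by
  simp only [realFourierCoeff_apply] at hg ⊢
  exact hasSum_mFourier_series_of_summable (f := toComplex g) hg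

lemma hasSum_mul_mFourier_apply {g : C(UnitAddTorus d, ℝ)}
    (hg : Summable fun k => realFourierCoeff k g) (x : UnitAddTorus d) :
    HasSum (fun k => realFourierCoeff k g * mFourier k x) (g x : ℂ) := by
  simpa using! (ContinuousMap.evalCLM ℂ x).hasSum (hasSum_smul_mFourier hg)

lemma ext_realFourierCoeff {f g : C(UnitAddTorus d, ℝ)}
    (hg : Summable fun k => realFourierCoeff k g)
    (h : ∀ k, realFourierCoeff k f = realFourierCoeff k g) : f = g := by
  have hf : Summable fun k => realFourierCoeff k f := by simpa only [h] using hg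
  ext x
  have hfx := hasSum_mul_mFourier_apply hf x
  simp only [h] at hfx
  exact_mod_cast hfx.unique (hasSum_mul_mFourier_apply hg x)

lemma enorm_reFourierSeries_le (c : (d → ℤ) → ℂ) : ‖reFourierSeries c‖ₑ ≤ ∑' k, ‖c k‖ₑ := by
  calc ‖reFourierSeries c‖ₑ ≤ ‖(∑' k, c k • mFourier k : C(UnitAddTorus d, ℂ))‖ₑ := by
        rw [enorm_le_iff_norm_le]
        exact (ContinuousMap.norm_le _ (norm_nonneg _)).2 fun x =>
          (Complex.abs_re_le_norm _).trans (ContinuousMap.norm_coe_le_norm _ x)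
    _ ≤ ∑' k, ‖c k • mFourier k‖ₑ :=
        enorm_tsum_le_tsum_enorm (ε := C(UnitAddTorus d, ℂ))
    _ = ∑' k, ‖c k‖ₑ := by simp only [enorm_smul_mFourier]

lemma realFourierCoeff_mul {f g : C(UnitAddTorus d, ℝ)}
    (hg : Summable fun k => realFourierCoeff k g) (k : d → ℤ) :
    realFourierCoeff k (f * g) = ∑' l, realFourierCoeff (k - l) f * realFourierCoeff l g := by
  have hseries : HasSum (fun l => realFourierCoeff l g • (toComplex f * mFourier l))
      (toComplex f * toComplex g) := by
    simpa only [mul_smul_comm] using (hasSum_smul_mFourier hg).mul_left (toComplex f)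
  have hshift (l : d → ℤ) :
      complexFourierCoeff k (toComplex f * mFourier l) = realFourierCoeff (k - l) f := by
    rw [complexFourierCoeff_apply, realFourierCoeff_apply, mFourierCoeff, mFourierCoeff]
    congr 1; ext x
    rw [neg_sub, sub_eq_add_neg, add_comm, mFourier_add]
    simp only [ContinuousMap.mul_apply, toComplex_apply, smul_eq_mul]; ring
  calc realFourierCoeff k (f * g) = complexFourierCoeff k (toComplex f * toComplex g) :=
        congrArg (complexFourierCoeff k) (toComplex_mul f g)
    _ = ∑' l, complexFourierCoeff k (realFourierCoeff l g • (toComplex f * mFourier l)) :=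
        ((complexFourierCoeff k).hasSum hseries).tsum_eq.symm
    _ = ∑' l, realFourierCoeff (k - l) f * realFourierCoeff l g := by
        refine tsum_congr fun l => ?_
        rw [map_smul, smul_eq_mul, hshift, mul_comm]

end FourierCoefficients

/-! ### The Wiener norms with exponential weights -/

section WienerNorm

variable {d : Type*} [Fintype d]

/-- The Euclidean length of a frequency; `freqNorm` is the case `d = Fin 3`. -/
def freqLength (k : d → ℤ) : ℝ := ‖WithLp.toLp 2 fun i => (k i : ℝ)‖

lemma freqLength_sq (k : d → ℤ) : freqLength k ^ 2 = ∑ i, (k i : ℝ) ^ 2 := by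
  simp [freqLength, EuclideanSpace.norm_sq_eq]

lemma freqLength_nonneg (k : d → ℤ) : 0 ≤ freqLength k := norm_nonneg _

lemma freqLength_zero : freqLength (0 : d → ℤ) = 0 := by
  simp [freqLength, EuclideanSpace.norm_eq]

lemma freqLength_add_le (k l : d → ℤ) : freqLength (k + l) ≤ freqLength k + freqLength l := by
  refine le_of_eq_of_le ?_ (norm_add_le _ _)
  rw [freqLength, ← WithLp.toLp_add]
  simp only [Pi.add_def, Int.cast_add]

lemma freqLength_neg (k : d → ℤ) : freqLength (-k) = freqLength k := by
  simp [freqLength, EuclideanSpace.norm_eq]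

lemma abs_le_freqLength (k : d → ℤ) (i : d) : |(k i : ℝ)| ≤ freqLength k :=
  PiLp.norm_apply_le (WithLp.toLp 2 fun i => (k i : ℝ)) i

lemma one_le_freqLength {k : d → ℤ} (hk : k ≠ 0) : 1 ≤ freqLength k := by
  obtain ⟨i, hi⟩ := Function.ne_iff.1 hk
  exact le_trans (mod_cast Int.one_le_abs hi) (abs_le_freqLength k i)

/-- The weight `e^{r|k|}`. -/
def expWeight (r : ℝ) (k : d → ℤ) : ℝ≥0∞ := ENNReal.ofReal (Real.exp (r * freqLength k))

lemma one_le_expWeight {r : ℝ} (hr : 0 ≤ r) (k : d → ℤ) : 1 ≤ expWeight r k :=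
  ENNReal.one_le_ofReal.2 (Real.one_le_exp (mul_nonneg hr (freqLength_nonneg k)))

lemma expWeight_mono {r s : ℝ} (h : r ≤ s) (k : d → ℤ) : expWeight r k ≤ expWeight s k := by
  have := freqLength_nonneg k
  unfold expWeight
  gcongr

lemma expWeight_add (r s : ℝ) (k : d → ℤ) :
    expWeight (r + s) k = expWeight r k * expWeight s k := by
  rw [expWeight, add_mul, Real.exp_add, ENNReal.ofReal_mul (Real.exp_nonneg _)]
  rfl

lemma expWeight_add_le {r : ℝ} (hr : 0 ≤ r) (k l : d → ℤ) :
    expWeight r (k + l) ≤ expWeight r k * expWeight r l := by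
  rw [expWeight, expWeight, expWeight, ← ENNReal.ofReal_mul (Real.exp_nonneg _), ← Real.exp_add,
    ← mul_add]
  gcongr
  exact freqLength_add_le k l

/-- The norm `∑ₖ |𝓕 g (k)| e^{r|k|}`, with values in `[0, ∞]`. It is the norm of `B_δ` for
`δ = e^r`. -/
def wienerNorm (r : ℝ) (g : C(UnitAddTorus d, ℝ)) : ℝ≥0∞ :=
  ∑' k, ‖realFourierCoeff k g‖ₑ * expWeight r k

lemma wienerNorm_mono {r s : ℝ} (h : r ≤ s) (g : C(UnitAddTorus d, ℝ)) :
    wienerNorm r g ≤ wienerNorm s g :=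
  ENNReal.tsum_le_tsum fun k => by gcongr; exact expWeight_mono h k

lemma tsum_enorm_le_tsum_mul_expWeight {r : ℝ} (hr : 0 ≤ r) (c : (d → ℤ) → ℂ) :
    ∑' k, ‖c k‖ₑ ≤ ∑' k, ‖c k‖ₑ * expWeight r k :=
  ENNReal.tsum_le_tsum fun k => le_mul_of_one_le_right' (one_le_expWeight hr k)

lemma summable_realFourierCoeff {r : ℝ} (hr : 0 ≤ r) {g : C(UnitAddTorus d, ℝ)}
    (hg : wienerNorm r g ≠ ⊤) : Summable fun k => realFourierCoeff k g :=
  .of_enorm (ne_top_of_le_ne_top hg (tsum_enorm_le_tsum_mul_expWeight hr _))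

lemma enorm_le_wienerNorm {r : ℝ} (hr : 0 ≤ r) (g : C(UnitAddTorus d, ℝ)) :
    ‖g‖ₑ ≤ wienerNorm r g := by
  by_cases hg : wienerNorm r g = ⊤
  · simp [hg]
  have hsum := summable_realFourierCoeff hr hg
  have hseries : reFourierSeries (fun k => realFourierCoeff k g) = g :=
    ext_realFourierCoeff hsum
      (realFourierCoeff_reFourierSeries hsum (conjSymmetric_realFourierCoeff g))
  calc ‖g‖ₑ = ‖reFourierSeries fun k => realFourierCoeff k g‖ₑ := by rw [hseries]
    _ ≤ ∑' k, ‖realFourierCoeff k g‖ₑ := enorm_reFourierSeries_le _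
    _ ≤ wienerNorm r g := tsum_enorm_le_tsum_mul_expWeight hr _

lemma abs_apply_le_of_wienerNorm_le {r : ℝ} (hr : 0 ≤ r) {C : ℝ≥0} {g : C(UnitAddTorus d, ℝ)}
    (hg : wienerNorm r g ≤ C) (x : UnitAddTorus d) : |g x| ≤ C :=
  (g.norm_coe_le_norm x).trans (mod_cast (enorm_le_wienerNorm hr g).trans hg)

lemma summable_of_tsum_wienerNorm {r : ℝ} (hr : 0 ≤ r) {ι : Type*} {f : ι → C(UnitAddTorus d, ℝ)}
    (h : ∑' n, wienerNorm r (f n) ≠ ⊤) : Summable f :=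
  .of_enorm (ne_top_of_le_ne_top h (ENNReal.tsum_le_tsum fun n => enorm_le_wienerNorm hr (f n)))

lemma wienerNorm_zero (r : ℝ) : wienerNorm r (0 : C(UnitAddTorus d, ℝ)) = 0 := by
  simp [wienerNorm]

lemma wienerNorm_neg (r : ℝ) (f : C(UnitAddTorus d, ℝ)) : wienerNorm r (-f) = wienerNorm r f := by
  simp [wienerNorm]

lemma wienerNorm_smul (r c : ℝ) (f : C(UnitAddTorus d, ℝ)) :
    wienerNorm r (c • f) = ENNReal.ofReal |c| * wienerNorm r f := by
  simp only [wienerNorm, ← ENNReal.tsum_mul_left, map_smul, enorm_smul, Real.enorm_eq_ofReal_abs,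
    mul_assoc]

lemma wienerNorm_add_le (r : ℝ) (f g : C(UnitAddTorus d, ℝ)) :
    wienerNorm r (f + g) ≤ wienerNorm r f + wienerNorm r g := by
  simp only [wienerNorm, ← ENNReal.tsum_add, map_add, ← add_mul]
  gcongr
  exact enorm_add_le _ _

lemma wienerNorm_sum_le {ι : Type*} (r : ℝ) (s : Finset ι) (f : ι → C(UnitAddTorus d, ℝ)) :
    wienerNorm r (∑ i ∈ s, f i) ≤ ∑ i ∈ s, wienerNorm r (f i) :=
  Finset.le_sum_of_subadditive (wienerNorm r) (wienerNorm_zero r).le (wienerNorm_add_le r) s f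

lemma wienerNorm_le_tsum {ι : Type*} (r : ℝ) {f : ι → C(UnitAddTorus d, ℝ)}
    {g : C(UnitAddTorus d, ℝ)} (h : HasSum f g) : wienerNorm r g ≤ ∑' n, wienerNorm r (f n) := by
  simp only [wienerNorm]
  rw [ENNReal.tsum_comm]
  refine ENNReal.tsum_le_tsum fun k => ?_
  rw [ENNReal.tsum_mul_right, ← ((realFourierCoeff k).hasSum h).tsum_eq]
  gcongr
  exact enorm_tsum_le_tsum_enorm

lemma wienerNorm_eq_zero {r : ℝ} (hr : 0 ≤ r) {g : C(UnitAddTorus d, ℝ)} :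
    wienerNorm r g = 0 ↔ g = 0 := by
  refine ⟨fun h => ?_, fun h => h ▸ wienerNorm_zero r⟩
  have hg := (enorm_le_wienerNorm hr g).trans h.le
  rwa [← ofReal_norm, nonpos_iff_eq_zero, ENNReal.ofReal_eq_zero, norm_le_zero_iff] at hg

lemma wienerNorm_mul_le {r : ℝ} (hr : 0 ≤ r) (f g : C(UnitAddTorus d, ℝ)) :
    wienerNorm r (f * g) ≤ wienerNorm r f * wienerNorm r g := by
  by_cases hg : wienerNorm r g = ⊤
  · obtain rfl | hf := eq_or_ne f 0
    · simp [wienerNorm_zero]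
    · simp [hg, ENNReal.mul_top ((wienerNorm_eq_zero hr).not.2 hf)]
  let a (k : d → ℤ) := ‖realFourierCoeff k f‖ₑ * expWeight r k
  let b (k : d → ℤ) := ‖realFourierCoeff k g‖ₑ * expWeight r k
  have hconv (k : d → ℤ) :
      ‖realFourierCoeff k (f * g)‖ₑ * expWeight r k ≤ ∑' l, a (k - l) * b l := by
    rw [realFourierCoeff_mul (summable_realFourierCoeff hr hg)]
    refine (mul_le_mul_left enorm_tsum_le_tsum_enorm _).trans ?_
    rw [← ENNReal.tsum_mul_right]
    refine ENNReal.tsum_le_tsum fun l => ?_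
    have hweight : expWeight r k ≤ expWeight r (k - l) * expWeight r l := by
      simpa using expWeight_add_le hr (k - l) l
    calc _ ≤ ‖realFourierCoeff (k - l) f * realFourierCoeff l g‖ₑ *
          (expWeight r (k - l) * expWeight r l) := by gcongr
      _ = a (k - l) * b l := by rw [enorm_mul]; ring
  calc wienerNorm r (f * g) ≤ ∑' k, ∑' l, a (k - l) * b l := ENNReal.tsum_le_tsum hconv
    _ = ∑' l, (∑' k, a (k - l)) * b l := by
        rw [ENNReal.tsum_comm]; simp only [ENNReal.tsum_mul_right]
    _ = ∑' l, (∑' k, a k) * b l :=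
        tsum_congr fun l => by rw [← (Equiv.subRight l).tsum_eq a]; rfl
    _ = wienerNorm r f * wienerNorm r g := ENNReal.tsum_mul_left

end WienerNorm


/-! ### Fourier multipliers -/

section FourierMultipliers

variable {d : Type*} [Fintype d]

/-- The Fourier multiplier with symbol `m` on real functions. The real part plays no role when `m`
is `ConjSymmetric`. -/
def fourierMultiplier (m : (d → ℤ) → ℂ) (g : C(UnitAddTorus d, ℝ)) : C(UnitAddTorus d, ℝ) :=
  reFourierSeries fun k => m k * realFourierCoeff k g

/-- The symbol `m` maps the weight `e^{s|k|}` to the weight `e^{r|k|}` with norm at most `C`. -/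
def SymbolBound (m : (d → ℤ) → ℂ) (r s : ℝ) (C : ℝ≥0) : Prop :=
  ∀ k, ‖m k‖ₑ * expWeight r k ≤ C * expWeight s k

variable {m : (d → ℤ) → ℂ} {r s : ℝ} {C : ℝ≥0} {g : C(UnitAddTorus d, ℝ)}

lemma symbolBound_of_norm_le {η : ℝ} (hm : ∀ k, ‖m k‖ ≤ C * Real.exp (η * freqLength k))
    (h : r + η ≤ s) : SymbolBound m r s C := fun k => by
  have hk : ‖m k‖ₑ ≤ C * expWeight η k := by
    rw [expWeight, ← ENNReal.ofReal_coe_nnreal, ← ENNReal.ofReal_mul C.coe_nonneg,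
      ← ofReal_norm]
    exact ENNReal.ofReal_le_ofReal (hm k)
  calc ‖m k‖ₑ * expWeight r k ≤ C * expWeight η k * expWeight r k := by gcongr
    _ = C * expWeight (r + η) k := by rw [expWeight_add]; ring
    _ ≤ C * expWeight s k := by gcongr; exact expWeight_mono h k

lemma fourierMultiplier_smul (m : (d → ℤ) → ℂ) (c : ℝ) (g : C(UnitAddTorus d, ℝ)) :
    fourierMultiplier m (c • g) = c • fourierMultiplier m g := by
  simp only [fourierMultiplier, reFourierSeries]
  rw [← map_smul, ← tsum_const_smul'']
  congr 2
  ext1 k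
  rw [map_smul, ← smul_assoc, Complex.real_smul, Complex.real_smul, mul_left_comm]

lemma realFourierCoeff_fourierMultiplier (hm : ConjSymmetric m)
    (h : Summable fun k => m k * realFourierCoeff k g) (k : d → ℤ) :
    realFourierCoeff k (fourierMultiplier m g) = m k * realFourierCoeff k g :=
  realFourierCoeff_reFourierSeries h (hm.mul (conjSymmetric_realFourierCoeff g)) k

lemma SymbolBound.tsum_le (h : SymbolBound m r s C) (g : C(UnitAddTorus d, ℝ)) :
    ∑' k, ‖m k * realFourierCoeff k g‖ₑ * expWeight r k ≤ C * wienerNorm s g := by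
  rw [wienerNorm, ← ENNReal.tsum_mul_left]
  refine ENNReal.tsum_le_tsum fun k => ?_
  calc ‖m k * realFourierCoeff k g‖ₑ * expWeight r k
      = ‖m k‖ₑ * expWeight r k * ‖realFourierCoeff k g‖ₑ := by rw [enorm_mul]; ring
    _ ≤ C * expWeight s k * ‖realFourierCoeff k g‖ₑ := mul_le_mul' (h k) le_rfl
    _ = C * (‖realFourierCoeff k g‖ₑ * expWeight s k) := by ring

lemma SymbolBound.summable (h : SymbolBound m r s C) (hr : 0 ≤ r) (hg : wienerNorm s g ≠ ⊤) :
    Summable fun k => m k * realFourierCoeff k g :=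
  .of_enorm <| ne_top_of_le_ne_top (ENNReal.mul_ne_top ENNReal.coe_ne_top hg)
    ((tsum_enorm_le_tsum_mul_expWeight hr _).trans (h.tsum_le g))

lemma SymbolBound.wienerNorm_le (h : SymbolBound m r s C) (hm : ConjSymmetric m) (hr : 0 ≤ r)
    (hg : wienerNorm s g ≠ ⊤) : wienerNorm r (fourierMultiplier m g) ≤ C * wienerNorm s g := by
  rw [wienerNorm]
  simp only [realFourierCoeff_fourierMultiplier hm (h.summable hr hg)]
  exact h.tsum_le g

lemma SymbolBound.tsum_wienerNorm_ne_top (h : SymbolBound m r s C) (hm : ConjSymmetric m)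
    (hr : 0 ≤ r) {ι : Type*} {f : ι → C(UnitAddTorus d, ℝ)} (hs : ∑' n, wienerNorm s (f n) ≠ ⊤) :
    ∑' n, wienerNorm r (fourierMultiplier m (f n)) ≠ ⊤ := by
  refine ne_top_of_le_ne_top (b := C * ∑' n, wienerNorm s (f n))
    (ENNReal.mul_ne_top ENNReal.coe_ne_top hs) ?_
  rw [← ENNReal.tsum_mul_left]
  exact ENNReal.tsum_le_tsum fun n =>
    h.wienerNorm_le hm hr (ENNReal.ne_top_of_tsum_ne_top hs n)

lemma SymbolBound.hasSum_fourierMultiplier (h : SymbolBound m r s C) (hm : ConjSymmetric m)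
    (hr : 0 ≤ r) {ι : Type*} {f : ι → C(UnitAddTorus d, ℝ)} (hf : HasSum f g)
    (hs : ∑' n, wienerNorm s (f n) ≠ ⊤) :
    HasSum (fun n => fourierMultiplier m (f n)) (fourierMultiplier m g) := by
  have hfs (n : ι) : Summable fun k => m k * realFourierCoeff k (f n) :=
    h.summable hr (ENNReal.ne_top_of_tsum_ne_top hs n)
  have hgs : Summable fun k => m k * realFourierCoeff k g :=
    h.summable hr (ne_top_of_le_ne_top hs (wienerNorm_le_tsum s hf))
  have hsum := summable_of_tsum_wienerNorm hr (h.tsum_wienerNorm_ne_top hm hr hs)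
  suffices heq : ∑' n, fourierMultiplier m (f n) = fourierMultiplier m g from heq ▸ hsum.hasSum
  refine ext_realFourierCoeff ?_ fun k => ?_
  · simpa only [realFourierCoeff_fourierMultiplier hm hgs] using hgs
  · rw [(realFourierCoeff k).map_tsum hsum, realFourierCoeff_fourierMultiplier hm hgs]
    simp only [realFourierCoeff_fourierMultiplier hm (hfs _)]
    rw [tsum_mul_left, ((realFourierCoeff k).hasSum hf).tsum_eq]

end FourierMultipliers

/-! ### Partial derivatives and the Poisson equation in Fourier space -/

section Symbols

variable {d : Type*}

/-- The symbol `2πikᵢ` of `∂ᵢ`. -/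
def partialSymbol (i : d) (k : d → ℤ) : ℂ := 2 * Real.pi * Complex.I * (k i : ℂ)

lemma conjSymmetric_partialSymbol (i : d) : ConjSymmetric (partialSymbol i) := fun k => by
  simp [partialSymbol, Complex.conj_ofReal, map_ofNat]

variable [Fintype d]

/-- The symbol `(4π²|k|²)⁻¹` of `(-Δ)⁻¹` on functions of mean zero; it vanishes at `k = 0`, where
the division by zero gives `0`. -/
def poissonSymbol (k : d → ℤ) : ℂ := (((4 * Real.pi ^ 2 * freqLength k ^ 2)⁻¹ : ℝ) : ℂ)

/-- The partial derivative `∂ᵢ`, as a Fourier multiplier. -/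
def partialDeriv (i : d) (g : C(UnitAddTorus d, ℝ)) : C(UnitAddTorus d, ℝ) :=
  fourierMultiplier (partialSymbol i) g

/-- The solution `φ` of mean zero of `-Δφ = g - ∫ g`. -/
def poissonPotential (g : C(UnitAddTorus d, ℝ)) : C(UnitAddTorus d, ℝ) :=
  fourierMultiplier poissonSymbol g

/-- The derivative `∂ᵢφ` of the solution `φ` of mean zero of `-Δφ = g - ∫ g`. -/
def gradPotential (i : d) (g : C(UnitAddTorus d, ℝ)) : C(UnitAddTorus d, ℝ) :=
  fourierMultiplier (fun k => partialSymbol i k * poissonSymbol k) g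

lemma conjSymmetric_poissonSymbol : ConjSymmetric (poissonSymbol (d := d)) := fun k => by
  rw [poissonSymbol, poissonSymbol, freqLength_neg, Complex.conj_ofReal]

lemma conjSymmetric_partialSymbol_mul_poissonSymbol (i : d) :
    ConjSymmetric fun k => partialSymbol i k * poissonSymbol k :=
  (conjSymmetric_partialSymbol i).mul conjSymmetric_poissonSymbol

lemma norm_partialSymbol_le (i : d) (k : d → ℤ) :
    ‖partialSymbol i k‖ ≤ 2 * Real.pi * freqLength k := by
  simp only [partialSymbol, norm_mul, Complex.norm_I, Complex.norm_real, Complex.norm_intCast,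
    mul_one, Complex.norm_ofNat, Real.norm_eq_abs, abs_of_pos Real.pi_pos]
  gcongr
  exact abs_le_freqLength k i

lemma norm_poissonSymbol (k : d → ℤ) :
    ‖poissonSymbol k‖ = (4 * Real.pi ^ 2 * freqLength k ^ 2)⁻¹ := by
  rw [poissonSymbol, Complex.norm_real, Real.norm_eq_abs, abs_of_nonneg (by positivity)]

lemma norm_poissonSymbol_le_one (k : d → ℤ) : ‖poissonSymbol k‖ ≤ 1 := by
  obtain rfl | hk := eq_or_ne k 0
  · simp [norm_poissonSymbol, freqLength_zero]
  · rw [norm_poissonSymbol]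
    have hpi := one_le_pow₀ (n := 2) (one_le_two.trans Real.two_le_pi)
    have hlen := one_le_pow₀ (n := 2) (one_le_freqLength hk)
    exact inv_le_one_of_one_le₀ (one_le_mul_of_one_le_of_one_le (by linarith) hlen)

lemma norm_partialSymbol_mul_poissonSymbol_le_one (i : d) (k : d → ℤ) :
    ‖partialSymbol i k * poissonSymbol k‖ ≤ 1 := by
  obtain rfl | hk := eq_or_ne k 0
  · simp [partialSymbol]
  have hlen : 1 ≤ 2 * Real.pi * freqLength k :=
    one_le_mul_of_one_le_of_one_le (by linarith [Real.pi_gt_three]) (one_le_freqLength hk)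
  calc ‖partialSymbol i k * poissonSymbol k‖
      ≤ 2 * Real.pi * freqLength k * (4 * Real.pi ^ 2 * freqLength k ^ 2)⁻¹ := by
        rw [norm_mul, norm_poissonSymbol]
        gcongr
        exact norm_partialSymbol_le i k
    _ = (2 * Real.pi * freqLength k)⁻¹ := by
        have := one_le_freqLength hk
        field_simp
        ring
    _ ≤ 1 := inv_le_one_of_one_le₀ hlen

/-- Cauchy's estimate: `|k| ≤ e^{η|k|}/η` lets a loss `η` in the weight absorb a derivative. -/
lemma symbolBound_partialSymbol (i : d) {r s : ℝ} {η : ℝ≥0} (hη : 0 < η) (h : r + η ≤ s) :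
    SymbolBound (partialSymbol i) r s (2 * NNReal.pi / η) := by
  refine symbolBound_of_norm_le (η := η) (fun k => ?_) h
  have hexp : η * freqLength k ≤ Real.exp (η * freqLength k) :=
    (le_add_of_nonneg_right zero_le_one).trans (Real.add_one_le_exp _)
  calc ‖partialSymbol i k‖ ≤ 2 * Real.pi * freqLength k := norm_partialSymbol_le i k
    _ = 2 * Real.pi / η * (η * freqLength k) := by field_simp
    _ ≤ 2 * Real.pi / η * Real.exp (η * freqLength k) := by gcongr
    _ = (2 * NNReal.pi / η : ℝ≥0) * Real.exp (η * freqLength k) := by push_cast; rfl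

lemma symbolBound_poissonSymbol (r : ℝ) : SymbolBound (poissonSymbol (d := d)) r r 1 :=
  symbolBound_of_norm_le (η := 0) (by simpa using norm_poissonSymbol_le_one) (add_zero r).le

lemma symbolBound_partialSymbol_mul_poissonSymbol (i : d) (r : ℝ) :
    SymbolBound (fun k => partialSymbol i k * poissonSymbol k) r r 1 :=
  symbolBound_of_norm_le (η := 0)
    (by simpa only [zero_mul, Real.exp_zero, NNReal.coe_one, mul_one] using
      norm_partialSymbol_mul_poissonSymbol_le_one i) (add_zero r).le

variable {r s : ℝ} {g : C(UnitAddTorus d, ℝ)}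

lemma wienerNorm_poissonPotential_le (hr : 0 ≤ r) (hg : wienerNorm r g ≠ ⊤) :
    wienerNorm r (poissonPotential g) ≤ wienerNorm r g := by
  simpa [poissonPotential] using
    (symbolBound_poissonSymbol r).wienerNorm_le conjSymmetric_poissonSymbol hr hg

lemma wienerNorm_gradPotential_le (hr : 0 ≤ r) (i : d) (hg : wienerNorm r g ≠ ⊤) :
    wienerNorm r (gradPotential i g) ≤ wienerNorm r g := by
  simpa [gradPotential] using (symbolBound_partialSymbol_mul_poissonSymbol i r).wienerNorm_le
    (conjSymmetric_partialSymbol_mul_poissonSymbol i) hr hg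

lemma wienerNorm_partialDeriv_le (hr : 0 ≤ r) {η : ℝ≥0} (hη : 0 < η) (h : r + η ≤ s) (i : d)
    (hg : wienerNorm s g ≠ ⊤) :
    wienerNorm r (partialDeriv i g) ≤ (2 * NNReal.pi / η : ℝ≥0) * wienerNorm s g :=
  (symbolBound_partialSymbol i hη h).wienerNorm_le (conjSymmetric_partialSymbol i) hr hg

lemma wienerNorm_partialDeriv_ne_top (hr : 0 ≤ r) (h : r < s) (i : d) (hg : wienerNorm s g ≠ ⊤) :
    wienerNorm r (partialDeriv i g) ≠ ⊤ :=
  ne_top_of_le_ne_top (ENNReal.mul_ne_top ENNReal.coe_ne_top hg)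
    (wienerNorm_partialDeriv_le hr (η := ⟨s - r, (sub_pos.2 h).le⟩) (sub_pos.2 h)
      (add_sub_cancel r s).le i hg)

lemma summable_partialSymbol_mul_realFourierCoeff (hr : 0 < r) (i : d) (hg : wienerNorm r g ≠ ⊤) :
    Summable fun k => partialSymbol i k * realFourierCoeff k g :=
  (symbolBound_partialSymbol i (η := ⟨r, hr.le⟩) hr (zero_add r).le).summable le_rfl hg

lemma realFourierCoeff_partialDeriv (hr : 0 < r) (i : d) (hg : wienerNorm r g ≠ ⊤) (k : d → ℤ) :
    realFourierCoeff k (partialDeriv i g) = partialSymbol i k * realFourierCoeff k g :=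
  realFourierCoeff_fourierMultiplier (conjSymmetric_partialSymbol i)
    (summable_partialSymbol_mul_realFourierCoeff hr i hg) k

lemma realFourierCoeff_poissonPotential (hr : 0 ≤ r) (hg : wienerNorm r g ≠ ⊤) (k : d → ℤ) :
    realFourierCoeff k (poissonPotential g) = poissonSymbol k * realFourierCoeff k g :=
  realFourierCoeff_fourierMultiplier conjSymmetric_poissonSymbol
    ((symbolBound_poissonSymbol r).summable hr hg) k

lemma partialDeriv_poissonPotential (hr : 0 ≤ r) (i : d) (hg : wienerNorm r g ≠ ⊤) :
    partialDeriv i (poissonPotential g) = gradPotential i g := by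
  simp only [partialDeriv, gradPotential, fourierMultiplier,
    realFourierCoeff_poissonPotential hr hg, mul_assoc]

lemma sum_partialSymbol_mul_poissonSymbol {k : d → ℤ} (hk : k ≠ 0) :
    ∑ i, partialSymbol i k * (partialSymbol i k * poissonSymbol k) = -1 := by
  have hlen : (freqLength k : ℂ) ≠ 0 := mod_cast (zero_lt_one.trans_le (one_le_freqLength hk)).ne'
  have hsq : (freqLength k : ℂ) ^ 2 = ∑ i, (k i : ℂ) ^ 2 := mod_cast
    congrArg Complex.ofReal (freqLength_sq k)
  have hpi : (Real.pi : ℂ) ≠ 0 := mod_cast Real.pi_ne_zero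
  calc ∑ i, partialSymbol i k * (partialSymbol i k * poissonSymbol k)
      = -(4 * (Real.pi : ℂ) ^ 2 * ∑ i, (k i : ℂ) ^ 2) * poissonSymbol k := by
        rw [Finset.mul_sum, ← Finset.sum_neg_distrib, Finset.sum_mul]
        refine Finset.sum_congr rfl fun i _ => ?_
        rw [partialSymbol]
        linear_combination
          (4 * (Real.pi : ℂ) ^ 2 * (k i : ℂ) ^ 2 * poissonSymbol k) * Complex.I_sq
    _ = -1 := by
        rw [← hsq, poissonSymbol]
        push_cast
        field_simp

lemma realFourierCoeff_sum_partialDeriv_gradPotential (hr : 0 < r) (hg : wienerNorm r g ≠ ⊤)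
    (k : d → ℤ) : realFourierCoeff k (∑ i, partialDeriv i (gradPotential i g)) =
      (∑ i, partialSymbol i k * (partialSymbol i k * poissonSymbol k)) * realFourierCoeff k g := by
  rw [map_sum, Finset.sum_mul]
  refine Finset.sum_congr rfl fun i _ => ?_
  rw [realFourierCoeff_partialDeriv hr i
      (ne_top_of_le_ne_top hg (wienerNorm_gradPotential_le hr.le i hg)), gradPotential,
    realFourierCoeff_fourierMultiplier (conjSymmetric_partialSymbol_mul_poissonSymbol i)
      ((symbolBound_partialSymbol_mul_poissonSymbol i r).summable hr.le hg)]
  ring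

lemma sum_partialDeriv_gradPotential (hr : 0 < r) (hg : wienerNorm r g ≠ ⊤) :
    ∑ i, partialDeriv i (gradPotential i g) =
      ContinuousMap.const _ (∫ x, g x ∂torusHaar d) - g := by
  refine ext_realFourierCoeff ?_ fun k => ?_
  · have hconst : Summable fun k : d → ℤ =>
        realFourierCoeff k (ContinuousMap.const _ (∫ x, g x ∂torusHaar d)) := by
      simp only [realFourierCoeff_const]
      exact (hasSum_ite_eq 0 _).summable
    simpa only [map_sub] using hconst.sub (summable_realFourierCoeff hr.le hg)
  · rw [realFourierCoeff_sum_partialDeriv_gradPotential hr hg, map_sub, realFourierCoeff_const]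
    obtain rfl | hk := eq_or_ne k 0
    · simp [partialSymbol, realFourierCoeff_zero]
    · simp [sum_partialSymbol_mul_poissonSymbol hk, hk]

end Symbols

/-! ### Differentiability of functions with finite Wiener norm -/

section CoveringMap

variable {d : Type*}

/-- The covering map `ℝ^d → (ℝ/ℤ)^d`; `torusProj` is the case `d = Fin 3`. -/
def torusCover (v : d → ℝ) : UnitAddTorus d := fun i => (v i : UnitAddCircle)

lemma isOpenQuotientMap_torusCover : IsOpenQuotientMap (torusCover (d := d)) :=
  .piMap fun _ => QuotientAddGroup.isOpenQuotientMap_mk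

lemma torusCover_zero : torusCover (0 : d → ℝ) = 0 := rfl

lemma torusCover_add (v w : d → ℝ) : torusCover (v + w) = torusCover v + torusCover w := rfl

lemma torusCover_single [DecidableEq d] (i : d) (s : ℝ) :
    torusCover (Pi.single i s) = Pi.single i (s : UnitAddCircle) :=
  (Pi.single_op (fun _ (a : ℝ) => (a : UnitAddCircle)) (fun _ => rfl) i s).symm

lemma exists_torusCover_eq (x : UnitAddTorus d) : ∃ v ∈ Icc (0 : d → ℝ) 1, torusCover v = x := by
  refine ⟨fun i => AddCircle.equivIco 1 0 (x i), ⟨fun i => ?_, fun i => ?_⟩, funext fun i => ?_⟩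
  · exact (AddCircle.equivIco 1 0 (x i)).2.1
  · simpa using (AddCircle.equivIco 1 0 (x i)).2.2.le
  · exact (AddCircle.equivIco 1 0).symm_apply_apply (x i)

lemma hasDerivAt_add_single [Finite d] [DecidableEq d] {E : Type*} [NormedAddCommGroup E]
    [NormedSpace ℝ E] {g : UnitAddTorus d → E} {v : d → ℝ} {L : (d → ℝ) →L[ℝ] E}
    (h : HasFDerivAt (fun w => g (torusCover w)) L v) (i : d) :
    HasDerivAt (fun s : ℝ => g (torusCover v + Pi.single i (s : UnitAddCircle)))
      (L (Pi.single i 1)) 0 := by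
  have := Fintype.ofFinite d
  have hline : HasDerivAt (fun s : ℝ => v + Pi.single i s) (Pi.single i 1) 0 :=
    (hasDerivAt_single i (0 : ℝ)).const_add v
  have hv : HasFDerivAt (fun w => g (torusCover w)) L (v + Pi.single i (0 : ℝ)) := by
    simpa using h
  refine (hv.comp_hasDerivAt (0 : ℝ) hline).congr_of_eventuallyEq (.of_forall fun s => ?_)
  simp only [Function.comp, torusCover_add, torusCover_single]

/-- The `i`-th coordinate on `ℝ^d`, as a real functional with complex values. -/
def complexCoord (i : d) : (d → ℝ) →L[ℝ] ℂ := Complex.ofRealCLM ∘L .proj i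

lemma complexCoord_apply (i : d) (v : d → ℝ) : complexCoord i v = (v i : ℂ) := rfl

variable [Fintype d]

lemma mFourier_torusCover (k : d → ℤ) (v : d → ℝ) :
    mFourier k (torusCover v) = Complex.exp (∑ i, partialSymbol i k * (v i : ℂ)) := by
  rw [Complex.exp_sum]
  simp only [mFourier, ContinuousMap.coe_mk, torusCover]
  refine Finset.prod_congr rfl fun i _ => ?_
  rw [fourier_coe_apply, partialSymbol]
  congr 1
  simp

lemma norm_complexCoord_le (i : d) : ‖complexCoord i‖ ≤ 1 :=
  ContinuousLinearMap.opNorm_le_bound _ zero_le_one fun w => by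
    simpa [complexCoord_apply] using norm_le_pi_norm w i

lemma hasFDerivAt_mFourier (k : d → ℤ) (v : d → ℝ) :
    HasFDerivAt (fun w => mFourier k (torusCover w))
      (∑ i, (partialSymbol i k * mFourier k (torusCover v)) • complexCoord i) v := by
  simp only [mFourier_torusCover]
  have hexp := (HasFDerivAt.fun_sum (u := Finset.univ) fun i _ =>
    (complexCoord i).hasFDerivAt (x := v) |>.const_mul (partialSymbol i k)).cexp
  simpa only [Finset.smul_sum, smul_smul, mul_comm, complexCoord_apply] using! hexp

variable {r : ℝ} {g : C(UnitAddTorus d, ℝ)}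

lemma summable_realFourierCoeff_partialDeriv (hr : 0 < r) (i : d) (hg : wienerNorm r g ≠ ⊤) :
    Summable fun k => realFourierCoeff k (partialDeriv i g) := by
  simpa only [realFourierCoeff_partialDeriv hr i hg] using
    summable_partialSymbol_mul_realFourierCoeff hr i hg

lemma hasFDerivAt_comp_torusCover (hr : 0 < r) (hg : wienerNorm r g ≠ ⊤) (v : d → ℝ) :
    HasFDerivAt (fun w => g (torusCover w))
      (∑ i, partialDeriv i g (torusCover v) •
        ContinuousLinearMap.proj (R := ℝ) (φ := fun _ => ℝ) i) v := by
  have hsum (i : d) := summable_realFourierCoeff_partialDeriv hr i hg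
  have hseries (w : d → ℝ) :=
    hasSum_mul_mFourier_apply (summable_realFourierCoeff hr.le hg) (torusCover w)
  have hterm (k : d → ℤ) (w : d → ℝ) :
      HasFDerivAt (fun w => realFourierCoeff k g * mFourier k (torusCover w))
        (∑ i, (realFourierCoeff k (partialDeriv i g) * mFourier k (torusCover w)) •
          complexCoord i) w := by
    refine ((hasFDerivAt_mFourier k w).const_mul (realFourierCoeff k g)).congr_fderiv ?_
    simp only [Finset.smul_sum, smul_smul, realFourierCoeff_partialDeriv hr _ hg]
    simp only [mul_left_comm, mul_assoc]
  have hbound (k : d → ℤ) (w : d → ℝ) :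
      ‖∑ i, (realFourierCoeff k (partialDeriv i g) * mFourier k (torusCover w)) •
        complexCoord i‖ ≤ ∑ i, ‖realFourierCoeff k (partialDeriv i g)‖ := by
    refine norm_sum_le_of_le _ fun i _ => ?_
    rw [norm_smul, norm_mul, norm_mFourier_apply, mul_one]
    exact mul_le_of_le_one_right (norm_nonneg _) (norm_complexCoord_le i)
  have hderiv := hasFDerivAt_tsum (x₀ := v) (summable_sum fun i _ => (hsum i).norm) hterm hbound
    (hseries v).summable v
  have hlimit : ∑' k, ∑ i, (realFourierCoeff k (partialDeriv i g) * mFourier k (torusCover v)) •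
      complexCoord i = ∑ i, (partialDeriv i g (torusCover v) : ℂ) • complexCoord i :=
    (hasSum_sum fun i _ =>
      (hasSum_mul_mFourier_apply (hsum i) (torusCover v)).smul_const (complexCoord i)).tsum_eq
  rw [hlimit, funext fun w => (hseries w).tsum_eq] at hderiv
  refine (Complex.reCLM.hasFDerivAt.comp v hderiv).congr_fderiv ?_
  ext w
  simp [complexCoord_apply]

lemma hasDerivAt_partialDeriv [DecidableEq d] (hr : 0 < r) (hg : wienerNorm r g ≠ ⊤) (i : d)
    (x : UnitAddTorus d) :
    HasDerivAt (fun s : ℝ => g (x + Pi.single i (s : UnitAddCircle))) (partialDeriv i g x) 0 := by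
  obtain ⟨v, -, rfl⟩ := exists_torusCover_eq x
  simpa [Pi.single_apply] using
    hasDerivAt_add_single (g := g) (hasFDerivAt_comp_torusCover hr hg v) i

lemma contDiff_comp_torusCover (n : ℕ) (hr : 0 < r) (hg : wienerNorm r g ≠ ⊤) :
    ContDiff ℝ n fun v => g (torusCover v) := by
  induction n generalizing r g with
  | zero => exact contDiff_zero.2 (g.continuous.comp isOpenQuotientMap_torusCover.continuous)
  | succ n ih =>
    have hderiv := hasFDerivAt_comp_torusCover hr hg
    rw [Nat.cast_succ, contDiff_succ_iff_fderiv]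
    refine ⟨fun v => (hderiv v).differentiableAt, by simp, ?_⟩
    rw [funext fun v => (hderiv v).fderiv]
    exact .sum fun i _ => .smul (ih (half_pos hr)
      (wienerNorm_partialDeriv_ne_top (half_pos hr).le (half_lt_self hr) i hg)) contDiff_const

end CoveringMap

/-! ### The three-dimensional torus -/

section ThreeTorus

variable {δ r : ℝ} {g : C(T3, ℝ)}

lemma freqNorm_eq_freqLength (k : Fin 3 → ℤ) : freqNorm k = freqLength k := by
  simp [freqNorm, freqLength, EuclideanSpace.norm_eq]

lemma bTerm_eq_toReal (hδ : 0 < δ) (g : C(T3, ℝ)) (k : Fin 3 → ℤ) :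
    bTerm δ g k = (‖realFourierCoeff k g‖ₑ * expWeight (Real.log δ) k).toReal := by
  rw [ENNReal.toReal_mul, toReal_enorm, expWeight, ENNReal.toReal_ofReal (Real.exp_nonneg _),
    bTerm, realFourierCoeff_apply, Real.rpow_def_of_pos hδ, freqNorm_eq_freqLength]

lemma enorm_mul_expWeight_ne_top (r : ℝ) (g : C(T3, ℝ)) (k : Fin 3 → ℤ) :
    ‖realFourierCoeff k g‖ₑ * expWeight r k ≠ ⊤ :=
  ENNReal.mul_ne_top enorm_ne_top ENNReal.ofReal_ne_top

lemma memB_of_wienerNorm_ne_top (hδ : 0 < δ) (hg : wienerNorm (Real.log δ) g ≠ ⊤) :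
    MemB δ g :=
  (ENNReal.summable_toReal hg).congr fun k => (bTerm_eq_toReal hδ g k).symm

lemma bNorm_eq_toReal (hδ : 0 < δ) (g : C(T3, ℝ)) :
    bNorm δ g = (wienerNorm (Real.log δ) g).toReal := by
  rw [wienerNorm, ENNReal.tsum_toReal_eq (enorm_mul_expWeight_ne_top _ g)]
  exact tsum_congr (bTerm_eq_toReal hδ g)

lemma wienerNorm_eq_ofReal_bNorm (hδ : 0 < δ) (hg : MemB δ g) :
    wienerNorm (Real.log δ) g = ENNReal.ofReal (bNorm δ g) := by
  have hnonneg (k : Fin 3 → ℤ) : 0 ≤ bTerm δ g k :=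
    bTerm_eq_toReal hδ g k ▸ ENNReal.toReal_nonneg
  rw [bNorm, ENNReal.ofReal_tsum_of_nonneg hnonneg hg]
  refine tsum_congr fun k => ?_
  rw [bTerm_eq_toReal hδ, ENNReal.ofReal_toReal (enorm_mul_expWeight_ne_top _ g k)]

lemma torusContDiff_of_wienerNorm_ne_top (n : ℕ) (hr : 0 < r) (hg : wienerNorm r g ≠ ⊤) :
    TorusContDiff n g :=
  contDiff_comp_torusCover n hr hg

lemma torusPartial_apply_torusProj {f : T3 → ℝ} {v : Fin 3 → ℝ} {L : (Fin 3 → ℝ) →L[ℝ] ℝ}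
    (h : HasFDerivAt (fun w => f (torusProj w)) L v) (i : Fin 3) :
    torusPartial i f (torusProj v) = L (Pi.single i 1) :=
  (hasDerivAt_add_single h i).deriv

lemma torusPartial_eq_partialDeriv (hr : 0 < r) (hg : wienerNorm r g ≠ ⊤) (i : Fin 3) :
    torusPartial i g = partialDeriv i g :=
  funext fun x => (hasDerivAt_partialDeriv hr hg i x).deriv

lemma torusLaplacian_poissonPotential (hr : 0 < r) (hg : wienerNorm r g ≠ ⊤) (x : T3) :
    -torusLaplacian (poissonPotential g) x = g x - ∫ y, g y ∂torusMeasure := by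
  have hpot : wienerNorm r (poissonPotential g) ≠ ⊤ :=
    ne_top_of_le_ne_top hg (wienerNorm_poissonPotential_le hr.le hg)
  have hgrad (i : Fin 3) : wienerNorm r (gradPotential i g) ≠ ⊤ :=
    ne_top_of_le_ne_top hg (wienerNorm_gradPotential_le hr.le i hg)
  simp only [torusLaplacian, torusPartial_eq_partialDeriv hr hpot,
    partialDeriv_poissonPotential hr.le _ hg, torusPartial_eq_partialDeriv hr (hgrad _)]
  rw [← ContinuousMap.sum_apply, sum_partialDeriv_gradPotential hr hg]
  exact neg_sub _ _

end ThreeTorus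

/-! ### Families of functions and their averages -/

section Families

lemma measurable_of_hasDerivAt {α : Type*} [MeasurableSpace α] {F : ℝ → α → ℝ} {F' : α → ℝ}
    {t : ℝ} (hF : ∀ s, Measurable (F s)) (h : ∀ a, HasDerivAt (fun s => F s a) (F' a) t) :
    Measurable F' := by
  have hstep : Tendsto (fun n : ℕ => ((n : ℝ) + 1)⁻¹) atTop (𝓝[≠] 0) := by
    refine tendsto_nhdsWithin_iff.2 ⟨?_, .of_forall fun n => inv_ne_zero n.cast_add_one_pos.ne'⟩
    simpa only [one_div] using tendsto_one_div_add_atTop_nhds_zero_nat (𝕜 := ℝ)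
  refine measurable_of_tendsto_metrizable
    (f := fun (n : ℕ) a => ((n : ℝ) + 1)⁻¹⁻¹ • (F (t + ((n : ℝ) + 1)⁻¹) a - F t a))
    (fun n => ((hF _).sub (hF _)).const_smul (((n : ℝ) + 1)⁻¹⁻¹)) <| tendsto_pi_nhds.2 fun a =>
    (hasDerivAt_iff_tendsto_slope_zero.1 (h a)).comp hstep

variable {d M : Type*} [Fintype d] [MeasurableSpace M]

/-- The functions `g θ` depend measurably on `θ` and have Wiener norms of radius `r` at most `C`. -/
structure IsBoundedFamily (r : ℝ) (C : ℝ≥0) (g : M → C(UnitAddTorus d, ℝ)) : Prop where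
  measurable : ∀ x, Measurable fun θ => g θ x
  wienerNorm_le : ∀ θ, wienerNorm r (g θ) ≤ C

namespace IsBoundedFamily

variable {r s : ℝ} {C C' : ℝ≥0} {f g : M → C(UnitAddTorus d, ℝ)}

lemma wienerNorm_ne_top (hg : IsBoundedFamily r C g) (θ : M) : wienerNorm r (g θ) ≠ ⊤ :=
  ne_top_of_le_ne_top ENNReal.coe_ne_top (hg.wienerNorm_le θ)

lemma abs_apply_le (hg : IsBoundedFamily r C g) (hr : 0 ≤ r) (θ : M) (x : UnitAddTorus d) :
    |g θ x| ≤ C :=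
  abs_apply_le_of_wienerNorm_le hr (hg.wienerNorm_le θ) x

lemma mono (hg : IsBoundedFamily s C g) (hr : r ≤ s) (hC : C ≤ C') : IsBoundedFamily r C' g where
  measurable := hg.measurable
  wienerNorm_le θ := (wienerNorm_mono hr _).trans ((hg.wienerNorm_le θ).trans (mod_cast hC))

lemma const {f : C(UnitAddTorus d, ℝ)} (hf : wienerNorm r f ≤ C) :
    IsBoundedFamily r C fun _ : M => f where
  measurable _ := measurable_const
  wienerNorm_le _ := hf

lemma neg (hg : IsBoundedFamily r C g) : IsBoundedFamily r C fun θ => -g θ where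
  measurable x := (hg.measurable x).neg
  wienerNorm_le θ := (wienerNorm_neg r _).trans_le (hg.wienerNorm_le θ)

lemma smul (hg : IsBoundedFamily r C g) (c : ℝ) :
    IsBoundedFamily r (‖c‖₊ * C) fun θ => c • g θ where
  measurable x := (hg.measurable x).const_smul c
  wienerNorm_le θ := by
    rw [wienerNorm_smul, ← Real.enorm_eq_ofReal_abs, ENNReal.coe_mul]
    exact mul_le_mul' le_rfl (hg.wienerNorm_le θ)

lemma add (hf : IsBoundedFamily r C f) (hg : IsBoundedFamily r C' g) :
    IsBoundedFamily r (C + C') fun θ => f θ + g θ where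
  measurable x := (hf.measurable x).add (hg.measurable x)
  wienerNorm_le θ := by
    rw [ENNReal.coe_add]
    exact (wienerNorm_add_le r _ _).trans (add_le_add (hf.wienerNorm_le θ) (hg.wienerNorm_le θ))

lemma sum {ι : Type*} {t : Finset ι} {g : ι → M → C(UnitAddTorus d, ℝ)} {C : ι → ℝ≥0}
    (hg : ∀ i ∈ t, IsBoundedFamily r (C i) (g i)) :
    IsBoundedFamily r (∑ i ∈ t, C i) fun θ => ∑ i ∈ t, g i θ where
  measurable x := by
    simp only [ContinuousMap.sum_apply]
    exact Finset.measurable_sum t fun i hi => (hg i hi).measurable x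
  wienerNorm_le θ := by
    rw [ENNReal.ofNNReal_finsetSum]
    exact (wienerNorm_sum_le r t _).trans
      (Finset.sum_le_sum fun i hi => (hg i hi).wienerNorm_le θ)

lemma mul (hr : 0 ≤ r) (hf : IsBoundedFamily r C f) (hg : IsBoundedFamily r C' g) :
    IsBoundedFamily r (C * C') fun θ => f θ * g θ where
  measurable x := (hf.measurable x).mul (hg.measurable x)
  wienerNorm_le θ := by
    rw [ENNReal.coe_mul]
    exact (wienerNorm_mul_le hr _ _).trans
      (mul_le_mul' (hf.wienerNorm_le θ) (hg.wienerNorm_le θ))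

lemma partialDeriv (hr : 0 ≤ r) {η : ℝ≥0} (hη : 0 < η) (h : r + η ≤ s)
    (hg : IsBoundedFamily s C g) (i : d) :
    IsBoundedFamily r (2 * NNReal.pi / η * C) fun θ => partialDeriv i (g θ) where
  measurable x := by
    classical
    exact measurable_of_hasDerivAt (fun _ => hg.measurable _) fun θ => hasDerivAt_partialDeriv
      ((add_pos_of_nonneg_of_pos hr hη).trans_le h) (hg.wienerNorm_ne_top θ) i x
  wienerNorm_le θ := by
    rw [ENNReal.coe_mul]
    exact (wienerNorm_partialDeriv_le hr hη h i (hg.wienerNorm_ne_top θ)).trans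
      (mul_le_mul' le_rfl (hg.wienerNorm_le θ))

end IsBoundedFamily

lemma measurable_uncurry_of_measurable_apply {X : Type*} [TopologicalSpace X]
    [TopologicalSpace.MetrizableSpace X] [SecondCountableTopology X] [MeasurableSpace X]
    [OpensMeasurableSpace X] {g : M → C(X, ℝ)} (hg : ∀ x, Measurable fun θ => g θ x) :
    Measurable fun p : M × X => g p.1 p.2 :=
  (measurable_uncurry_of_continuous_of_measurable (u := fun x θ => g θ x)
    (fun θ => (g θ).continuous) hg).comp measurable_swap

lemma measurable_realFourierCoeff {g : M → C(UnitAddTorus d, ℝ)}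
    (hg : ∀ x, Measurable fun θ => g θ x) (k : d → ℤ) :
    Measurable fun θ => realFourierCoeff k (g θ) := by
  simp only [realFourierCoeff_eq_integral]
  have h : Measurable fun p : M × UnitAddTorus d => mFourier (-k) p.2 * (g p.1 p.2 : ℂ) :=
    ((mFourier (-k)).continuous.measurable.comp measurable_snd).mul
      (Complex.measurable_ofReal.comp (measurable_uncurry_of_measurable_apply hg))
  exact h.stronglyMeasurable.integral_prod_right.measurable

/-- The average `∫ g_θ μ(dθ)` of a family of functions, set to `0` when it is not continuous. -/
def average (μ : Measure M) (g : M → C(UnitAddTorus d, ℝ)) : C(UnitAddTorus d, ℝ) :=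
  open Classical in
  if h : Continuous fun x => ∫ θ, g θ x ∂μ then ⟨_, h⟩ else 0

namespace IsBoundedFamily

variable {r : ℝ} {C : ℝ≥0} {g : M → C(UnitAddTorus d, ℝ)}

section FiniteMeasure

variable (μ : Measure M) [IsFiniteMeasure μ]

lemma integrable (hg : IsBoundedFamily r C g) (hr : 0 ≤ r) (x : UnitAddTorus d) :
    Integrable (fun θ => g θ x) μ :=
  (integrable_const (C : ℝ)).mono' (hg.measurable x).aestronglyMeasurable
    (ae_of_all _ fun θ => hg.abs_apply_le hr θ x)

lemma integrable_uncurry (hg : IsBoundedFamily r C g) (hr : 0 ≤ r) :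
    Integrable (fun p : M × UnitAddTorus d => g p.1 p.2) (μ.prod (torusHaar d)) :=
  (integrable_const (C : ℝ)).mono'
    (measurable_uncurry_of_measurable_apply hg.measurable).aestronglyMeasurable
    (ae_of_all _ fun p => hg.abs_apply_le hr p.1 p.2)

lemma average_apply (hg : IsBoundedFamily r C g) (hr : 0 ≤ r) (x : UnitAddTorus d) :
    average μ g x = ∫ θ, g θ x ∂μ := by
  have h : Continuous fun x => ∫ θ, g θ x ∂μ :=
    continuous_of_dominated (fun x => (hg.measurable x).aestronglyMeasurable)
      (fun x => ae_of_all _ fun θ => hg.abs_apply_le hr θ x) (integrable_const (C : ℝ))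
      (ae_of_all _ fun θ => (g θ).continuous)
  rw [average, dif_pos h]
  rfl

lemma realFourierCoeff_average (hg : IsBoundedFamily r C g) (hr : 0 ≤ r) (k : d → ℤ) :
    realFourierCoeff k (average μ g) = ∫ θ, realFourierCoeff k (g θ) ∂μ := by
  simp only [realFourierCoeff_eq_integral, hg.average_apply μ hr]
  rw [integral_integral_swap]
  · congr 1
    ext x
    rw [integral_const_mul, integral_complex_ofReal]
  · refine ((hg.integrable_uncurry μ hr).ofReal (𝕜 := ℂ)).bdd_mul (c := 1)
      ((mFourier (-k)).continuous.measurable.comp measurable_snd).aestronglyMeasurable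
      (ae_of_all _ fun p => (norm_mFourier_apply _ _).le)

end FiniteMeasure

variable (μ : Measure M) [IsProbabilityMeasure μ]

lemma wienerNorm_average_le (hg : IsBoundedFamily r C g) (hr : 0 ≤ r) :
    wienerNorm r (average μ g) ≤ C := by
  have hmeas (k : d → ℤ) : Measurable fun θ => ‖realFourierCoeff k (g θ)‖ₑ :=
    (measurable_realFourierCoeff hg.measurable k).enorm
  calc wienerNorm r (average μ g)
      ≤ ∑' k, ∫⁻ θ, ‖realFourierCoeff k (g θ)‖ₑ * expWeight r k ∂μ := by
        refine ENNReal.tsum_le_tsum fun k => ?_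
        rw [hg.realFourierCoeff_average μ hr, lintegral_mul_const _ (hmeas k)]
        gcongr
        exact enorm_integral_le_lintegral_enorm _
    _ = ∫⁻ θ, wienerNorm r (g θ) ∂μ :=
        (lintegral_tsum fun k => ((hmeas k).mul_const _).aemeasurable).symm
    _ ≤ ∫⁻ _, C ∂μ := lintegral_mono hg.wienerNorm_le
    _ = C := by simp

lemma gradPotential_average (hg : IsBoundedFamily r C g) (hr : 0 ≤ r) (j : d) :
    IsBoundedFamily r C fun _ : M => gradPotential j (average μ g) :=
  .const <| (wienerNorm_gradPotential_le hr j
    (ne_top_of_le_ne_top ENNReal.coe_ne_top (hg.wienerNorm_average_le μ hr))).trans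
    (hg.wienerNorm_average_le μ hr)

end IsBoundedFamily

end Families

/-! ### The Taylor coefficients in time -/

section TaylorCoefficients

open Finset.HasAntidiagonal

/-- The densities and the momenta of all the fluids. -/
structure FluidState (M d : Type*) where
  density : M → C(UnitAddTorus d, ℝ)
  momentum : M → d → C(UnitAddTorus d, ℝ)

/-- All the components of `v` form bounded families. -/
structure FluidState.IsBounded {M d : Type*} [MeasurableSpace M] [Fintype d] (r : ℝ) (C : ℝ≥0)
    (v : FluidState M d) : Prop where
  density : IsBoundedFamily r C v.density
  momentum : ∀ j, IsBoundedFamily r C fun θ => v.momentum θ j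

variable {M d : Type*} [MeasurableSpace M] [Fintype d] (μ : Measure M)

/-- The Taylor coefficient of order `n + 1` in time of a solution, in terms of the coefficients
`v 0, …, v n`, obtained by comparing the coefficients of `tⁿ` in the multifluid system. -/
def nextTaylorCoeff (n : ℕ) (v : ℕ → FluidState M d) : FluidState M d where
  density θ := -(((n : ℝ) + 1)⁻¹ • ∑ p ∈ antidiagonal n, ∑ i,
    partialDeriv i ((v p.1).momentum θ i * (v p.2).density θ))
  momentum θ j := -(((n : ℝ) + 1)⁻¹ • ((∑ p ∈ antidiagonal n, ∑ i,
    (v p.1).momentum θ i * partialDeriv i ((v p.2).momentum θ j)) +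
      gradPotential j (average μ (v n).density)))

/-- The Taylor coefficients in time of the solution with initial data `v₀`. -/
def taylorCoeff (v₀ : FluidState M d) : ℕ → FluidState M d
  | 0 => v₀
  | n + 1 => nextTaylorCoeff μ n fun m => if _h : m ≤ n then taylorCoeff v₀ m else v₀

lemma nextTaylorCoeff_congr {n : ℕ} {v w : ℕ → FluidState M d} (h : ∀ m ≤ n, v m = w m) :
    nextTaylorCoeff μ n v = nextTaylorCoeff μ n w := by
  have hfst {p : ℕ × ℕ} (hp : p ∈ antidiagonal n) : v p.1 = w p.1 :=
    h _ (antidiagonal.fst_le hp)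
  have hsnd {p : ℕ × ℕ} (hp : p ∈ antidiagonal n) : v p.2 = w p.2 :=
    h _ (antidiagonal.snd_le hp)
  simp only [nextTaylorCoeff, h n le_rfl, FluidState.mk.injEq]
  constructor
  · ext1 θ
    rw [Finset.sum_congr rfl fun p hp => by rw [hfst hp, hsnd hp]]
  · ext1 θ
    ext1 j
    rw [Finset.sum_congr rfl fun p hp => by rw [hfst hp, hsnd hp]]

lemma taylorCoeff_zero (v₀ : FluidState M d) : taylorCoeff μ v₀ 0 = v₀ := by rw [taylorCoeff]

lemma taylorCoeff_succ (v₀ : FluidState M d) (n : ℕ) :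
    taylorCoeff μ v₀ (n + 1) = nextTaylorCoeff μ n (taylorCoeff μ v₀) := by
  rw [taylorCoeff]
  exact nextTaylorCoeff_congr μ fun m hm => dif_pos hm

/-- The bound `B Rⁿ Cₙ ε⁻ⁿ` of the Taylor coefficients after a loss `ε` in the radius. The Catalan
numbers `Cₙ` reproduce the convolutions in the recursion. -/
def taylorBound (B R : ℝ≥0) (n : ℕ) (ε : ℝ≥0) : ℝ≥0 := B * R ^ n * catalan n * ε⁻¹ ^ n

lemma sum_antidiagonal_taylorBound (B R ε : ℝ≥0) (n : ℕ) :
    ∑ p ∈ antidiagonal n, taylorBound B R p.1 ε * taylorBound B R p.2 ε =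
      B ^ 2 * R ^ n * catalan (n + 1) * ε⁻¹ ^ n := by
  rw [catalan_succ']
  push_cast
  rw [Finset.mul_sum, Finset.sum_mul]
  refine Finset.sum_congr rfl fun p hp => ?_
  rw [← mem_antidiagonal.1 hp, taylorBound, taylorBound]
  ring

lemma catalan_le_catalan_succ (n : ℕ) : catalan n ≤ catalan (n + 1) := by
  rw [catalan_succ']
  simpa using Finset.single_le_sum (f := fun p : ℕ × ℕ => catalan p.1 * catalan p.2)
    (fun _ _ => Nat.zero_le _) (mem_antidiagonal.2 (show (n, 0).1 + (n, 0).2 = n from add_zero n))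

lemma catalan_le_four_pow (n : ℕ) : catalan n ≤ 4 ^ n :=
  calc catalan n ≤ n.centralBinom := by
        rw [catalan_eq_centralBinom_div]
        exact Nat.div_le_self _ _
    _ ≤ 2 ^ (2 * n) := Nat.choose_le_two_pow _ _
    _ = 4 ^ n := by rw [pow_mul]; norm_num

lemma succ_succ_div_succ_pow_le (n : ℕ) : (((n : ℝ≥0) + 2) / (n + 1)) ^ n ≤ 3 := by
  rw [← NNReal.coe_le_coe]
  push_cast
  calc (((n : ℝ) + 2) / (n + 1)) ^ n ≤ Real.exp (1 / (n + 1)) ^ n := by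
        refine pow_le_pow_left₀ (by positivity) (le_of_eq_of_le ?_ (Real.add_one_le_exp _)) n
        field_simp
        ring
    _ ≤ Real.exp 1 := by
        rw [← Real.exp_nat_mul, mul_one_div, Real.exp_le_exp]
        exact div_le_one_of_le₀ (by linarith) (by positivity)
    _ ≤ 3 := Real.exp_one_lt_three.le

/-- The recursion from loss `ε (n + 1) / (n + 2)` to loss `ε`, with the gap `ε / (n + 2)` to absorb
one derivative, is compatible with `taylorBound`. -/
lemma taylorBound_succ {D B R r₀ ε : ℝ≥0} (hε : 0 < ε) (hεr : ε ≤ r₀)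
    (hR : 12 * NNReal.pi * D * B + 3 * r₀ ≤ R) (n : ℕ) :
    ((n : ℝ≥0) + 1)⁻¹ * (D * (2 * NNReal.pi / (ε / (n + 2)) *
      ∑ p ∈ antidiagonal n, taylorBound B R p.1 (ε * (n + 1) / (n + 2)) *
        taylorBound B R p.2 (ε * (n + 1) / (n + 2))) +
      taylorBound B R n (ε * (n + 1) / (n + 2))) ≤ taylorBound B R (n + 1) ε := by
  have hloss : (ε * ((n : ℝ≥0) + 1) / (n + 2))⁻¹ ^ n ≤ 3 * ε⁻¹ ^ n := by
    rw [mul_div_assoc, mul_inv, inv_div, mul_pow, mul_comm]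
    exact mul_le_mul_left (succ_succ_div_succ_pow_le n) _
  have htwo : ((n : ℝ≥0) + 1)⁻¹ * (n + 2) ≤ 2 := by
    rw [inv_mul_le_iff₀ (by positivity), add_mul, one_mul, mul_two]
    gcongr
    exact le_add_of_nonneg_left n.cast_nonneg
  have hone : ((n : ℝ≥0) + 1)⁻¹ ≤ 1 := inv_le_one_of_one_le₀ (le_add_of_nonneg_left n.cast_nonneg)
  have hcat : (catalan n : ℝ≥0) ≤ catalan (n + 1) := mod_cast catalan_le_catalan_succ n
  set c : ℝ≥0 := ((catalan (n + 1) : ℕ) : ℝ≥0)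
  have hconvolution : ((n : ℝ≥0) + 1)⁻¹ * (D * (2 * NNReal.pi / (ε / (n + 2)) *
      (B ^ 2 * R ^ n * c * (ε * (n + 1) / (n + 2))⁻¹ ^ n))) ≤
        12 * NNReal.pi * D * B * (B * R ^ n * c * ε⁻¹ ^ (n + 1)) :=
    calc _ = ((n : ℝ≥0) + 1)⁻¹ * (n + 2) * (2 * NNReal.pi * D * B * (B * R ^ n * c * ε⁻¹)) *
          (ε * (n + 1) / (n + 2))⁻¹ ^ n := by rw [div_div_eq_mul_div, div_eq_mul_inv]; ring
      _ ≤ 2 * (2 * NNReal.pi * D * B * (B * R ^ n * c * ε⁻¹)) * (3 * ε⁻¹ ^ n) := by gcongr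
      _ = _ := by ring
  have hpotential : ((n : ℝ≥0) + 1)⁻¹ * taylorBound B R n (ε * (n + 1) / (n + 2)) ≤
      3 * r₀ * (B * R ^ n * c * ε⁻¹ ^ (n + 1)) :=
    calc _ ≤ 1 * (B * R ^ n * c * (3 * ε⁻¹ ^ n)) := by unfold taylorBound; gcongr
      _ = 3 * ε * (B * R ^ n * c * ε⁻¹ ^ (n + 1)) := by
          rw [pow_succ]
          field_simp
      _ ≤ _ := by gcongr
  rw [sum_antidiagonal_taylorBound, mul_add]
  calc _ ≤ (12 * NNReal.pi * D * B + 3 * r₀) * (B * R ^ n * c * ε⁻¹ ^ (n + 1)) := by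
        rw [add_mul]
        exact add_le_add hconvolution hpotential
    _ ≤ R * (B * R ^ n * c * ε⁻¹ ^ (n + 1)) := by gcongr
    _ = taylorBound B R (n + 1) ε := by rw [taylorBound]; ring

lemma taylorBound_le {B R ε : ℝ≥0} (n : ℕ) : taylorBound B R n ε ≤ B * (4 * R / ε) ^ n := by
  have hcat : (catalan n : ℝ≥0) ≤ 4 ^ n := mod_cast catalan_le_four_pow n
  calc taylorBound B R n ε ≤ B * R ^ n * 4 ^ n * ε⁻¹ ^ n := by unfold taylorBound; gcongr
    _ = B * (4 * R / ε) ^ n := by rw [div_eq_mul_inv]; ring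

variable [IsProbabilityMeasure μ]

lemma isBounded_nextTaylorCoeff {r s : ℝ} (hr : 0 ≤ r) {η : ℝ≥0} (hη : 0 < η) (h : r + η ≤ s)
    {n : ℕ} {v : ℕ → FluidState M d} {b : ℕ → ℝ≥0} (hv : ∀ m ≤ n, (v m).IsBounded s (b m)) :
    (nextTaylorCoeff μ n v).IsBounded r (((n : ℝ≥0) + 1)⁻¹ * (Fintype.card d *
      (2 * NNReal.pi / η * ∑ p ∈ antidiagonal n, b p.1 * b p.2) + b n)) := by
  have hrs : r ≤ s := (le_add_of_nonneg_right η.coe_nonneg).trans h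
  have hfst {p : ℕ × ℕ} (hp : p ∈ antidiagonal n) := hv _ (antidiagonal.fst_le hp)
  have hsnd {p : ℕ × ℕ} (hp : p ∈ antidiagonal n) := hv _ (antidiagonal.snd_le hp)
  have hnorm : ‖((n : ℝ) + 1)⁻¹‖₊ = ((n : ℝ≥0) + 1)⁻¹ := by
    rw [← NNReal.coe_inj, coe_nnnorm, Real.norm_of_nonneg (by positivity)]
    push_cast
    rfl
  have hsum : ∑ p ∈ antidiagonal n, ∑ _i : d, 2 * NNReal.pi / η * (b p.1 * b p.2) =
      Fintype.card d * (2 * NNReal.pi / η * ∑ p ∈ antidiagonal n, b p.1 * b p.2) := by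
    simp only [Finset.sum_const, Finset.card_univ, nsmul_eq_mul, Finset.mul_sum]
  constructor
  · refine .neg (.mono (.smul (.sum fun p hp => .sum fun i _ =>
      (((hfst hp).momentum i).mul (hr.trans hrs) (hsnd hp).density).partialDeriv hr hη h i) _)
      le_rfl ?_)
    rw [hnorm, hsum]
    gcongr
    exact le_self_add
  · refine fun j => .neg (.mono (.smul (.add (.sum fun p hp => .sum fun i _ =>
      (((hfst hp).momentum i).mono hrs le_rfl).mul hr
        (((hsnd hp).momentum j).partialDeriv hr hη h i))
      (((hv n le_rfl).density.mono hrs le_rfl).gradPotential_average μ hr j)) _) le_rfl ?_)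
    rw [hnorm, ← hsum]
    simp only [mul_left_comm]
    exact le_rfl

lemma isBounded_taylorCoeff {B R r₀ : ℝ≥0} (hR : 12 * NNReal.pi * Fintype.card d * B + 3 * r₀ ≤ R)
    {v₀ : FluidState M d} (hv₀ : v₀.IsBounded r₀ B) (n : ℕ) {ε : ℝ≥0} (hε : 0 < ε) (hεr : ε ≤ r₀) :
    (taylorCoeff μ v₀ n).IsBounded (r₀ - ε) (taylorBound B R n ε) := by
  induction n using Nat.strong_induction_on generalizing ε with
  | _ n ih =>
  cases n with
  | zero =>
    have hle : (r₀ : ℝ) - ε ≤ r₀ := sub_le_self _ ε.coe_nonneg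
    have hB : B ≤ taylorBound B R 0 ε := by simp [taylorBound]
    rw [taylorCoeff_zero]
    exact ⟨hv₀.density.mono hle hB, fun j => (hv₀.momentum j).mono hle hB⟩
  | succ n =>
    have hε' : 0 < ε * (n + 1) / (n + 2) := by positivity
    have hgap : (r₀ : ℝ) - ε + (ε / (n + 2) : ℝ≥0) ≤ r₀ - (ε * (n + 1) / (n + 2) : ℝ≥0) := by
      push_cast
      refine le_of_eq ?_
      field_simp
      ring
    have hε'r : ε * (n + 1) / (n + 2) ≤ r₀ := by
      refine (div_le_of_le_mul₀ zero_le zero_le ?_).trans hεr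
      gcongr
      exact one_le_two
    have hnext := isBounded_nextTaylorCoeff μ (sub_nonneg.2 (NNReal.coe_le_coe.2 hεr))
      (by positivity) hgap fun m hm => ih m (Nat.lt_succ_of_le hm) hε' hε'r
    have hbound := taylorBound_succ hε hεr hR n
    rw [taylorCoeff_succ]
    exact ⟨hnext.density.mono le_rfl hbound, fun j => (hnext.momentum j).mono le_rfl hbound⟩

end TaylorCoefficients

/-! ### Power series in time -/

section TimeSeries

open Finset.HasAntidiagonal

/-- The power series in time with coefficients `u`. -/
def timeSeries {E : Type*} [NormedAddCommGroup E] [NormedSpace ℝ E] (u : ℕ → E) (t : ℝ) : E :=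
  ∑' n, t ^ n • u n

section BanachSpace

variable {E : Type*} [NormedAddCommGroup E] [NormedSpace ℝ E] {B Q : ℝ≥0} {t : ℝ} {u : ℕ → E}

lemma timeSeries_zero (u : ℕ → E) : timeSeries u 0 = u 0 := by
  rw [timeSeries, tsum_eq_single 0 fun n hn => by rw [zero_pow hn, zero_smul], pow_zero, one_smul]

lemma summable_norm_pow_smul (hu : ∀ n, ‖u n‖₊ ≤ B * Q ^ n) (ht : ‖t‖₊ * Q < 1) :
    Summable fun n => ‖t ^ n • u n‖ := by
  refine (NNReal.summable_coe (f := fun n => ‖t ^ n • u n‖₊)).2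
    (NNReal.summable_of_le (fun n => ?_) ((NNReal.summable_geometric ht).mul_left B))
  calc ‖t ^ n • u n‖₊ = ‖t‖₊ ^ n * ‖u n‖₊ := by rw [nnnorm_smul, nnnorm_pow]
    _ ≤ ‖t‖₊ ^ n * (B * Q ^ n) := by gcongr; exact hu n
    _ = B * (‖t‖₊ * Q) ^ n := by ring

lemma hasSum_timeSeries [CompleteSpace E] (hu : ∀ n, ‖u n‖₊ ≤ B * Q ^ n) (ht : ‖t‖₊ * Q < 1) :
    HasSum (fun n => t ^ n • u n) (timeSeries u t) :=
  (summable_norm_pow_smul hu ht).of_norm.hasSum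

lemma norm_deriv_pow_smul_le (hu : ∀ n, ‖u n‖₊ ≤ B * Q ^ n) {q : ℝ≥0} {y : ℝ}
    (hy : |y| * Q ≤ q) (n : ℕ) :
    ‖((n : ℝ) * y ^ (n - 1)) • u n‖ ≤ B * Q * (n * (q : ℝ) ^ (n - 1)) := by
  rcases n with _ | n
  · simp
  · calc ‖(((n + 1 : ℕ) : ℝ) * y ^ n) • u (n + 1)‖
        = ((n + 1 : ℕ) : ℝ) * |y| ^ n * ‖u (n + 1)‖ := by
          rw [norm_smul, norm_mul, norm_pow, Real.norm_natCast, Real.norm_eq_abs]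
      _ ≤ ((n + 1 : ℕ) : ℝ) * |y| ^ n * (B * Q ^ (n + 1)) := by
          gcongr
          exact mod_cast hu (n + 1)
      _ = B * Q * (((n + 1 : ℕ) : ℝ) * (|y| * Q) ^ n) := by ring
      _ ≤ B * Q * (((n + 1 : ℕ) : ℝ) * (q : ℝ) ^ n) := by gcongr

lemma hasDerivAt_timeSeries [CompleteSpace E] (hu : ∀ n, ‖u n‖₊ ≤ B * Q ^ n) (ht : ‖t‖₊ * Q < 1)
    {v : E} (hv : HasSum (fun n : ℕ => t ^ n • (((n : ℝ) + 1) • u (n + 1))) v) :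
    HasDerivAt (timeSeries u) v t := by
  obtain ⟨q, htq, hq⟩ := exists_between ht
  have hbound_summable : Summable fun n : ℕ => (B * Q : ℝ) * (n * (q : ℝ) ^ (n - 1)) := by
    refine Summable.mul_left _ ?_
    rw [← summable_nat_add_iff 1]
    have hq' : ‖(q : ℝ)‖ < 1 := by simpa using hq
    simpa only [Nat.choose_one_right, Nat.add_sub_cancel] using
      summable_choose_mul_geometric_of_norm_lt_one (R := ℝ) 1 hq'
  have hv' : HasSum (fun n : ℕ => ((n : ℝ) * t ^ (n - 1)) • u n) v := by
    rw [← hasSum_nat_add_iff' 1]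
    simp only [Finset.range_one, Finset.sum_singleton, Nat.cast_zero, zero_mul, zero_smul, sub_zero,
      Nat.cast_add, Nat.cast_one, Nat.add_sub_cancel]
    exact hv.congr_fun fun n => by rw [smul_smul, mul_comm]
  have hopen : IsOpen ((· * (Q : ℝ)) ⁻¹' Metric.ball 0 q) :=
    Metric.isOpen_ball.preimage (continuous_mul_const _)
  have hconvex : Convex ℝ ((· * (Q : ℝ)) ⁻¹' Metric.ball 0 q) :=
    (convex_ball 0 (q : ℝ)).is_linear_preimage (LinearMap.mulRight ℝ (Q : ℝ)).isLinear
  have htmem : t ∈ (· * (Q : ℝ)) ⁻¹' Metric.ball 0 q := by simpa using NNReal.coe_lt_coe.2 htq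
  rw [← hv'.tsum_eq]
  exact hasDerivAt_tsum_of_isPreconnected (𝕜 := ℝ) (g := fun n (s : ℝ) => s ^ n • u n)
    hbound_summable hopen hconvex.isPreconnected
    (fun n y _ => (hasDerivAt_pow n y).smul_const (u n))
    (fun n y hy => norm_deriv_pow_smul_le hu (by simpa using (mem_ball_zero_iff.1 hy).le) n) htmem
    (hasSum_timeSeries hu ht).summable htmem

end BanachSpace

lemma hasSum_timeSeries_mul {A : Type*} [NormedRing A] [NormedAlgebra ℝ A] [CompleteSpace A]
    {a b : ℕ → A} {B B' Q : ℝ≥0} {t : ℝ} (ha : ∀ n, ‖a n‖₊ ≤ B * Q ^ n)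
    (hb : ∀ n, ‖b n‖₊ ≤ B' * Q ^ n) (ht : ‖t‖₊ * Q < 1) :
    HasSum (fun n => t ^ n • ∑ p ∈ antidiagonal n, a p.1 * b p.2)
      (timeSeries a t * timeSeries b t) := by
  have hat := summable_norm_pow_smul ha ht
  have hbt := summable_norm_pow_smul hb ht
  have hterm (n : ℕ) : t ^ n • ∑ p ∈ antidiagonal n, a p.1 * b p.2 =
      ∑ p ∈ antidiagonal n, (t ^ p.1 • a p.1) * (t ^ p.2 • b p.2) := by
    rw [Finset.smul_sum]
    refine Finset.sum_congr rfl fun p hp => ?_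
    rw [smul_mul_smul_comm, ← pow_add, mem_antidiagonal.1 hp]
  simp only [hterm, timeSeries]
  rw [tsum_mul_tsum_eq_tsum_sum_antidiagonal_of_summable_norm hat hbt]
  exact (summable_norm_sum_mul_antidiagonal_of_summable_norm hat hbt).of_norm.hasSum

section WienerNorm

variable {d : Type*} [Fintype d] {r : ℝ} {B Q : ℝ≥0} {s t : ℝ} {u : ℕ → C(UnitAddTorus d, ℝ)}

lemma nnnorm_le_of_wienerNorm_le (hr : 0 ≤ r) {g : C(UnitAddTorus d, ℝ)} {C : ℝ≥0}
    (hg : wienerNorm r g ≤ C) : ‖g‖₊ ≤ C :=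
  ENNReal.coe_le_coe.1 ((enorm_le_wienerNorm hr g).trans hg)

lemma wienerNorm_pow_smul_le (hu : ∀ n, wienerNorm r (u n) ≤ (B * Q ^ n : ℝ≥0)) (n : ℕ) :
    wienerNorm r (t ^ n • u n) ≤ B * (‖t‖ₑ * Q) ^ n :=
  calc wienerNorm r (t ^ n • u n) = ‖t‖ₑ ^ n * wienerNorm r (u n) := by
        rw [wienerNorm_smul, ← Real.enorm_eq_ofReal_abs, enorm_pow]
    _ ≤ ‖t‖ₑ ^ n * (B * Q ^ n) := by gcongr; exact mod_cast hu n
    _ = B * (‖t‖ₑ * Q) ^ n := by ring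

lemma tsum_wienerNorm_pow_smul_le (hu : ∀ n, wienerNorm r (u n) ≤ (B * Q ^ n : ℝ≥0)) :
    ∑' n, wienerNorm r (t ^ n • u n) ≤ B * (1 - ‖t‖ₑ * Q)⁻¹ := by
  rw [← ENNReal.tsum_geometric, ← ENNReal.tsum_mul_left]
  exact ENNReal.tsum_le_tsum fun n => wienerNorm_pow_smul_le hu n

lemma tsum_wienerNorm_pow_smul_ne_top (hu : ∀ n, wienerNorm r (u n) ≤ (B * Q ^ n : ℝ≥0))
    (ht : ‖t‖₊ * Q < 1) : ∑' n, wienerNorm r (t ^ n • u n) ≠ ⊤ := by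
  have ht' : ‖t‖ₑ * Q < 1 := by
    rw [enorm_eq_nnnorm, ← ENNReal.coe_mul]
    exact ENNReal.coe_lt_one_iff.2 ht
  exact ne_top_of_le_ne_top (ENNReal.mul_ne_top ENNReal.coe_ne_top
    (ENNReal.inv_ne_top.2 (tsub_pos_of_lt ht').ne')) (tsum_wienerNorm_pow_smul_le hu)

lemma wienerNorm_timeSeries_le_tsum (hr : 0 ≤ r)
    (hu : ∀ n, wienerNorm r (u n) ≤ (B * Q ^ n : ℝ≥0)) (ht : ‖t‖₊ * Q < 1) :
    wienerNorm r (timeSeries u t) ≤ ∑' n, wienerNorm r (t ^ n • u n) :=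
  wienerNorm_le_tsum r <| hasSum_timeSeries (fun n => nnnorm_le_of_wienerNorm_le hr (hu n)) ht

lemma wienerNorm_timeSeries_le (hr : 0 ≤ r) (hu : ∀ n, wienerNorm r (u n) ≤ (B * Q ^ n : ℝ≥0))
    (ht : ‖t‖₊ * Q < 1) : wienerNorm r (timeSeries u t) ≤ B * (1 - ‖t‖ₑ * Q)⁻¹ :=
  (wienerNorm_timeSeries_le_tsum hr hu ht).trans (tsum_wienerNorm_pow_smul_le hu)

lemma fourierMultiplier_timeSeries {m : (d → ℤ) → ℂ} {r' : ℝ} {C : ℝ≥0}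
    (hm : ConjSymmetric m) (hC : SymbolBound m r' r C) (hr' : 0 ≤ r') (hr : 0 ≤ r)
    (hu : ∀ n, wienerNorm r (u n) ≤ (B * Q ^ n : ℝ≥0)) (ht : ‖t‖₊ * Q < 1) :
    fourierMultiplier m (timeSeries u t) = timeSeries (fun n => fourierMultiplier m (u n)) t := by
  have hsum := hC.hasSum_fourierMultiplier hm hr'
    (hasSum_timeSeries (fun n => nnnorm_le_of_wienerNorm_le hr (hu n)) ht)
    (tsum_wienerNorm_pow_smul_ne_top hu ht)
  simpa only [timeSeries, fourierMultiplier_smul] using hsum.tsum_eq.symm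

lemma nnnorm_partialDeriv_le (hr : 0 < r) {g : C(UnitAddTorus d, ℝ)} {C : ℝ≥0}
    (hg : wienerNorm r g ≤ C) (i : d) :
    ‖partialDeriv i g‖₊ ≤ 2 * NNReal.pi / r.toNNReal * C := by
  refine nnnorm_le_of_wienerNorm_le le_rfl ((wienerNorm_partialDeriv_le le_rfl
    (Real.toNNReal_pos.2 hr) (by rw [zero_add, Real.coe_toNNReal r hr.le]) i
    (ne_top_of_le_ne_top ENNReal.coe_ne_top hg)).trans ?_)
  rw [ENNReal.coe_mul]
  gcongr

lemma partialDeriv_timeSeries (hr : 0 < r) (hu : ∀ n, wienerNorm r (u n) ≤ (B * Q ^ n : ℝ≥0))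
    (ht : ‖t‖₊ * Q < 1) (i : d) :
    partialDeriv i (timeSeries u t) = timeSeries (fun n => partialDeriv i (u n)) t :=
  fourierMultiplier_timeSeries (conjSymmetric_partialSymbol i) (symbolBound_partialSymbol i
    (Real.toNNReal_pos.2 hr) (by rw [zero_add, Real.coe_toNNReal r hr.le])) le_rfl hr.le hu ht

lemma gradPotential_timeSeries (hr : 0 ≤ r) (hu : ∀ n, wienerNorm r (u n) ≤ (B * Q ^ n : ℝ≥0))
    (ht : ‖t‖₊ * Q < 1) (i : d) :
    gradPotential i (timeSeries u t) = timeSeries (fun n => gradPotential i (u n)) t :=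
  fourierMultiplier_timeSeries (conjSymmetric_partialSymbol_mul_poissonSymbol i)
    (symbolBound_partialSymbol_mul_poissonSymbol i r) hr hr hu ht

section Products

variable {B' : ℝ≥0} {a b : ℕ → C(UnitAddTorus d, ℝ)}

lemma hasSum_mul_partialDeriv_timeSeries (hr : 0 < r)
    (ha : ∀ n, wienerNorm r (a n) ≤ (B * Q ^ n : ℝ≥0))
    (hb : ∀ n, wienerNorm r (b n) ≤ (B' * Q ^ n : ℝ≥0)) (ht : ‖t‖₊ * Q < 1) (i : d) :
    HasSum (fun n => t ^ n • ∑ p ∈ antidiagonal n, a p.1 * partialDeriv i (b p.2))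
      (timeSeries a t * partialDeriv i (timeSeries b t)) := by
  rw [partialDeriv_timeSeries hr hb ht]
  exact hasSum_timeSeries_mul (a := a) (b := fun n => partialDeriv i (b n))
    (fun n => nnnorm_le_of_wienerNorm_le hr.le (ha n))
    (fun n => (nnnorm_partialDeriv_le hr (hb n) i).trans_eq (mul_assoc _ _ _).symm) ht

lemma partialDeriv_mul (hr : 0 < r) {f g : C(UnitAddTorus d, ℝ)} (hf : wienerNorm r f ≠ ⊤)
    (hg : wienerNorm r g ≠ ⊤) (i : d) :
    partialDeriv i (f * g) = partialDeriv i f * g + f * partialDeriv i g := by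
  classical
  ext x
  have hfg : wienerNorm r (f * g) ≠ ⊤ :=
    ne_top_of_le_ne_top (ENNReal.mul_ne_top hf hg) (wienerNorm_mul_le hr.le f g)
  simpa using (hasDerivAt_partialDeriv hr hfg i x).unique
    ((hasDerivAt_partialDeriv hr hf i x).mul (hasDerivAt_partialDeriv hr hg i x))

lemma hasSum_partialDeriv_mul_timeSeries (hr : 0 < r)
    (ha : ∀ n, wienerNorm r (a n) ≤ (B * Q ^ n : ℝ≥0))
    (hb : ∀ n, wienerNorm r (b n) ≤ (B' * Q ^ n : ℝ≥0)) (ht : ‖t‖₊ * Q < 1) (i : d) :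
    HasSum (fun n => t ^ n • ∑ p ∈ antidiagonal n, partialDeriv i (a p.1 * b p.2))
      (partialDeriv i (timeSeries a t * timeSeries b t)) := by
  have hne {f : C(UnitAddTorus d, ℝ)} {c : ℝ≥0} (hf : wienerNorm r f ≤ c) :
      wienerNorm r f ≠ ⊤ := ne_top_of_le_ne_top ENNReal.coe_ne_top hf
  have hne' {c : ℝ≥0} {u : ℕ → C(UnitAddTorus d, ℝ)}
      (hu : ∀ n, wienerNorm r (u n) ≤ (c * Q ^ n : ℝ≥0)) : wienerNorm r (timeSeries u t) ≠ ⊤ :=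
    ne_top_of_le_ne_top (tsum_wienerNorm_pow_smul_ne_top hu ht)
      (wienerNorm_timeSeries_le_tsum hr.le hu ht)
  have hsum := (hasSum_mul_partialDeriv_timeSeries hr hb ha ht i).add
    (hasSum_mul_partialDeriv_timeSeries hr ha hb ht i)
  rw [partialDeriv_mul hr (hne' ha) (hne' hb), mul_comm (partialDeriv i (timeSeries a t))]
  refine hsum.congr_fun fun n => ?_
  rw [← Finset.Nat.sum_antidiagonal_swap (f := fun p => b p.1 * partialDeriv i (a p.2)),
    ← smul_add, ← Finset.sum_add_distrib]
  congr 1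
  refine Finset.sum_congr rfl fun p _ => ?_
  rw [partialDeriv_mul hr (hne (ha _)) (hne (hb _)), mul_comm (partialDeriv i (a p.1))]
  rfl

end Products

lemma wienerNorm_timeSeries_le_two_mul (hr : 0 ≤ r)
    (hu : ∀ n, wienerNorm r (u n) ≤ (B * Q ^ n : ℝ≥0)) (ht : ‖t‖₊ * Q ≤ 1 / 2) :
    wienerNorm r (timeSeries u t) ≤ (2 * B : ℝ≥0) := by
  have ht' : ‖t‖ₑ * Q ≤ 2⁻¹ := by
    rw [enorm_eq_nnnorm, ← ENNReal.coe_mul, ← ENNReal.coe_two, ← ENNReal.coe_inv two_ne_zero]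
    exact mod_cast ht.trans_eq (one_div 2)
  calc wienerNorm r (timeSeries u t) ≤ B * (1 - ‖t‖ₑ * Q)⁻¹ :=
        wienerNorm_timeSeries_le hr hu (ht.trans_lt one_half_lt_one)
    _ ≤ B * (1 - 2⁻¹)⁻¹ := by gcongr
    _ = (2 * B : ℝ≥0) := by
        rw [ENNReal.one_sub_inv_two, inv_inv, mul_comm, ENNReal.coe_mul, ENNReal.coe_two]

lemma nnnorm_pow_sub_pow_mul_pow_le (hs : ‖s‖₊ * Q ≤ 1 / 2) (ht : ‖t‖₊ * Q ≤ 1 / 2) (n : ℕ) :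
    ‖s ^ n - t ^ n‖₊ * Q ^ n ≤ 2 * Q * ‖s - t‖₊ * (n * (1 / 2) ^ n) := by
  rcases n with _ | n
  · simp
  · have hmax : max ‖s‖₊ ‖t‖₊ * Q ≤ 1 / 2 := by rw [max_mul]; exact max_le hs ht
    have hpow : ‖s ^ (n + 1) - t ^ (n + 1)‖₊ ≤ ‖s - t‖₊ * ((n + 1 : ℕ) * max ‖s‖₊ ‖t‖₊ ^ n) := by
      rw [← NNReal.coe_le_coe]
      push_cast [Real.norm_eq_abs]
      simpa [mul_assoc] using abs_pow_sub_pow_le s t (n + 1)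
    calc ‖s ^ (n + 1) - t ^ (n + 1)‖₊ * Q ^ (n + 1)
        ≤ ‖s - t‖₊ * ((n + 1 : ℕ) * max ‖s‖₊ ‖t‖₊ ^ n) * Q ^ (n + 1) := by gcongr
      _ = Q * ‖s - t‖₊ * ((n + 1 : ℕ) * (max ‖s‖₊ ‖t‖₊ * Q) ^ n) := by ring
      _ ≤ Q * ‖s - t‖₊ * ((n + 1 : ℕ) * (1 / 2) ^ n) := by gcongr
      _ = _ := by rw [pow_succ (1 / 2 : ℝ≥0)]; ring

lemma wienerNorm_timeSeries_sub_le (hr : 0 ≤ r)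
    (hu : ∀ n, wienerNorm r (u n) ≤ (B * Q ^ n : ℝ≥0)) (hs : ‖s‖₊ * Q ≤ 1 / 2)
    (ht : ‖t‖₊ * Q ≤ 1 / 2) :
    wienerNorm r (timeSeries u s - timeSeries u t) ≤ (4 * B * Q : ℝ≥0) * ‖s - t‖ₑ := by
  have hbound (n : ℕ) : ‖u n‖₊ ≤ B * Q ^ n := nnnorm_le_of_wienerNorm_le hr (hu n)
  have hsum := (hasSum_timeSeries hbound (hs.trans_lt one_half_lt_one)).sub
    (hasSum_timeSeries hbound (ht.trans_lt one_half_lt_one))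
  have hgeometric : HasSum (fun n : ℕ => (n : ℝ≥0) * (1 / 2) ^ n) 2 := by
    have hreal := hasSum_coe_mul_geometric_of_norm_lt_one (r := (1 / 2 : ℝ)) (by norm_num)
    rw [show (1 / 2 : ℝ) / (1 - 1 / 2) ^ 2 = 2 by norm_num] at hreal
    exact NNReal.hasSum_coe.1 (by push_cast; exact hreal)
  simp only [← sub_smul] at hsum
  calc wienerNorm r (timeSeries u s - timeSeries u t)
      ≤ ∑' n, wienerNorm r ((s ^ n - t ^ n) • u n) := wienerNorm_le_tsum r hsum
    _ ≤ ∑' n : ℕ, ((2 * B * Q * ‖s - t‖₊ * (n * (1 / 2) ^ n) : ℝ≥0) : ℝ≥0∞) := by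
        refine ENNReal.tsum_le_tsum fun n => ?_
        rw [wienerNorm_smul, ← Real.enorm_eq_ofReal_abs, enorm_eq_nnnorm]
        refine (mul_le_mul' le_rfl (hu n)).trans ?_
        rw [← ENNReal.coe_mul, ENNReal.coe_le_coe]
        calc ‖s ^ n - t ^ n‖₊ * (B * Q ^ n) = B * (‖s ^ n - t ^ n‖₊ * Q ^ n) := by ring
          _ ≤ B * (2 * Q * ‖s - t‖₊ * (n * (1 / 2) ^ n)) := by
              exact mul_le_mul_right (nnnorm_pow_sub_pow_mul_pow_le hs ht n) B
          _ = _ := by ring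
    _ = (4 * B * Q : ℝ≥0) * ‖s - t‖ₑ := by
        rw [← ENNReal.coe_tsum (hgeometric.mul_left _).summable, (hgeometric.mul_left _).tsum_eq,
          enorm_eq_nnnorm, ← ENNReal.coe_mul]
        congr 1
        ring

lemma eventually_nnnorm_mul_lt {c : ℝ≥0} (ht : ‖t‖₊ * Q < c) : ∀ᶠ s in 𝓝 t, ‖s‖₊ * Q < c :=
  (continuous_nnnorm.mul continuous_const).continuousAt.eventually_lt continuousAt_const ht

lemma tendsto_wienerNorm_timeSeries_sub (hr : 0 ≤ r)
    (hu : ∀ n, wienerNorm r (u n) ≤ (B * Q ^ n : ℝ≥0)) (ht : ‖t‖₊ * Q < 1 / 2) :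
    Tendsto (fun s => wienerNorm r (timeSeries u s - timeSeries u t)) (𝓝 t) (𝓝 0) := by
  have hlim : Tendsto (fun s => (4 * B * Q : ℝ≥0) * ‖s - t‖ₑ) (𝓝 t) (𝓝 0) := by
    have hsub : Tendsto (fun s => ‖s - t‖ₑ) (𝓝 t) (𝓝 0) := by
      simpa only [edist_eq_enorm_sub, id] using
        tendsto_iff_edist_tendsto_0.1 (tendsto_id (x := 𝓝 t))
    simpa only [mul_zero] using ENNReal.Tendsto.const_mul hsub (Or.inr ENNReal.coe_ne_top)
  exact tendsto_of_tendsto_of_tendsto_of_le_of_le' tendsto_const_nhds hlim (.of_forall fun _ =>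
    zero_le) ((eventually_nnnorm_mul_lt ht).mono fun s hs =>
      wienerNorm_timeSeries_sub_le hr hu hs.le ht.le)

lemma tendsto_of_tendsto_wienerNorm_sub (hr : 0 ≤ r) {α : Type*} {l : Filter α}
    {f : α → C(UnitAddTorus d, ℝ)} {g : C(UnitAddTorus d, ℝ)}
    (h : Tendsto (fun a => wienerNorm r (f a - g)) l (𝓝 0)) : Tendsto f l (𝓝 g) := by
  rw [tendsto_iff_edist_tendsto_0]
  refine tendsto_of_tendsto_of_tendsto_of_le_of_le tendsto_const_nhds h (fun _ => zero_le)
    fun a => ?_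
  rw [edist_eq_enorm_sub]
  exact enorm_le_wienerNorm hr _

end WienerNorm

section Families

variable {d M : Type*} [Fintype d] [MeasurableSpace M] {r : ℝ} {B Q : ℝ≥0} {t : ℝ}
  {u : ℕ → M → C(UnitAddTorus d, ℝ)}

lemma hasSum_timeSeries_apply (hr : 0 ≤ r) (hu : ∀ n, IsBoundedFamily r (B * Q ^ n) (u n))
    (ht : ‖t‖₊ * Q < 1) (θ : M) (x : UnitAddTorus d) :
    HasSum (fun n => t ^ n * u n θ x) (timeSeries (u · θ) t x) := by
  exact (hasSum_timeSeries (u := fun n => u n θ)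
    (fun n => nnnorm_le_of_wienerNorm_le hr ((hu n).wienerNorm_le θ)) ht).mapL
      (ContinuousMap.evalCLM ℝ x)

lemma IsBoundedFamily.timeSeries (hr : 0 ≤ r) (hu : ∀ n, IsBoundedFamily r (B * Q ^ n) (u n))
    (ht : ‖t‖₊ * Q ≤ 1 / 2) : IsBoundedFamily r (2 * B) fun θ => timeSeries (u · θ) t where
  measurable x := measurable_of_tendsto_metrizable
    (f := fun N θ => ∑ n ∈ Finset.range N, t ^ n * u n θ x)
    (fun _ => Finset.measurable_sum _ fun n _ => ((hu n).measurable x).const_mul _)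
    (tendsto_pi_nhds.2 fun θ =>
      (hasSum_timeSeries_apply hr hu (ht.trans_lt one_half_lt_one) θ x).tendsto_sum_nat)
  wienerNorm_le θ := wienerNorm_timeSeries_le_two_mul hr (fun n => (hu n).wienerNorm_le θ) ht

lemma average_timeSeries (μ : Measure M) [IsProbabilityMeasure μ] (hr : 0 ≤ r)
    (hu : ∀ n, IsBoundedFamily r (B * Q ^ n) (u n)) (ht : ‖t‖₊ * Q ≤ 1 / 2) :
    average μ (fun θ => timeSeries (u · θ) t) = timeSeries (fun n => average μ (u n)) t := by
  have ht' : ‖t‖₊ * Q < 1 := ht.trans_lt one_half_lt_one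
  ext x
  have hbound (n : ℕ) (θ : M) : ‖t ^ n * u n θ x‖ ≤ B * (‖t‖₊ * Q : ℝ≥0) ^ n :=
    calc ‖t ^ n * u n θ x‖ = ‖t‖ ^ n * |u n θ x| := by
          rw [norm_mul, norm_pow, Real.norm_eq_abs (u n θ x)]
      _ ≤ ‖t‖ ^ n * (B * Q ^ n : ℝ≥0) := by gcongr; exact (hu n).abs_apply_le hr θ x
      _ = B * (‖t‖₊ * Q : ℝ≥0) ^ n := by push_cast; ring
  have hint (n : ℕ) : Integrable (fun θ => t ^ n * u n θ x) μ :=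
    ((hu n).integrable μ hr x).const_mul _
  have hsummable : Summable fun n => ∫ θ, ‖t ^ n * u n θ x‖ ∂μ := by
    refine .of_nonneg_of_le (fun n => integral_nonneg fun _ => norm_nonneg _) (fun n => ?_)
      ((NNReal.summable_coe.2 (NNReal.summable_geometric ht')).mul_left (B : ℝ))
    refine (integral_mono (hint n).norm (integrable_const _) (hbound n)).trans_eq ?_
    simp
  have hintegral := hasSum_integral_of_summable_integral_norm hint hsummable
  have haverage := (hasSum_timeSeries (u := fun n => average μ (u n))
    (fun n => nnnorm_le_of_wienerNorm_le hr ((hu n).wienerNorm_average_le μ hr)) ht').mapL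
      (ContinuousMap.evalCLM ℝ x)
  rw [(IsBoundedFamily.timeSeries hr hu ht).average_apply μ hr]
  refine Eq.trans (integral_congr_ae (ae_of_all _ fun θ =>
    (hasSum_timeSeries_apply hr hu ht' θ x).tsum_eq.symm)) (hintegral.unique ?_)
  refine haverage.congr_fun fun n => ?_
  simp [integral_const_mul, (hu n).average_apply μ hr]

end Families

end TimeSeries

/-! ### The local solution -/

section LocalSolution

variable {M d : Type*} [MeasurableSpace M] [Fintype d]

/-- Solutions of the multifluid system on the time interval `(-τ, τ)`, the unknowns having Wiener
norms of radius `r` at most `C` and depending continuously on time in this norm. -/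
structure LocalSolution (μ : Measure M) (τ r : ℝ) (C : ℝ≥0) (v : ℝ → FluidState M d) : Prop where
  radius_pos : 0 < r
  isBounded : ∀ t, |t| < τ → (v t).IsBounded r C
  tendsto_density : ∀ θ t, |t| < τ →
    Tendsto (fun s => wienerNorm r ((v s).density θ - (v t).density θ)) (𝓝 t) (𝓝 0)
  tendsto_momentum : ∀ θ t, |t| < τ → ∀ j,
    Tendsto (fun s => wienerNorm r ((v s).momentum θ j - (v t).momentum θ j)) (𝓝 t) (𝓝 0)
  hasDerivAt_density : ∀ θ t, |t| < τ → HasDerivAt (fun s => (v s).density θ)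
    (-∑ i, partialDeriv i ((v t).momentum θ i * (v t).density θ)) t
  hasDerivAt_momentum : ∀ θ t, |t| < τ → ∀ j, HasDerivAt (fun s => (v s).momentum θ j)
    (-(∑ i, (v t).momentum θ i * partialDeriv i ((v t).momentum θ j)) -
      gradPotential j (average μ (v t).density)) t
  continuousAt_gradPotential : ∀ t, |t| < τ → ∀ j,
    ContinuousAt (fun s => gradPotential j (average μ (v s).density)) t

/-- The state at time `t` whose components are the power series in time with coefficients `v`. -/
def FluidState.timeSeries (v : ℕ → FluidState M d) (t : ℝ) : FluidState M d where
  density θ := VlasovPoisson.timeSeries (fun n => (v n).density θ) t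
  momentum θ j := VlasovPoisson.timeSeries (fun n => (v n).momentum θ j) t

omit [MeasurableSpace M] [Fintype d] in
lemma FluidState.timeSeries_zero (v : ℕ → FluidState M d) :
    FluidState.timeSeries v 0 = v 0 := by
  simp only [FluidState.timeSeries, VlasovPoisson.timeSeries_zero]

lemma FluidState.IsBounded.timeSeries {r t : ℝ} {B Q : ℝ≥0} {v : ℕ → FluidState M d} (hr : 0 ≤ r)
    (hv : ∀ n, (v n).IsBounded r (B * Q ^ n)) (ht : ‖t‖₊ * Q ≤ 1 / 2) :
    (FluidState.timeSeries v t).IsBounded r (2 * B) where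
  density := IsBoundedFamily.timeSeries hr (fun n => (hv n).density) ht
  momentum j := IsBoundedFamily.timeSeries hr (fun n => (hv n).momentum j) ht

section Taylor

variable {μ : Measure M} {r t : ℝ} {B Q : ℝ≥0} {v₀ : FluidState M d}
  (hv : ∀ n, (taylorCoeff μ v₀ n).IsBounded r (B * Q ^ n))

include hv

lemma hasDerivAt_density_timeSeries (hr : 0 < r) (ht : ‖t‖₊ * Q < 1) (θ : M) :
    HasDerivAt (fun s => (FluidState.timeSeries (taylorCoeff μ v₀) s).density θ)
      (-∑ i, partialDeriv i ((FluidState.timeSeries (taylorCoeff μ v₀) t).momentum θ i *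
        (FluidState.timeSeries (taylorCoeff μ v₀) t).density θ)) t := by
  have hdensity (n : ℕ) := (hv n).density.wienerNorm_le θ
  refine hasDerivAt_timeSeries (fun n => nnnorm_le_of_wienerNorm_le hr.le (hdensity n)) ht ?_
  refine (hasSum_sum (s := Finset.univ) fun i _ => hasSum_partialDeriv_mul_timeSeries hr
    (fun n => ((hv n).momentum i).wienerNorm_le θ) hdensity ht i).neg.congr_fun fun n => ?_
  rw [taylorCoeff_succ, nextTaylorCoeff]
  simp only [smul_neg]
  rw [smul_inv_smul₀ (by positivity), Finset.sum_comm, Finset.smul_sum]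

variable [IsProbabilityMeasure μ]

lemma gradPotential_average_timeSeries (hr : 0 ≤ r) (ht : ‖t‖₊ * Q ≤ 1 / 2) (j : d) :
    gradPotential j (average μ (FluidState.timeSeries (taylorCoeff μ v₀) t).density) =
      timeSeries (fun n => gradPotential j (average μ (taylorCoeff μ v₀ n).density)) t := by
  rw [← gradPotential_timeSeries hr (fun n => (hv n).density.wienerNorm_average_le μ hr)
    (ht.trans_lt one_half_lt_one)]
  exact congrArg _ (average_timeSeries μ hr (fun n => (hv n).density) ht)

lemma wienerNorm_gradPotential_average_taylorCoeff_le (hr : 0 ≤ r) (j : d) (n : ℕ) :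
    wienerNorm r (gradPotential j (average μ (taylorCoeff μ v₀ n).density)) ≤
      (B * Q ^ n : ℝ≥0) :=
  have hle := (hv n).density.wienerNorm_average_le μ hr
  (wienerNorm_gradPotential_le hr j (ne_top_of_le_ne_top ENNReal.coe_ne_top hle)).trans hle

lemma hasDerivAt_momentum_timeSeries (hr : 0 < r) (ht : ‖t‖₊ * Q ≤ 1 / 2) (θ : M) (j : d) :
    HasDerivAt (fun s => (FluidState.timeSeries (taylorCoeff μ v₀) s).momentum θ j)
      (-(∑ i, (FluidState.timeSeries (taylorCoeff μ v₀) t).momentum θ i *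
          partialDeriv i ((FluidState.timeSeries (taylorCoeff μ v₀) t).momentum θ j)) -
        gradPotential j (average μ (FluidState.timeSeries (taylorCoeff μ v₀) t).density)) t := by
  have hmomentum (i : d) (n : ℕ) := ((hv n).momentum i).wienerNorm_le θ
  have ht' : ‖t‖₊ * Q < 1 := ht.trans_lt one_half_lt_one
  refine hasDerivAt_timeSeries
    (fun n => nnnorm_le_of_wienerNorm_le hr.le (hmomentum j n)) ht' ?_
  rw [gradPotential_average_timeSeries hv hr.le ht]
  refine ((hasSum_sum (s := Finset.univ) fun i _ => hasSum_mul_partialDeriv_timeSeries hr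
    (hmomentum i) (hmomentum j) ht' i).neg.sub (hasSum_timeSeries (fun n =>
      nnnorm_le_of_wienerNorm_le hr.le
        (wienerNorm_gradPotential_average_taylorCoeff_le hv hr.le j n)) ht')).congr_fun fun n => ?_
  rw [taylorCoeff_succ, nextTaylorCoeff]
  simp only [smul_neg]
  rw [smul_inv_smul₀ (by positivity), smul_add, neg_add, ← sub_eq_add_neg, Finset.sum_comm,
    Finset.smul_sum]

lemma continuousAt_gradPotential_timeSeries (hr : 0 ≤ r) (ht : ‖t‖₊ * Q < 1 / 2) (j : d) :
    ContinuousAt (fun s => gradPotential j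
      (average μ (FluidState.timeSeries (taylorCoeff μ v₀) s).density)) t := by
  have hseries : ContinuousAt (timeSeries fun n =>
      gradPotential j (average μ (taylorCoeff μ v₀ n).density)) t :=
    tendsto_of_tendsto_wienerNorm_sub hr (tendsto_wienerNorm_timeSeries_sub hr
      (wienerNorm_gradPotential_average_taylorCoeff_le hv hr j) ht)
  exact hseries.congr ((eventually_nnnorm_mul_lt ht).mono fun s hs =>
    (gradPotential_average_timeSeries hv hr hs.le j).symm)

lemma localSolution_timeSeries (hr : 0 < r) {τ : ℝ} (hτ : ∀ t, |t| < τ → ‖t‖₊ * Q < 1 / 2) :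
    LocalSolution μ τ r (2 * B) (FluidState.timeSeries (taylorCoeff μ v₀)) where
  radius_pos := hr
  isBounded t ht := .timeSeries hr.le hv (hτ t ht).le
  tendsto_density θ t ht := tendsto_wienerNorm_timeSeries_sub hr.le
    (fun n => (hv n).density.wienerNorm_le θ) (hτ t ht)
  tendsto_momentum θ t ht j := tendsto_wienerNorm_timeSeries_sub hr.le
    (fun n => ((hv n).momentum j).wienerNorm_le θ) (hτ t ht)
  hasDerivAt_density θ t ht :=
    hasDerivAt_density_timeSeries hv hr ((hτ t ht).trans one_half_lt_one) θ
  hasDerivAt_momentum θ t ht j := hasDerivAt_momentum_timeSeries hv hr (hτ t ht).le θ j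
  continuousAt_gradPotential t ht j := continuousAt_gradPotential_timeSeries hv hr.le (hτ t ht) j

end Taylor

theorem exists_localSolution (μ : Measure M) [IsProbabilityMeasure μ] {r₀ B ε : ℝ≥0} (hε : 0 < ε)
    (hεr : ε < r₀) {v₀ : FluidState M d} (hv₀ : v₀.IsBounded r₀ B) :
    ∃ τ > 0, ∃ v, LocalSolution μ τ (r₀ - ε) (2 * B) v ∧ v 0 = v₀ := by
  obtain ⟨R, hR⟩ : ∃ R, R = 12 * NNReal.pi * Fintype.card d * B + 3 * r₀ := ⟨_, rfl⟩
  have hRpos : 0 < R := hR ▸ lt_add_of_le_of_pos zero_le (mul_pos three_pos (hε.trans hεr))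
  set Q : ℝ≥0 := 4 * R / ε
  have hQ : 0 < Q := by positivity
  have hv (n : ℕ) : (taylorCoeff μ v₀ n).IsBounded (r₀ - ε) (B * Q ^ n) := by
    have hn := isBounded_taylorCoeff μ hR.ge hv₀ n hε hεr.le
    exact ⟨hn.density.mono le_rfl (taylorBound_le n),
      fun j => (hn.momentum j).mono le_rfl (taylorBound_le n)⟩
  refine ⟨(1 / 2 / Q : ℝ≥0), by positivity, FluidState.timeSeries (taylorCoeff μ v₀),
    localSolution_timeSeries hv (sub_pos.2 hεr) fun t ht => ?_, ?_⟩
  · rw [← Real.norm_eq_abs] at ht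
    exact (lt_div_iff₀ hQ).1 (mod_cast ht)
  · rw [FluidState.timeSeries_zero, taylorCoeff_zero]

end LocalSolution

/-! ### Positivity of the densities -/

section Positivity

lemma nonpos_of_isMinOn_Icc {f : ℝ → ℝ} {f' a b : ℝ} (hab : a < b) (hmin : IsMinOn f (Icc a b) b)
    (hf : HasDerivAt f f' b) : f' ≤ 0 := by
  have hcone : a - b ∈ posTangentConeAt (Icc a b) b :=
    sub_mem_posTangentConeAt_of_segment_subset (by rw [segment_symm, segment_eq_Icc hab.le])
  have hnonneg : 0 ≤ (a - b) * f' := by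
    simpa using hmin.localize.hasFDerivWithinAt_nonneg hf.hasFDerivAt.hasFDerivWithinAt hcone
  exact nonpos_of_mul_nonneg_right hnonneg (sub_neg.2 hab)

lemma exists_forall_exp_mul_le {X : Type*} [TopologicalSpace X] [CompactSpace X] [Nonempty X]
    {T : ℝ} (hT : 0 ≤ T) (L : ℝ) {ρ : ℝ → C(X, ℝ)} (hρ : ContinuousOn ρ (Icc 0 T)) :
    ∃ s ∈ Icc 0 T, ∃ y, ∀ t ∈ Icc 0 T, ∀ x,
      Real.exp (-(L * s)) * ρ s y ≤ Real.exp (-(L * t)) * ρ t x := by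
  have hpair : ContinuousOn (fun p : ℝ × X => (ρ p.1, p.2)) (Icc 0 T ×ˢ univ) :=
    (hρ.comp continuousOn_fst fun _ hp => hp.1).prodMk continuousOn_snd
  have hcont : ContinuousOn (fun p : ℝ × X => Real.exp (-(L * p.1)) * ρ p.1 p.2)
      (Icc 0 T ×ˢ univ) :=
    ContinuousOn.mul (by fun_prop) (ContinuousEval.continuous_eval.comp_continuousOn hpair)
  obtain ⟨⟨s, y⟩, ⟨hs, -⟩, hmin⟩ := (isCompact_Icc.prod isCompact_univ).exists_isMinOn
    ⟨(0, Classical.arbitrary X), left_mem_Icc.2 hT, mem_univ _⟩ hcont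
  exact ⟨s, hs, y, fun t ht x => hmin (a := (t, x)) ⟨ht, mem_univ x⟩⟩

variable {d : Type*} [Fintype d] {r : ℝ}

lemma partialDeriv_eq_zero_of_forall_le (hr : 0 < r) {g : C(UnitAddTorus d, ℝ)}
    (hg : wienerNorm r g ≠ ⊤) {x : UnitAddTorus d} (hx : ∀ y, g x ≤ g y) (i : d) :
    partialDeriv i g x = 0 := by
  classical
  refine IsLocalMin.hasDerivAt_eq_zero (.of_forall fun s => ?_) (hasDerivAt_partialDeriv hr hg i x)
  simpa using hx (x + Pi.single i (s : UnitAddCircle))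

/-- At a negative minimum of `e^{-Lt} ρ` at a positive time the time derivative is positive. -/
lemma nonneg_of_transport (hr : 0 < r) {T L : ℝ} {ρ : ℝ → C(UnitAddTorus d, ℝ)}
    {b : ℝ → UnitAddTorus d → d → ℝ} {c : ℝ → UnitAddTorus d → ℝ}
    (hρ : ContinuousOn ρ (Icc 0 T)) (hρr : ∀ t ∈ Icc 0 T, wienerNorm r (ρ t) ≠ ⊤)
    (hc : ∀ t ∈ Icc 0 T, ∀ x, -L < c t x) (hzero : ∀ x, 0 ≤ ρ 0 x)
    (hderiv : ∀ t ∈ Icc 0 T, ∀ x, HasDerivAt (fun s => ρ s x)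
      (-(∑ i, b t x i * partialDeriv i (ρ t) x) - c t x * ρ t x) t) :
    ∀ t ∈ Icc 0 T, ∀ x, 0 ≤ ρ t x := by
  intro t ht x
  obtain ⟨s, hs, y, hmin⟩ := exists_forall_exp_mul_le (ht.1.trans ht.2) L hρ
  suffices hsy : 0 ≤ ρ s y from (mul_nonneg_iff_of_pos_left (Real.exp_pos _)).1
    ((mul_nonneg (Real.exp_pos _).le hsy).trans (hmin t ht x))
  by_contra! hneg
  have hspos : 0 < s := hs.1.lt_of_ne fun h => (hzero y).not_gt (h ▸ hneg)
  have hgrad (i : d) : partialDeriv i (ρ s) y = 0 :=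
    partialDeriv_eq_zero_of_forall_le hr (hρr s hs)
      (fun z => le_of_mul_le_mul_left (hmin s hs z) (Real.exp_pos _)) i
  have hexp : HasDerivAt (fun a : ℝ => Real.exp (-(L * a))) (Real.exp (-(L * s)) * -L) s := by
    simpa using ((hasDerivAt_id s).const_mul L).neg.exp
  have hweighted : HasDerivAt (fun a => Real.exp (-(L * a)) * ρ a y)
      (Real.exp (-(L * s)) * ((L + c s y) * -ρ s y)) s := by
    refine (hexp.mul (hderiv s hs y)).congr_deriv ?_
    simp only [hgrad, mul_zero, Finset.sum_const_zero]
    ring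
  have hmin_time : IsMinOn (fun a => Real.exp (-(L * a)) * ρ a y) (Icc 0 s) s :=
    fun a ha => hmin a ⟨ha.1, ha.2.trans hs.2⟩ y
  refine (nonpos_of_isMinOn_Icc hspos hmin_time hweighted).not_gt
    (mul_pos (Real.exp_pos _) (mul_pos ?_ (neg_pos.2 hneg)))
  linarith [hc s hs y]

end Positivity

/-! ### Properties of local solutions -/

lemma abs_lt_of_mem_Icc {T τ t : ℝ} (hT : T < τ) (ht : t ∈ Icc 0 T) : |t| < τ :=
  (abs_of_nonneg ht.1).trans_lt (ht.2.trans_lt hT)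

namespace LocalSolution

variable {M d : Type*} [MeasurableSpace M] [Fintype d] {μ : Measure M} {τ r : ℝ} {C : ℝ≥0}

section General

variable {v : ℝ → FluidState M d} (h : LocalSolution μ τ r C v)

include h

lemma density_ne_top (θ : M) {t : ℝ} (ht : |t| < τ) : wienerNorm r ((v t).density θ) ≠ ⊤ :=
  (h.isBounded t ht).density.wienerNorm_ne_top θ

lemma momentum_ne_top (θ : M) {t : ℝ} (ht : |t| < τ) (j : d) :
    wienerNorm r ((v t).momentum θ j) ≠ ⊤ :=
  ((h.isBounded t ht).momentum j).wienerNorm_ne_top θ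

lemma momentum_mul_density_ne_top (θ : M) {t : ℝ} (ht : |t| < τ) (j : d) :
    wienerNorm r ((v t).momentum θ j * (v t).density θ) ≠ ⊤ :=
  (((h.isBounded t ht).momentum j).mul h.radius_pos.le
    (h.isBounded t ht).density).wienerNorm_ne_top θ

lemma hasDerivAt_density_apply (θ : M) {t : ℝ} (ht : |t| < τ) (x : UnitAddTorus d) :
    HasDerivAt (fun s => (v s).density θ x)
      (-∑ i, partialDeriv i ((v t).momentum θ i * (v t).density θ) x) t := by
  simpa using! (ContinuousMap.evalCLM ℝ x).hasFDerivAt.comp_hasDerivAt t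
    (h.hasDerivAt_density θ t ht)

lemma hasDerivAt_momentum_apply (θ : M) {t : ℝ} (ht : |t| < τ) (j : d) (x : UnitAddTorus d) :
    HasDerivAt (fun s => (v s).momentum θ j x)
      (-(∑ i, (v t).momentum θ i x * partialDeriv i ((v t).momentum θ j) x) -
        gradPotential j (average μ (v t).density) x) t := by
  simpa using! (ContinuousMap.evalCLM ℝ x).hasFDerivAt.comp_hasDerivAt t
    (h.hasDerivAt_momentum θ t ht j)

lemma integral_density (θ : M) {t : ℝ} (ht : |t| < τ) :
    ∫ x, (v t).density θ x ∂torusHaar d = ∫ x, (v 0).density θ x ∂torusHaar d := by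
  have hderiv (s : ℝ) (hs : s ∈ Metric.ball (0 : ℝ) τ) :
      HasDerivAt (fun s => realFourierCoeff 0 ((v s).density θ)) 0 s := by
    rw [mem_ball_zero_iff] at hs
    refine ((realFourierCoeff (0 : d → ℤ)).hasFDerivAt.comp_hasDerivAt s
      (h.hasDerivAt_density θ s hs)).congr_deriv ?_
    rw [map_neg, map_sum, neg_eq_zero]
    refine Finset.sum_eq_zero fun i _ => ?_
    rw [realFourierCoeff_partialDeriv h.radius_pos i (h.momentum_mul_density_ne_top θ hs i)]
    simp [partialSymbol]
  have hconst := Metric.isOpen_ball.is_const_of_deriv_eq_zero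
    (convex_ball (0 : ℝ) τ).isPreconnected
    (fun s hs => (hderiv s hs).differentiableAt.differentiableWithinAt)
    (fun s hs => (hderiv s hs).deriv) (mem_ball_zero_iff.2 ht)
    (Metric.mem_ball_self ((abs_nonneg t).trans_lt ht))
  simp only [realFourierCoeff_zero] at hconst
  exact mod_cast hconst

lemma density_nonneg {T : ℝ} (hT : T < τ) {θ : M} (hzero : ∀ x, 0 ≤ (v 0).density θ x) :
    ∀ t ∈ Icc 0 T, ∀ x, 0 ≤ (v t).density θ x := by
  have hτ {t : ℝ} (ht : t ∈ Icc 0 T) : |t| < τ := abs_lt_of_mem_Icc hT ht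
  set K : ℝ≥0 := 2 * NNReal.pi / r.toNNReal * C
  have hbound {t : ℝ} (ht : t ∈ Icc 0 T) (i : d) (x : UnitAddTorus d) :
      |partialDeriv i ((v t).momentum θ i) x| ≤ K :=
    ((partialDeriv i ((v t).momentum θ i)).norm_coe_le_norm x).trans (nnnorm_partialDeriv_le
      h.radius_pos (((h.isBounded t (hτ ht)).momentum i).wienerNorm_le θ) i)
  refine nonneg_of_transport (L := ∑ _i : d, (K : ℝ) + 1)
    (b := fun t x i => (v t).momentum θ i x)
    (c := fun t x => ∑ i, partialDeriv i ((v t).momentum θ i) x) h.radius_pos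
    (fun t ht => (h.hasDerivAt_density θ t (hτ ht)).continuousAt.continuousWithinAt)
    (fun t ht => h.density_ne_top θ (hτ ht)) (fun t ht x => ?_) hzero fun t ht x => ?_
  · calc -(∑ _i : d, (K : ℝ) + 1) < -∑ _i : d, (K : ℝ) := neg_lt_neg (lt_add_one _)
      _ = ∑ _i : d, -(K : ℝ) := Finset.sum_neg_distrib _ |>.symm
      _ ≤ _ := Finset.sum_le_sum fun i _ => (abs_le.1 (hbound ht i x)).1
  · refine (h.hasDerivAt_density_apply θ (hτ ht) x).congr_deriv ?_
    simp only [partialDeriv_mul h.radius_pos (h.momentum_ne_top θ (hτ ht) _)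
      (h.density_ne_top θ (hτ ht)), ContinuousMap.add_apply, ContinuousMap.mul_apply,
      Finset.sum_add_distrib, Finset.sum_mul]
    ring

variable [IsProbabilityMeasure μ]

lemma average_ne_top {t : ℝ} (ht : |t| < τ) : wienerNorm r (average μ (v t).density) ≠ ⊤ :=
  ne_top_of_le_ne_top ENNReal.coe_ne_top
    ((h.isBounded t ht).density.wienerNorm_average_le μ h.radius_pos.le)

lemma poissonPotential_ne_top {t : ℝ} (ht : |t| < τ) :
    wienerNorm r (poissonPotential (average μ (v t).density)) ≠ ⊤ :=
  ne_top_of_le_ne_top (h.average_ne_top ht)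
    (wienerNorm_poissonPotential_le h.radius_pos.le (h.average_ne_top ht))

lemma integral_average {t : ℝ} (ht : |t| < τ) :
    ∫ x, average μ (v t).density x ∂torusHaar d =
      ∫ θ, ∫ x, (v 0).density θ x ∂torusHaar d ∂μ := by
  have hbounded := (h.isBounded t ht).density
  simp only [hbounded.average_apply μ h.radius_pos.le]
  rw [← integral_integral_swap (hbounded.integrable_uncurry μ h.radius_pos.le)]
  exact integral_congr_ae (ae_of_all _ fun θ => h.integral_density θ ht)

end General

section ThreeTorus

variable [IsProbabilityMeasure μ] {v : ℝ → FluidState M (Fin 3)} (h : LocalSolution μ τ r C v)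

include h

lemma torusPartial_poissonPotential {t : ℝ} (ht : |t| < τ) (j : Fin 3) (x : T3) :
    torusPartial j (poissonPotential (average μ (v t).density)) x =
      gradPotential j (average μ (v t).density) x := by
  rw [torusPartial_eq_partialDeriv h.radius_pos (h.poissonPotential_ne_top ht),
    partialDeriv_poissonPotential h.radius_pos.le j (h.average_ne_top ht)]

theorem isMultifluidSolution {T : ℝ} (hT : T < τ)
    (hmass : ∫ θ, ∫ x, (v 0).density θ x ∂torusMeasure ∂μ = 1) :
    IsMultifluidSolution μ T (v 0).density (v 0).momentum (fun θ t => (v t).density θ)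
      (fun θ t => (v t).momentum θ) fun t => poissonPotential (average μ (v t).density) := by
  have hr : 0 < r := h.radius_pos
  have hτ {t : ℝ} (ht : t ∈ Icc 0 T) : |t| < τ := abs_lt_of_mem_Icc hT ht
  exact
  { measurable_density t ht := (h.isBounded t (hτ ht)).density.measurable
    measurable_momentum t ht j := ((h.isBounded t (hτ ht)).momentum j).measurable
    integrable_density t ht := (h.isBounded t (hτ ht)).density.integrable μ hr.le
    contDiff_density θ t ht := torusContDiff_of_wienerNorm_ne_top 1 hr (h.density_ne_top θ (hτ ht))
    contDiff_momentum θ t ht j :=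
      torusContDiff_of_wienerNorm_ne_top 1 hr (h.momentum_ne_top θ (hτ ht) j)
    contDiff_potential t ht :=
      torusContDiff_of_wienerNorm_ne_top 2 hr (h.poissonPotential_ne_top (hτ ht))
    continuity θ t ht x := by
      refine ((h.hasDerivAt_density_apply θ (hτ ht) x).congr_deriv ?_).hasDerivWithinAt
      congr 1
      refine Finset.sum_congr rfl fun i _ => ?_
      rw [← torusPartial_eq_partialDeriv hr (h.momentum_mul_density_ne_top θ (hτ ht) i)]
      rfl
    momentum θ t ht j x := by
      refine ((h.hasDerivAt_momentum_apply θ (hτ ht) j x).congr_deriv ?_).hasDerivWithinAt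
      simp only [torusPartial_eq_partialDeriv hr (h.momentum_ne_top θ (hτ ht) j),
        h.torusPartial_poissonPotential (hτ ht)]
    poisson t ht x := by
      rw [torusLaplacian_poissonPotential hr (h.average_ne_top (hτ ht)),
        (h.isBounded t (hτ ht)).density.average_apply μ hr.le]
      exact congrArg _ ((h.integral_average (hτ ht)).trans hmass)
    initial_density _ := rfl
    initial_momentum _ := rfl }

end ThreeTorus

end LocalSolution

/-! ### Differentiation under the integral sign and conservation laws -/

section MeasurablePrecompact

/-- The maps `f i`, `i ∈ S`, are measurable with values in a common compact set. This notion is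
stable under continuous operations and makes all dominated convergence arguments automatic. -/
structure MeasurablePrecompact {ι P X : Type*} [MeasurableSpace P] [MeasurableSpace X]
    [TopologicalSpace X] (S : Set ι) (f : ι → P → X) : Prop where
  measurable : ∀ i ∈ S, Measurable (f i)
  exists_isCompact : ∃ K, IsCompact K ∧ ∀ i ∈ S, ∀ p, f i p ∈ K

namespace MeasurablePrecompact

variable {ι P X Y : Type*} [MeasurableSpace P] {S : Set ι}

lemma of_norm_le [NormedAddCommGroup X] [ProperSpace X] [MeasurableSpace X] {f : ι → P → X} {C : ℝ}
    (hf : ∀ i ∈ S, Measurable (f i)) (hC : ∀ i ∈ S, ∀ p, ‖f i p‖ ≤ C) :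
    MeasurablePrecompact S f :=
  ⟨hf, Metric.closedBall 0 C, isCompact_closedBall _ _,
    fun i hi p => mem_closedBall_zero_iff.2 (hC i hi p)⟩

section Topological

variable [TopologicalSpace X] [MeasurableSpace X] [TopologicalSpace Y] [MeasurableSpace Y]
  {f : ι → P → X} {g : ι → P → Y}

lemma of_compactSpace [CompactSpace X] (hf : ∀ i ∈ S, Measurable (f i)) :
    MeasurablePrecompact S f :=
  ⟨hf, univ, isCompact_univ, fun _ _ _ => mem_univ _⟩

lemma const (x : X) : MeasurablePrecompact S fun _ (_ : P) => x :=
  ⟨fun _ _ => measurable_const, {x}, isCompact_singleton, fun _ _ _ => mem_singleton x⟩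

lemma continuous_comp [OpensMeasurableSpace X] [BorelSpace Y] {F : X → Y} (hF : Continuous F)
    (hf : MeasurablePrecompact S f) : MeasurablePrecompact S fun i p => F (f i p) := by
  obtain ⟨K, hK, hmem⟩ := hf.exists_isCompact
  exact ⟨fun i hi => hF.measurable.comp (hf.measurable i hi), F '' K, hK.image hF,
    fun i hi p => mem_image_of_mem F (hmem i hi p)⟩

lemma prodMk (hf : MeasurablePrecompact S f) (hg : MeasurablePrecompact S g) :
    MeasurablePrecompact S fun i p => (f i p, g i p) := by
  obtain ⟨K, hK, hfK⟩ := hf.exists_isCompact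
  obtain ⟨L, hL, hgL⟩ := hg.exists_isCompact
  exact ⟨fun i hi => (hf.measurable i hi).prodMk (hg.measurable i hi), K ×ˢ L, hK.prod hL,
    fun i hi p => ⟨hfK i hi p, hgL i hi p⟩⟩

lemma pi {κ : Type*} {f : κ → ι → P → X} (hf : ∀ k, MeasurablePrecompact S (f k)) :
    MeasurablePrecompact S fun i p k => f k i p := by
  choose K hK hmem using fun k => (hf k).exists_isCompact
  exact ⟨fun i hi => measurable_pi_lambda _ fun k => (hf k).measurable i hi, univ.pi K,
    isCompact_univ_pi hK, fun i hi p k _ => hmem k i hi p⟩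

end Topological

variable {f g : ι → P → ℝ}

lemma add (hf : MeasurablePrecompact S f) (hg : MeasurablePrecompact S g) :
    MeasurablePrecompact S fun i p => f i p + g i p :=
  continuous_comp continuous_add (hf.prodMk hg)

lemma sub (hf : MeasurablePrecompact S f) (hg : MeasurablePrecompact S g) :
    MeasurablePrecompact S fun i p => f i p - g i p :=
  continuous_comp continuous_sub (hf.prodMk hg)

lemma mul (hf : MeasurablePrecompact S f) (hg : MeasurablePrecompact S g) :
    MeasurablePrecompact S fun i p => f i p * g i p :=
  continuous_comp continuous_mul (hf.prodMk hg)

lemma sum {κ : Type*} [Countable κ] {f : κ → ι → P → ℝ} (s : Finset κ)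
    (hf : ∀ k, MeasurablePrecompact S (f k)) :
    MeasurablePrecompact S fun i p => ∑ k ∈ s, f k i p :=
  continuous_comp (F := fun a : κ → ℝ => ∑ k ∈ s, a k) (by fun_prop) (pi hf)

lemma exists_norm_le (hf : MeasurablePrecompact S f) : ∃ C, ∀ i ∈ S, ∀ p, ‖f i p‖ ≤ C := by
  obtain ⟨K, hK, hmem⟩ := hf.exists_isCompact
  obtain ⟨C, hC⟩ := hK.isBounded.exists_norm_le
  exact ⟨C, fun i hi p => hC _ (hmem i hi p)⟩

variable {ν : Measure P} [IsFiniteMeasure ν]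

lemma integrable (hf : MeasurablePrecompact S f) {i : ι} (hi : i ∈ S) : Integrable (f i) ν := by
  obtain ⟨C, hC⟩ := hf.exists_norm_le
  exact (integrable_const C).mono' (hf.measurable i hi).aestronglyMeasurable (ae_of_all _ (hC i hi))

lemma exists_norm_integral_le (hf : MeasurablePrecompact S f) :
    ∃ C, ∀ i ∈ S, ‖∫ p, f i p ∂ν‖ ≤ C := by
  obtain ⟨C, hC⟩ := hf.exists_norm_le
  exact ⟨C * ν.real univ, fun i hi => norm_integral_le_of_norm_le_const (ae_of_all _ (hC i hi))⟩

lemma hasDerivAt_integral {S : Set ℝ} (hS : IsOpen S) {F F' : ℝ → P → ℝ}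
    (hF : MeasurablePrecompact S F) (hF' : MeasurablePrecompact S F')
    (hderiv : ∀ t ∈ S, ∀ p, HasDerivAt (fun s => F s p) (F' t p) t) {t : ℝ} (ht : t ∈ S) :
    HasDerivAt (fun s => ∫ p, F s p ∂ν) (∫ p, F' t p ∂ν) t := by
  obtain ⟨C, hC⟩ := hF'.exists_norm_le
  have hnhds : S ∈ 𝓝 t := hS.mem_nhds ht
  exact (hasDerivAt_integral_of_dominated_loc_of_deriv_le (bound := fun _ => C) hnhds
    (mem_of_superset hnhds fun s hs => (hF.measurable s hs).aestronglyMeasurable)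
    (hF.integrable ht) (hF'.measurable t ht).aestronglyMeasurable
    (ae_of_all _ fun p s hs => hC s hs p) (integrable_const C)
    (ae_of_all _ fun p s hs => hderiv s hs p)).2

end MeasurablePrecompact

/-- One-parameter groups of transformations that preserve the measure `ν`. -/
structure IsMeasurePreservingFlow {P : Type*} [MeasurableSpace P] (ν : Measure P)
    (σ : ℝ → P → P) : Prop where
  measurePreserving : ∀ s, MeasurePreserving (σ s) ν ν
  zero_apply : ∀ p, σ 0 p = p
  add_apply : ∀ s t p, σ (s + t) p = σ t (σ s p)

variable {P : Type*} [MeasurableSpace P] {ν : Measure P} [IsFiniteMeasure ν]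

lemma IsMeasurePreservingFlow.integral_deriv_eq_zero {σ : ℝ → P → P}
    (hσ : IsMeasurePreservingFlow ν σ) {G G' : P → ℝ} {C C' : ℝ} (hG : Measurable G)
    (hC : ∀ p, ‖G p‖ ≤ C) (hC' : ∀ p, ‖G' p‖ ≤ C')
    (hderiv : ∀ p, HasDerivAt (fun s => G (σ s p)) (G' p) 0) : ∫ p, G' p ∂ν = 0 := by
  have hmeas (s : ℝ) : Measurable (σ s) := (hσ.measurePreserving s).measurable
  have hG' : Measurable G' := measurable_of_hasDerivAt (fun s => hG.comp (hmeas s)) hderiv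
  have hflow (s : ℝ) (p : P) : HasDerivAt (fun a => G (σ a p)) (G' (σ s p)) s := by
    have hshift := HasDerivAt.comp_sub_const (f := fun a => G (σ a (σ s p))) s s
      (by simpa using hderiv (σ s p))
    simpa only [← hσ.add_apply, add_sub_cancel] using hshift
  have hconst (s : ℝ) : ∫ p, G (σ s p) ∂ν = ∫ p, G p ∂ν := by
    rw [← integral_map (hmeas s).aemeasurable hG.aestronglyMeasurable,
      (hσ.measurePreserving s).map_eq]
  have hmoving := MeasurablePrecompact.hasDerivAt_integral (ν := ν) isOpen_univ
    (.of_norm_le (fun s _ => hG.comp (hmeas s)) fun s _ p => hC (σ s p))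
    (.of_norm_le (fun s _ => hG'.comp (hmeas s)) fun s _ p => hC' (σ s p))
    (fun s _ p => hflow s p) (mem_univ 0)
  simp only [Function.comp_apply, hσ.zero_apply, hconst] at hmoving
  exact hmoving.unique (hasDerivAt_const 0 _)

/-- The derivatives of the fluxes `Gᵢ` integrate to zero because the flows preserve `ν`. -/
lemma hasDerivAt_integral_of_conservationLaw {ι : Type*} [Fintype ι] {σ : ι → ℝ → P → P}
    (hσ : ∀ i, IsMeasurePreservingFlow ν (σ i)) {S : Set ℝ} (hS : IsOpen S) {F R : ℝ → P → ℝ}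
    {G G' : ι → ℝ → P → ℝ} (hF : MeasurablePrecompact S F) (hR : MeasurablePrecompact S R)
    (hG : ∀ i, MeasurablePrecompact S (G i)) (hG' : ∀ i, MeasurablePrecompact S (G' i))
    (hflux : ∀ i, ∀ t ∈ S, ∀ p, HasDerivAt (fun s => G i t (σ i s p)) (G' i t p) 0)
    (hderiv : ∀ t ∈ S, ∀ p, HasDerivAt (fun s => F s p) (R t p - ∑ i, G' i t p) t)
    {t : ℝ} (ht : t ∈ S) :
    HasDerivAt (fun s => ∫ p, F s p ∂ν) (∫ p, R t p ∂ν) t := by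
  have hzero (i : ι) : ∫ p, G' i t p ∂ν = 0 := by
    obtain ⟨C, hC⟩ := (hG i).exists_norm_le
    obtain ⟨C', hC'⟩ := (hG' i).exists_norm_le
    exact (hσ i).integral_deriv_eq_zero ((hG i).measurable t ht) (hC t ht) (hC' t ht)
      (hflux i t ht)
  refine (hF.hasDerivAt_integral hS (hR.sub (.sum _ hG')) hderiv ht).congr_deriv ?_
  rw [integral_sub (hR.integrable ht) (integrable_finsetSum _ fun i _ => (hG' i).integrable ht),
    integral_finsetSum _ fun i _ => (hG' i).integrable ht]
  simp only [hzero, Finset.sum_const_zero, sub_zero]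

lemma isMeasurePreservingFlow_add_single {d : Type*} [Fintype d] [DecidableEq d] (i : d) :
    IsMeasurePreservingFlow (torusHaar d)
      fun s x => x + Pi.single i (s : UnitAddCircle) where
  measurePreserving s := measurePreserving_add_right _ _
  zero_apply x := by simp
  add_apply s t x := by rw [AddCircle.coe_add, Pi.single_add, add_assoc]

lemma IsMeasurePreservingFlow.prodMap_id {M : Type*} [MeasurableSpace M] {μ : Measure M}
    [IsFiniteMeasure μ] {σ : ℝ → P → P} (hσ : IsMeasurePreservingFlow ν σ) :
    IsMeasurePreservingFlow (μ.prod ν) fun s => Prod.map id (σ s) where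
  measurePreserving s := (MeasurePreserving.id μ).prod (hσ.measurePreserving s)
  zero_apply p := Prod.ext rfl (hσ.zero_apply p.2)
  add_apply s t p := Prod.ext rfl (hσ.add_apply s t p.2)

end MeasurablePrecompact

/-! ### Derivatives on phase space -/

section Phase

lemma continuous_of_continuous_comp_torusCover {d E X : Type*} [TopologicalSpace E]
    [TopologicalSpace X] {F : ℝ × UnitAddTorus d × E → X}
    (hF : Continuous fun p : ℝ × (d → ℝ) × E => F (p.1, torusCover p.2.1, p.2.2)) : Continuous F :=
  (IsOpenQuotientMap.id.prodMap
    (isOpenQuotientMap_torusCover.prodMap .id)).isQuotientMap.continuous_iff.2 hF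

variable {d E : Type*} [NormedAddCommGroup E] [NormedSpace ℝ E] {Ψ : ℝ → UnitAddTorus d → E → ℝ}

/-- The lift to `ℝ × ℝ^d × E` of a function of time, position and momentum. -/
def phaseLift (Ψ : ℝ → UnitAddTorus d → E → ℝ) (p : ℝ × (d → ℝ) × E) : ℝ :=
  Ψ p.1 (torusCover p.2.1) p.2.2

/-- The derivative of a function of time, position and momentum. Tangent vectors of the torus are
identified with `ℝ^d` by the covering map, and the base point is moved to the origin. -/
def phaseDeriv (Ψ : ℝ → UnitAddTorus d → E → ℝ) (t : ℝ) (x : UnitAddTorus d) (v : E) :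
    ℝ × (d → ℝ) × E →L[ℝ] ℝ :=
  fderiv ℝ (fun q => Ψ (t + q.1) (x + torusCover q.2.1) (v + q.2.2)) 0

lemma phaseDeriv_torusCover [Finite d] (Ψ : ℝ → UnitAddTorus d → E → ℝ) (t : ℝ) (w : d → ℝ)
    (v : E) :
    phaseDeriv Ψ t (torusCover w) v = fderiv ℝ (phaseLift Ψ) (t, w, v) := by
  cases nonempty_fintype d
  have h := fderiv_comp_add_left (𝕜 := ℝ) (f := phaseLift Ψ) (x := 0) (t, w, v)
  rw [add_zero] at h
  exact h

variable [Fintype d]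

lemma hasDerivAt_phase (hΨ : ContDiff ℝ 1 (phaseLift Ψ)) {α : ℝ → ℝ} {β : ℝ → d → ℝ} {γ : ℝ → E}
    {α' s : ℝ} {β' : d → ℝ} {γ' : E} (hα : HasDerivAt α α' s) (hβ : HasDerivAt β β' s)
    (hγ : HasDerivAt γ γ' s) (x : UnitAddTorus d) :
    HasDerivAt (fun a => Ψ (α a) (x + torusCover (β a)) (γ a))
      (phaseDeriv Ψ (α s) (x + torusCover (β s)) (γ s) (α', β', γ')) s := by
  obtain ⟨w, -, rfl⟩ := exists_torusCover_eq x
  simp only [← torusCover_add, phaseDeriv_torusCover]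
  exact (hΨ.differentiable one_ne_zero (α s, w + β s, γ s)).hasFDerivAt.comp_hasDerivAt s
    (hα.prodMk ((hβ.const_add w).prodMk hγ))

lemma continuous_phaseDeriv (hΨ : ContDiff ℝ 1 (phaseLift Ψ)) :
    Continuous fun p : ℝ × UnitAddTorus d × E => phaseDeriv Ψ p.1 p.2.1 p.2.2 := by
  refine continuous_of_continuous_comp_torusCover ?_
  simp only [phaseDeriv_torusCover]
  exact hΨ.continuous_fderiv one_ne_zero

end Phase

/-! ### Transport of test functions by the fluids -/

section Transport

variable {M d : Type*}

namespace FluidState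

/-- The momentum vector `ξ_θ(x)` at `p = (θ, x)`. -/
def momentumVector (v : FluidState M d) (p : M × UnitAddTorus d) : EuclideanSpace ℝ d :=
  WithLp.toLp 2 fun j => v.momentum p.1 j p.2

/-- The force field `-∇φ` generated by the average density of the fluids. -/
def forceField [Fintype d] [MeasurableSpace M] (μ : Measure M) (v : FluidState M d) :
    C(UnitAddTorus d, EuclideanSpace ℝ d) where
  toFun x := WithLp.toLp 2 fun j => -gradPotential j (average μ v.density) x
  continuous_toFun := by fun_prop

end FluidState

variable [MeasurableSpace M] [Fintype d]

lemma IsBoundedFamily.measurablePrecompact {ι : Type*} {S : Set ι} {r : ℝ} {C : ℝ≥0}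
    {g : ι → M → C(UnitAddTorus d, ℝ)} (hr : 0 ≤ r) (hg : ∀ i ∈ S, IsBoundedFamily r C (g i)) :
    MeasurablePrecompact S fun i (p : M × UnitAddTorus d) => g i p.1 p.2 :=
  .of_norm_le (fun i hi => measurable_uncurry_of_measurable_apply (hg i hi).measurable)
    fun i hi p => (hg i hi).abs_apply_le hr p.1 p.2

lemma IsBoundedFamily.measurablePrecompact_partialDeriv {ι : Type*} {S : Set ι} {r : ℝ} {C : ℝ≥0}
    {g : ι → M → C(UnitAddTorus d, ℝ)} (hr : 0 < r) (hg : ∀ i ∈ S, IsBoundedFamily r C (g i))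
    (k : d) :
    MeasurablePrecompact S fun i (p : M × UnitAddTorus d) =>
      VlasovPoisson.partialDeriv k (g i p.1) p.2 :=
  measurablePrecompact le_rfl fun i hi =>
    (hg i hi).partialDeriv le_rfl (Real.toNNReal_pos.2 hr) (by simp [hr.le]) k

lemma apply_transport {d : Type*} [Fintype d] [DecidableEq d]
    (L : ℝ × (d → ℝ) × EuclideanSpace ℝ d →L[ℝ] ℝ)
    (ξ e : EuclideanSpace ℝ d) (a : d → EuclideanSpace ℝ d) :
    L (1, 0, e - ∑ i, ξ i • a i) =
      L (1, ξ.ofLp, e) - ∑ i, ξ i * L (0, Pi.single i 1, a i) := by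
  have hdecomp : ((1, 0, e - ∑ i, ξ i • a i) : ℝ × (d → ℝ) × EuclideanSpace ℝ d) =
      (1, ξ.ofLp, e) - ∑ i, ξ i • (0, Pi.single i 1, a i) := by
    refine Prod.ext (by simp [Prod.fst_sum]) (Prod.ext ?_ (by simp [Prod.snd_sum]))
    simp [Prod.snd_sum, Prod.fst_sum, ← Pi.single_smul, Finset.univ_sum_single]
  simp only [hdecomp, map_sub, map_sum, map_smul, smul_eq_mul]

namespace LocalSolution

variable {μ : Measure M} {τ r : ℝ} {C : ℝ≥0} {v : ℝ → FluidState M d}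
  (h : LocalSolution μ τ r C v)

include h

lemma hasDerivAt_momentumVector {t : ℝ} (ht : |t| < τ) (p : M × UnitAddTorus d) :
    HasDerivAt (fun s => (v s).momentumVector p)
      ((v t).forceField μ p.2 - ∑ i, (v t).momentumVector p i •
        WithLp.toLp 2 fun j => partialDeriv i ((v t).momentum p.1 j) p.2) t := by
  refine ((PiLp.hasFDerivAt_toLp 2 _).comp_hasDerivAt t (hasDerivAt_pi.2 fun j =>
    h.hasDerivAt_momentum_apply p.1 ht j p.2)).congr_deriv (PiLp.ext fun j => ?_)
  simp only [FluidState.forceField, FluidState.momentumVector, ContinuousMap.coe_mk,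
    PiLp.sub_apply, WithLp.ofLp_sum, WithLp.ofLp_smul, Finset.sum_apply, Pi.smul_apply,
    smul_eq_mul]
  exact neg_sub_comm _ _

lemma hasDerivAt_momentumVector_add_single [DecidableEq d] {t : ℝ} (ht : |t| < τ)
    (p : M × UnitAddTorus d) (i : d) :
    HasDerivAt (fun s : ℝ => (v t).momentumVector (p.1, p.2 + Pi.single i (s : UnitAddCircle)))
      (WithLp.toLp 2 fun j => partialDeriv i ((v t).momentum p.1 j) p.2) 0 :=
  ((PiLp.hasFDerivAt_toLp 2 _).comp_hasDerivAt 0 (hasDerivAt_pi.2 fun j =>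
    hasDerivAt_partialDeriv h.radius_pos (h.momentum_ne_top p.1 ht j) i p.2)).congr_deriv rfl

lemma continuousAt_forceField {t : ℝ} (ht : |t| < τ) :
    ContinuousAt (fun s => (v s).forceField μ) t := by
  let assemble (g : d → C(UnitAddTorus d, ℝ)) : C(UnitAddTorus d, EuclideanSpace ℝ d) :=
    ⟨fun x => WithLp.toLp 2 fun j => -g j x, by fun_prop⟩
  have hassemble : Continuous assemble := by
    refine ContinuousMap.continuous_of_continuous_uncurry _ ?_
    change Continuous fun q : (d → C(UnitAddTorus d, ℝ)) × UnitAddTorus d =>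
      WithLp.toLp 2 fun j => -q.1 j q.2
    fun_prop
  exact hassemble.continuousAt.comp (continuousAt_pi.2 (h.continuousAt_gradPotential t ht))

lemma measurablePrecompact_density :
    MeasurablePrecompact (Metric.ball 0 τ) fun t (p : M × UnitAddTorus d) =>
      (v t).density p.1 p.2 :=
  IsBoundedFamily.measurablePrecompact h.radius_pos.le fun t ht =>
    (h.isBounded t (mem_ball_zero_iff.1 ht)).density

lemma measurablePrecompact_momentum (j : d) :
    MeasurablePrecompact (Metric.ball 0 τ) fun t (p : M × UnitAddTorus d) =>
      (v t).momentum p.1 j p.2 :=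
  IsBoundedFamily.measurablePrecompact h.radius_pos.le fun t ht =>
    (h.isBounded t (mem_ball_zero_iff.1 ht)).momentum j

lemma measurablePrecompact_momentumVector :
    MeasurablePrecompact (Metric.ball 0 τ) fun t (p : M × UnitAddTorus d) =>
      (v t).momentumVector p :=
  .continuous_comp (PiLp.continuous_toLp 2 _) (.pi h.measurablePrecompact_momentum)

lemma measurablePrecompact_partialDeriv_momentum (i : d) :
    MeasurablePrecompact (Metric.ball 0 τ) fun t (p : M × UnitAddTorus d) =>
      (WithLp.toLp 2 fun j => partialDeriv i ((v t).momentum p.1 j) p.2 : EuclideanSpace ℝ d) :=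
  .continuous_comp (PiLp.continuous_toLp 2 _) (.pi fun j =>
    IsBoundedFamily.measurablePrecompact_partialDeriv h.radius_pos
      (fun t ht => (h.isBounded t (mem_ball_zero_iff.1 ht)).momentum j) i)

lemma measurablePrecompact_partialDeriv_flux (i : d) :
    MeasurablePrecompact (Metric.ball 0 τ) fun t (p : M × UnitAddTorus d) =>
      partialDeriv i ((v t).momentum p.1 i * (v t).density p.1) p.2 :=
  IsBoundedFamily.measurablePrecompact_partialDeriv h.radius_pos (fun t ht =>
    have hbounded := h.isBounded t (mem_ball_zero_iff.1 ht)
    (hbounded.momentum i).mul h.radius_pos.le hbounded.density) i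

lemma measurablePrecompact_forceField [IsProbabilityMeasure μ] :
    MeasurablePrecompact (Metric.ball 0 τ) fun t (p : M × UnitAddTorus d) =>
      (v t).forceField μ p.2 :=
  .continuous_comp (PiLp.continuous_toLp 2 _) (.pi fun j =>
    IsBoundedFamily.measurablePrecompact h.radius_pos.le fun t ht =>
      (((h.isBounded t (mem_ball_zero_iff.1 ht)).density.gradPotential_average μ
        h.radius_pos.le j).neg))

lemma measurablePrecompact_phasePoint :
    MeasurablePrecompact (Metric.ball 0 τ) fun t (p : M × UnitAddTorus d) =>
      (t, p.2, (v t).momentumVector p) :=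
  .prodMk (.of_norm_le (fun _ _ => measurable_const) fun _ ht _ => (mem_ball_zero_iff.1 ht).le)
    (.prodMk (.of_compactSpace fun _ _ => measurable_snd) h.measurablePrecompact_momentumVector)

variable {Ψ : ℝ → UnitAddTorus d → EuclideanSpace ℝ d → ℝ} (hΨ : ContDiff ℝ 1 (phaseLift Ψ))

include hΨ

lemma measurablePrecompact_testFunction :
    MeasurablePrecompact (Metric.ball 0 τ) fun t (p : M × UnitAddTorus d) =>
      Ψ t p.2 ((v t).momentumVector p) :=
  h.measurablePrecompact_phasePoint.continuous_comp
    (continuous_of_continuous_comp_torusCover (F := fun q => Ψ q.1 q.2.1 q.2.2) hΨ.continuous)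

lemma measurablePrecompact_phaseDeriv
    {w : ℝ → M × UnitAddTorus d → ℝ × (d → ℝ) × EuclideanSpace ℝ d}
    (hw : MeasurablePrecompact (Metric.ball 0 τ) w) :
    MeasurablePrecompact (Metric.ball 0 τ) fun t (p : M × UnitAddTorus d) =>
      phaseDeriv Ψ t p.2 ((v t).momentumVector p) (w t p) :=
  (h.measurablePrecompact_phasePoint.prodMk hw).continuous_comp
    (((continuous_phaseDeriv hΨ).comp continuous_fst).clm_apply continuous_snd)

lemma hasDerivAt_testFunction {t : ℝ} (ht : |t| < τ) (p : M × UnitAddTorus d) :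
    HasDerivAt (fun s => Ψ s p.2 ((v s).momentumVector p))
      (phaseDeriv Ψ t p.2 ((v t).momentumVector p)
        (1, 0, (v t).forceField μ p.2 - ∑ i, (v t).momentumVector p i •
          WithLp.toLp 2 fun j => partialDeriv i ((v t).momentum p.1 j) p.2)) t := by
  simpa [torusCover_zero] using hasDerivAt_phase hΨ (hasDerivAt_id t)
    (hasDerivAt_const t (0 : d → ℝ)) (h.hasDerivAt_momentumVector ht p) p.2

lemma hasDerivAt_testFunction_add_single [DecidableEq d] {t : ℝ} (ht : |t| < τ)
    (p : M × UnitAddTorus d) (i : d) :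
    HasDerivAt (fun s : ℝ => Ψ t (p.2 + Pi.single i (s : UnitAddCircle))
        ((v t).momentumVector (p.1, p.2 + Pi.single i (s : UnitAddCircle))))
      (phaseDeriv Ψ t p.2 ((v t).momentumVector p) (0, Pi.single i 1,
        WithLp.toLp 2 fun j => partialDeriv i ((v t).momentum p.1 j) p.2)) 0 := by
  have hline : HasDerivAt (fun s : ℝ => Pi.single (M := fun _ : d => ℝ) i s) (Pi.single i 1) 0 :=
    hasDerivAt_single i 0
  simpa [torusCover_zero, torusCover_single] using hasDerivAt_phase hΨ (hasDerivAt_const 0 t)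
    hline (h.hasDerivAt_momentumVector_add_single ht p i) p.2

variable [IsProbabilityMeasure μ]

lemma measurablePrecompact_characteristicDeriv :
    MeasurablePrecompact (Metric.ball 0 τ) fun t (p : M × UnitAddTorus d) =>
      (v t).density p.1 p.2 * phaseDeriv Ψ t p.2 ((v t).momentumVector p)
        (1, ((v t).momentumVector p).ofLp, (v t).forceField μ p.2) :=
  h.measurablePrecompact_density.mul (h.measurablePrecompact_phaseDeriv hΨ (.prodMk (.const 1)
    (.prodMk (.continuous_comp (PiLp.continuous_ofLp 2 _) h.measurablePrecompact_momentumVector)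
      h.measurablePrecompact_forceField)))

/-- The fluids transport `ρ_θ Ψ(t, x, ξ_θ)` along their characteristics, up to divergences. -/
theorem hasDerivAt_integral_testFunction {t : ℝ} (ht : |t| < τ) :
    HasDerivAt (fun s => ∫ p, (v s).density p.1 p.2 * Ψ s p.2 ((v s).momentumVector p)
        ∂μ.prod (torusHaar d))
      (∫ p, (v t).density p.1 p.2 * phaseDeriv Ψ t p.2 ((v t).momentumVector p)
        (1, ((v t).momentumVector p).ofLp, (v t).forceField μ p.2) ∂μ.prod (torusHaar d)) t := by
  classical
  let flux (i : d) (t : ℝ) (p : M × UnitAddTorus d) : ℝ :=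
    ((v t).momentum p.1 i * (v t).density p.1) p.2
  have hdensity := h.measurablePrecompact_density
  have hflux (i : d) : MeasurablePrecompact (Metric.ball 0 τ) (flux i) :=
    (h.measurablePrecompact_momentum i).mul hdensity
  have hTest := h.measurablePrecompact_testFunction hΨ
  refine hasDerivAt_integral_of_conservationLaw (ν := μ.prod (torusHaar d)) (S := Metric.ball 0 τ)
    (G := fun i t p => flux i t p * Ψ t p.2 ((v t).momentumVector p))
    (G' := fun i t p => partialDeriv i ((v t).momentum p.1 i * (v t).density p.1) p.2 *
        Ψ t p.2 ((v t).momentumVector p) +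
      flux i t p * phaseDeriv Ψ t p.2 ((v t).momentumVector p)
        (0, Pi.single i 1, WithLp.toLp 2 fun j => partialDeriv i ((v t).momentum p.1 j) p.2))
    (fun i => (isMeasurePreservingFlow_add_single i).prodMap_id) Metric.isOpen_ball
    (hdensity.mul hTest) (h.measurablePrecompact_characteristicDeriv hΨ)
    (fun i => (hflux i).mul hTest) (fun i => ?_) (fun i t ht p => ?_) (fun t ht p => ?_)
    (mem_ball_zero_iff.2 ht)
  · exact .add (.mul (h.measurablePrecompact_partialDeriv_flux i) hTest) (.mul (hflux i)
      (h.measurablePrecompact_phaseDeriv hΨ (.prodMk (.const 0) (.prodMk (.const _)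
        (h.measurablePrecompact_partialDeriv_momentum i)))))
  · have ht' : |t| < τ := mem_ball_zero_iff.1 ht
    simpa [flux] using! (hasDerivAt_partialDeriv h.radius_pos
      (h.momentum_mul_density_ne_top p.1 ht' i) i p.2).mul
      (h.hasDerivAt_testFunction_add_single hΨ ht' p i)
  · have ht' : |t| < τ := mem_ball_zero_iff.1 ht
    refine ((h.hasDerivAt_density_apply p.1 ht' p.2).mul
      (h.hasDerivAt_testFunction hΨ ht' p)).congr_deriv ?_
    rw [apply_transport, Finset.sum_add_distrib, mul_sub, Finset.mul_sum, ← Finset.sum_mul]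
    have hflux_apply (i : d) : flux i t p =
      (v t).density p.1 p.2 * (v t).momentumVector p i := mul_comm _ _
    simp only [hflux_apply, mul_assoc]
    ring

end LocalSolution

end Transport

/-! ### Smooth test functions -/

section TestFunctions

instance : IsProbabilityMeasure torusMeasure :=
  inferInstanceAs (IsProbabilityMeasure (torusHaar (Fin 3)))

section TorusContDiff

variable {n : WithTop ℕ∞} {f g : T3 → ℝ}

lemma TorusContDiff.continuous (hg : TorusContDiff n g) : Continuous g :=
  isOpenQuotientMap_torusCover.isQuotientMap.continuous_iff.2 (ContDiff.continuous hg)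

lemma TorusContDiff.hasDerivAt_add_single (hg : TorusContDiff 1 g) (i : Fin 3) (x : T3) :
    HasDerivAt (fun s : ℝ => g (x + Pi.single i (s : UnitAddCircle))) (torusPartial i g x) 0 := by
  obtain ⟨v, -, rfl⟩ := exists_torusCover_eq x
  have hv := (ContDiff.differentiable hg one_ne_zero v).hasFDerivAt
  exact (VlasovPoisson.hasDerivAt_add_single hv i).differentiableAt.hasDerivAt

lemma TorusContDiff.torusPartial (hg : TorusContDiff (n + 1) g) (i : Fin 3) :
    TorusContDiff n (torusPartial i g) := by
  have hlift : (fun v => VlasovPoisson.torusPartial i g (torusProj v)) =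
      fun v => fderiv ℝ (fun w => g (torusProj w)) v (Pi.single i 1) := funext fun v =>
    torusPartial_apply_torusProj (ContDiff.differentiable hg (by simp) v).hasFDerivAt i
  rw [TorusContDiff, hlift]
  exact (ContDiff.fderiv_right hg le_rfl).clm_apply contDiff_const

lemma integral_mul_torusPartial (hf : TorusContDiff 1 f) (hg : TorusContDiff 1 g) (i : Fin 3) :
    ∫ x, f x * torusPartial i g x ∂torusMeasure = -∫ x, torusPartial i f x * g x ∂torusMeasure := by
  have hf₀ := hf.continuous
  have hg₀ := hg.continuous
  have hf₁ : Continuous (torusPartial i f) := (TorusContDiff.torusPartial (n := 0) hf i).continuous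
  have hg₁ : Continuous (torusPartial i g) := (TorusContDiff.torusPartial (n := 0) hg i).continuous
  obtain ⟨C, hC⟩ := isCompact_univ.exists_bound_of_continuousOn (hf₀.mul hg₀).continuousOn
  obtain ⟨C', hC'⟩ := isCompact_univ.exists_bound_of_continuousOn
    ((hf₁.mul hg₀).add (hf₀.mul hg₁)).continuousOn
  have hzero := (isMeasurePreservingFlow_add_single i).integral_deriv_eq_zero
    (hf₀.mul hg₀).measurable (fun x => hC x (mem_univ x)) (fun x => hC' x (mem_univ x))
    fun x => by simpa using! (hf.hasDerivAt_add_single i x).mul (hg.hasDerivAt_add_single i x)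
  rw [eq_neg_iff_add_eq_zero, add_comm, ← hzero]
  exact (integral_add (integrable_of_continuous_torus (hf₁.mul hg₀))
    (integrable_of_continuous_torus (hf₀.mul hg₁))).symm

lemma integral_mul_torusLaplacian (hf : TorusContDiff 2 f) (hg : TorusContDiff 2 g) :
    ∫ x, f x * torusLaplacian g x ∂torusMeasure =
      ∫ x, torusLaplacian f x * g x ∂torusMeasure := by
  have hf₁ (i : Fin 3) : TorusContDiff 1 (torusPartial i f) := TorusContDiff.torusPartial hf i
  have hg₁ (i : Fin 3) : TorusContDiff 1 (torusPartial i g) := TorusContDiff.torusPartial hg i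
  have hf₂ (i : Fin 3) : Continuous (torusPartial i (torusPartial i f)) :=
    (TorusContDiff.torusPartial (n := 0) (hf₁ i) i).continuous
  have hg₂ (i : Fin 3) : Continuous (torusPartial i (torusPartial i g)) :=
    (TorusContDiff.torusPartial (n := 0) (hg₁ i) i).continuous
  have hfg₂ (i : Fin 3) :
      Integrable (fun x => f x * torusPartial i (torusPartial i g) x) torusMeasure :=
    integrable_of_continuous_torus (hf.continuous.mul (hg₂ i))
  have hf₂g (i : Fin 3) :
      Integrable (fun x => torusPartial i (torusPartial i f) x * g x) torusMeasure :=
    integrable_of_continuous_torus ((hf₂ i).mul hg.continuous)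
  simp only [torusLaplacian, Finset.mul_sum, Finset.sum_mul]
  rw [integral_finsetSum _ fun i _ => hfg₂ i, integral_finsetSum _ fun i _ => hf₂g i]
  refine Finset.sum_congr rfl fun i _ => ?_
  rw [integral_mul_torusPartial (hf.of_le one_le_two) (hg₁ i),
    integral_mul_torusPartial (hf₁ i) (hg.of_le one_le_two), neg_neg]

end TorusContDiff

section PhaseSpace

variable {Ψ : ℝ → T3 → R3 → ℝ} (hΨ : ContDiff ℝ 1 (phaseLift Ψ)) (t : ℝ) (x : T3) (ξ e : R3)

include hΨ

lemma phaseDeriv_time : phaseDeriv Ψ t x ξ (1, 0, 0) = deriv (fun s => Ψ s x ξ) t := by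
  simpa [torusCover_zero] using (hasDerivAt_phase hΨ (hasDerivAt_id t)
    (hasDerivAt_const t (0 : Fin 3 → ℝ)) (hasDerivAt_const t ξ) x).deriv.symm

lemma phaseDeriv_position (i : Fin 3) :
    phaseDeriv Ψ t x ξ (0, Pi.single i 1, 0) = torusPartial i (fun y => Ψ t y ξ) x := by
  have hline : HasDerivAt (fun s : ℝ => Pi.single (M := fun _ : Fin 3 => ℝ) i s)
    (Pi.single i 1) 0 := hasDerivAt_single i 0
  simpa [torusCover_zero, torusCover_single] using! (hasDerivAt_phase hΨ (hasDerivAt_const 0 t)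
    hline (hasDerivAt_const 0 ξ) x).deriv.symm

lemma phaseDeriv_momentum : phaseDeriv Ψ t x ξ (0, 0, e) = fderiv ℝ (Ψ t x) ξ e := by
  obtain ⟨w, -, rfl⟩ := exists_torusCover_eq x
  have hslice := (hΨ.differentiable one_ne_zero (t, w, ξ)).hasFDerivAt.comp ξ
    ((hasFDerivAt_prodMk_right t (w, ξ)).comp ξ (hasFDerivAt_prodMk_right w ξ))
  rw [phaseDeriv_torusCover]
  exact (DFunLike.congr_fun hslice.fderiv e).symm

lemma phaseDeriv_characteristic :
    phaseDeriv Ψ t x ξ (1, ξ.ofLp, e) = deriv (fun s => Ψ s x ξ) t +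
      ∑ i, ξ i * torusPartial i (fun y => Ψ t y ξ) x + fderiv ℝ (Ψ t x) ξ e := by
  have hsplit := apply_transport (d := Fin 3) (phaseDeriv Ψ t x ξ) ξ e 0
  have hadd (L : ℝ × (Fin 3 → ℝ) × R3 →L[ℝ] ℝ) : L (1, 0, e) = L (1, 0, 0) + L (0, 0, e) := by
    rw [← map_add, Prod.mk_add_mk, Prod.mk_add_mk, add_zero, add_zero, zero_add]
  simp only [Pi.zero_apply, smul_zero, Finset.sum_const_zero, sub_zero, hadd,
    phaseDeriv_time hΨ, phaseDeriv_position hΨ, phaseDeriv_momentum hΨ] at hsplit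
  rw [add_right_comm, hsplit, sub_add_cancel]

end PhaseSpace

variable {χ : T3 → ℝ} (hχ : TorusContDiff 1 χ) (j : Fin 3)

include hχ

lemma contDiff_phaseLift_momentum_mul :
    ContDiff ℝ 1 (phaseLift fun _ x (ξ : R3) => ξ j * χ x) := by
  have hcoord : ContDiff ℝ 1 fun p : ℝ × (Fin 3 → ℝ) × R3 => p.2.2 j :=
    (EuclideanSpace.proj j : R3 →L[ℝ] ℝ).contDiff.comp (contDiff_snd.comp contDiff_snd)
  have hχ_lift : ContDiff ℝ 1 fun w : Fin 3 → ℝ => χ (torusProj w) := hχ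
  exact hcoord.mul (hχ_lift.comp (contDiff_fst.comp contDiff_snd))

lemma phaseDeriv_characteristic_momentum_mul (t : ℝ) (x : T3) (ξ e : R3) :
    phaseDeriv (fun _ x (ξ : R3) => ξ j * χ x) t x ξ (1, ξ.ofLp, e) =
      (∑ i, ξ i * ξ j * torusPartial i χ x) + e j * χ x := by
  have hpartial (i : Fin 3) :
      torusPartial i (fun y => ξ j * χ y) x = ξ j * torusPartial i χ x :=
    ((hχ.hasDerivAt_add_single i x).const_mul (ξ j)).deriv
  have hmomentum : fderiv ℝ (fun ξ : R3 => ξ j * χ x) ξ e = e j * χ x := by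
    have hcoord := ((EuclideanSpace.proj j : R3 →L[ℝ] ℝ).hasFDerivAt (x := ξ)).mul_const (χ x)
    exact (DFunLike.congr_fun hcoord.fderiv e).trans (mul_comm _ _)
  simp only [phaseDeriv_characteristic (contDiff_phaseLift_momentum_mul hχ j), deriv_const,
    zero_add, hpartial, hmomentum, mul_assoc]

end TestFunctions

/-! ### The kinetic measure -/

section KineticMeasure

lemma map_snd_withDensity_prod {α β : Type*} [MeasurableSpace α] [MeasurableSpace β]
    (μ : Measure α) (ν : Measure β) [SFinite μ] [SFinite ν] {f : α × β → ℝ≥0∞}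
    (hf : Measurable f) :
    ((μ.prod ν).withDensity f).map Prod.snd = ν.withDensity fun y => ∫⁻ x, f (x, y) ∂μ := by
  ext s hs
  rw [Measure.map_apply measurable_snd hs, withDensity_apply _ (measurable_snd hs),
    withDensity_apply _ hs, ← univ_prod, ← Measure.prod_restrict, Measure.restrict_univ,
    lintegral_prod_symm _ hf.aemeasurable]

lemma integral_withDensity_ofReal {α : Type*} [MeasurableSpace α] {μ : Measure α} {f : α → ℝ}
    (hf : Measurable f) (hpos : ∀ x, 0 ≤ f x) (g : α → ℝ) :
    ∫ x, g x ∂μ.withDensity (fun x => ENNReal.ofReal (f x)) = ∫ x, f x * g x ∂μ := by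
  rw [integral_withDensity_eq_integral_toReal_smul hf.ennreal_ofReal
    (ae_of_all _ fun _ => ENNReal.ofReal_lt_top)]
  simp only [ENNReal.toReal_ofReal (hpos _), smul_eq_mul]

variable {M : Type*} [MeasurableSpace M] {r : ℝ} {C : ℝ≥0}

namespace FluidState

section Momentum

variable {d : Type*} [Fintype d] {v : FluidState M d} (hv : v.IsBounded r C)

include hv

lemma IsBounded.measurable_momentumVector : Measurable v.momentumVector :=
  (PiLp.continuous_toLp 2 _).measurable.comp (measurable_pi_lambda _ fun j =>
    measurable_uncurry_of_measurable_apply (hv.momentum j).measurable)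

lemma IsBounded.nnnorm_momentumVector_le (hr : 0 ≤ r) (p : M × UnitAddTorus d) :
    ‖v.momentumVector p‖₊ ≤ NNReal.sqrt (Fintype.card d * C ^ 2) := by
  have hcomponent (j : d) : ‖v.momentumVector p j‖₊ ≤ C :=
    (hv.momentum j).abs_apply_le hr p.1 p.2
  rw [EuclideanSpace.nnnorm_eq, ← nsmul_eq_mul]
  gcongr
  exact Finset.sum_le_card_nsmul _ _ _ fun j _ => pow_le_pow_left' (hcomponent j) 2

end Momentum

/-- The distribution on phase space of the fluids in the state `v`. -/
def kineticMeasure (μ : Measure M) (v : FluidState M (Fin 3)) : Measure (T3 × R3) :=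
  multifluidMeasure μ v.density v.momentum

namespace IsBounded

variable {μ : Measure M} {v : FluidState M (Fin 3)} (hv : v.IsBounded r C)

include hv

lemma measurable_density : Measurable fun p : M × T3 => v.density p.1 p.2 :=
  measurable_uncurry_of_measurable_apply hv.density.measurable

lemma measurable_phasePoint : Measurable fun p : M × T3 => (p.2, v.momentumVector p) :=
  measurable_snd.prodMk hv.measurable_momentumVector

lemma ae_kineticMeasure_nnnorm_le (hr : 0 ≤ r) :
    ∀ᵐ z ∂v.kineticMeasure μ, ‖z.2‖₊ ≤ NNReal.sqrt (3 * C ^ 2) := by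
  refine (ae_map_iff hv.measurable_phasePoint.aemeasurable
    (measurableSet_le (by fun_prop) measurable_const)).2 (ae_of_all _ fun p => ?_)
  simpa using hv.nnnorm_momentumVector_le hr p

variable (hpos : ∀ θ x, 0 ≤ v.density θ x)

include hpos

lemma integral_kineticMeasure {g : T3 × R3 → ℝ} (hg : Measurable g) :
    ∫ z, g z ∂v.kineticMeasure μ =
      ∫ p, v.density p.1 p.2 * g (p.2, v.momentumVector p) ∂μ.prod torusMeasure :=
  (integral_map hv.measurable_phasePoint.aemeasurable hg.aestronglyMeasurable).trans
    (integral_withDensity_ofReal hv.measurable_density (fun p => hpos p.1 p.2) _)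

variable [IsProbabilityMeasure μ] (hr : 0 ≤ r)

include hr

lemma average_density_nonneg (x : T3) : 0 ≤ average μ v.density x := by
  rw [hv.density.average_apply μ hr]
  exact integral_nonneg fun θ => hpos θ x

lemma map_fst_kineticMeasure : (v.kineticMeasure μ).map Prod.fst =
    torusMeasure.withDensity fun x => ENNReal.ofReal (average μ v.density x) := by
  refine (Measure.map_map measurable_fst hv.measurable_phasePoint).trans
    ((map_snd_withDensity_prod μ torusMeasure hv.measurable_density.ennreal_ofReal).trans ?_)
  congr 1 with x
  rw [hv.density.average_apply μ hr, ofReal_integral_eq_lintegral_ofReal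
    (hv.density.integrable μ hr x) (ae_of_all _ fun θ => hpos θ x)]

lemma integral_kineticMeasure_comp_fst (χ : C(T3, ℝ)) :
    ∫ z, χ z.1 ∂v.kineticMeasure μ = ∫ x, average μ v.density x * χ x ∂torusMeasure := by
  rw [← integral_map (φ := Prod.fst) (f := χ) measurable_fst.aemeasurable
    χ.continuous.aestronglyMeasurable, hv.map_fst_kineticMeasure hpos hr,
    integral_withDensity_ofReal (ContinuousMap.continuous _).measurable
      (hv.average_density_nonneg hpos hr)]

lemma exists_density_kineticMeasure : ∃ q : T3 → ℝ, Measurable q ∧ (∀ x, 0 ≤ q x) ∧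
    (v.kineticMeasure μ).map Prod.fst = torusMeasure.withDensity (fun x => ENNReal.ofReal (q x)) ∧
      eLpNorm q 1 torusMeasure ≤ C ∧ eLpNorm q ∞ torusMeasure ≤ C := by
  have habs (x : T3) : ‖average μ v.density x‖ ≤ C :=
    abs_apply_le_of_wienerNorm_le hr (hv.density.wienerNorm_average_le μ hr) x
  have hbound (p : ℝ≥0∞) : eLpNorm (average μ v.density) p torusMeasure ≤ C := by
    simpa using eLpNorm_le_of_ae_bound (p := p) (ae_of_all torusMeasure habs)
  exact ⟨average μ v.density, (ContinuousMap.continuous _).measurable,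
    hv.average_density_nonneg hpos hr, hv.map_fst_kineticMeasure hpos hr, hbound 1, hbound ∞⟩

variable (hmass : ∫ x, average μ v.density x ∂torusMeasure = 1)

include hmass

lemma isProbabilityMeasure_kineticMeasure : IsProbabilityMeasure (v.kineticMeasure μ) := by
  suffices IsProbabilityMeasure ((v.kineticMeasure μ).map Prod.fst) from
    Measure.isProbabilityMeasure_of_map Prod.fst
  rw [hv.map_fst_kineticMeasure hpos hr]
  have hintegrable : Integrable (average μ v.density) torusMeasure :=
    integrable_of_continuous_torus (ContinuousMap.continuous _)
  refine ⟨?_⟩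
  rw [withDensity_apply _ .univ, setLIntegral_univ, ← ofReal_integral_eq_lintegral_ofReal
    hintegrable (ae_of_all _ (hv.average_density_nonneg hpos hr)), hmass, ENNReal.ofReal_one]

lemma isP2_kineticMeasure : IsP2 (v.kineticMeasure μ) := by
  have := hv.isProbabilityMeasure_kineticMeasure hpos hr hmass
  refine ⟨this, (integrable_const ((NNReal.sqrt (3 * C ^ 2) : ℝ) ^ 2)).mono' (by fun_prop) ?_⟩
  filter_upwards [hv.ae_kineticMeasure_nnnorm_le hr] with z hz
  rw [norm_pow, norm_norm]
  exact pow_le_pow_left₀ (norm_nonneg _) hz 2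

lemma lintegral_kineticMeasure_enorm_pow_le (n : ℕ) :
    ∫⁻ z, ‖z.2‖ₑ ^ n ∂v.kineticMeasure μ ≤ (NNReal.sqrt (3 * C ^ 2) ^ n : ℝ≥0) := by
  have := hv.isProbabilityMeasure_kineticMeasure hpos hr hmass
  have hle : ∀ᵐ z ∂v.kineticMeasure μ, ‖z.2‖ₑ ^ n ≤ (NNReal.sqrt (3 * C ^ 2) ^ n : ℝ≥0) := by
    filter_upwards [hv.ae_kineticMeasure_nnnorm_le hr] with z hz
    rw [enorm_eq_nnnorm]
    exact mod_cast pow_le_pow_left' hz n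
  exact (lintegral_mono_ae hle).trans_eq (by simp)

end IsBounded

end FluidState

lemma neg_integral_poissonPotential_mul_torusLaplacian (hr : 0 < r) {g : C(T3, ℝ)}
    (hg : wienerNorm r g ≠ ⊤) {χ : T3 → ℝ} (hχ : TorusContDiff 2 χ) :
    -∫ x, poissonPotential g x * torusLaplacian χ x ∂torusMeasure =
      (∫ x, g x * χ x ∂torusMeasure) - (∫ x, g x ∂torusMeasure) * ∫ x, χ x ∂torusMeasure := by
  have hpotential : TorusContDiff 2 (poissonPotential g) := torusContDiff_of_wienerNorm_ne_top 2 hr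
    (ne_top_of_le_ne_top hg (wienerNorm_poissonPotential_le hr.le hg))
  have hpoisson (x : T3) : -(torusLaplacian (poissonPotential g) x * χ x) =
      g x * χ x - (∫ y, g y ∂torusMeasure) * χ x := by
    rw [← neg_mul, torusLaplacian_poissonPotential hr hg, sub_mul]
  have hgχ : Integrable (fun x => g x * χ x) torusMeasure :=
    integrable_of_continuous_torus (g.continuous.mul hχ.continuous)
  have hχ₀ : Integrable χ torusMeasure := integrable_of_continuous_torus hχ.continuous
  rw [integral_mul_torusLaplacian hpotential hχ, ← integral_neg]
  simp only [hpoisson]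
  rw [integral_sub hgχ (hχ₀.const_mul _), integral_const_mul]

end KineticMeasure

/-! ### The kinetic measure as a suitable weak solution -/

lemma continuousInB_of_tendsto_wienerNorm {T τ δ : ℝ} (hδ : 0 < δ) {u : ℝ → C(T3, ℝ)} (hT : T < τ)
    (hu : ∀ t, |t| < τ → wienerNorm (Real.log δ) (u t) ≠ ⊤)
    (hcont : ∀ t, |t| < τ → Tendsto (fun s => wienerNorm (Real.log δ) (u s - u t)) (𝓝 t) (𝓝 0)) :
    ContinuousInB T δ u := by
  refine ⟨fun t ht => memB_of_wienerNorm_ne_top hδ (hu t (abs_lt_of_mem_Icc hT ht)),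
    fun t ht => ?_⟩
  simp only [bNorm_eq_toReal hδ]
  exact ((ENNReal.tendsto_toReal ENNReal.zero_ne_top).comp
    (hcont t (abs_lt_of_mem_Icc hT ht))).mono_left nhdsWithin_le_nhds

lemma IsTestFunction.contDiff_phaseLift {T : ℝ} {ψ : ℝ → T3 → R3 → ℝ} (hψ : IsTestFunction T ψ) :
    ContDiff ℝ 1 (phaseLift ψ) :=
  ContDiff.of_le hψ.1 (by simp)

lemma integral_Ico_eq_sub_of_hasDerivAt_of_norm_le {E : Type*} [NormedAddCommGroup E]
    [NormedSpace ℝ E] [CompleteSpace E] {f f' : ℝ → E} {a b K : ℝ} (hab : a ≤ b)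
    (hderiv : ∀ t ∈ Icc a b, HasDerivAt f (f' t) t) (hbound : ∀ t ∈ Icc a b, ‖f' t‖ ≤ K) :
    ∫ t in Ico a b, f' t = f b - f a := by
  have hEq : EqOn f' (deriv f) (Icc a b) := fun t ht => (hderiv t ht).deriv.symm
  have hintegrable : IntervalIntegrable f' volume a b := by
    rw [intervalIntegrable_iff_integrableOn_Icc_of_le hab]
    exact IntegrableOn.of_bound measure_Icc_lt_top
      ((aestronglyMeasurable_deriv f _).congr
        (ae_restrict_of_forall_mem measurableSet_Icc fun t ht => (hEq ht).symm))
      K (ae_restrict_of_forall_mem measurableSet_Icc hbound)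
  rw [integral_Ico_eq_integral_Ioc, ← intervalIntegral.integral_of_le hab]
  exact intervalIntegral.integral_eq_sub_of_hasDerivAt
    (fun t ht => hderiv t (uIcc_of_le hab ▸ ht)) hintegrable

namespace LocalSolution

variable {M : Type*} [MeasurableSpace M] {μ : Measure M} {τ r T : ℝ}
  {C : ℝ≥0} {v : ℝ → FluidState M (Fin 3)} (h : LocalSolution μ τ r C v) (hT : T < τ)
  (hpos : ∀ θ x, 0 ≤ (v 0).density θ x)

include h hT hpos

lemma integral_kineticMeasure {t : ℝ} (ht : t ∈ Icc 0 T) {g : T3 × R3 → ℝ} (hg : Measurable g) :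
    ∫ z, g z ∂(v t).kineticMeasure μ =
      ∫ p, (v t).density p.1 p.2 * g (p.2, (v t).momentumVector p) ∂μ.prod torusMeasure :=
  (h.isBounded t (abs_lt_of_mem_Icc hT ht)).integral_kineticMeasure
    (fun θ => h.density_nonneg hT (hpos θ) t ht) hg

variable [IsProbabilityMeasure μ]

lemma continuousOn_integral_kineticMeasure (g : BoundedContinuousFunction (T3 × R3) ℝ) :
    ContinuousOn (fun t => ∫ z, g z ∂(v t).kineticMeasure μ) (Icc 0 T) := by
  have hτ {t : ℝ} (ht : t ∈ Icc 0 T) : |t| < τ := abs_lt_of_mem_Icc hT ht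
  refine ContinuousOn.congr (fun t ht => ?_) fun t ht =>
    h.integral_kineticMeasure hT hpos ht g.continuous.measurable
  refine continuousWithinAt_of_dominated (bound := fun _ => C * ‖g‖)
    (eventually_mem_nhdsWithin.mono fun s hs => ?_)
    (eventually_mem_nhdsWithin.mono fun s hs => ae_of_all _ fun p => ?_) (integrable_const _)
    (ae_of_all _ fun p => ?_)
  · have hbounded := h.isBounded s (hτ hs)
    exact (hbounded.measurable_density.mul
      (g.continuous.measurable.comp hbounded.measurable_phasePoint)).aestronglyMeasurable
  · rw [norm_mul]
    exact mul_le_mul ((h.isBounded s (hτ hs)).density.abs_apply_le h.radius_pos.le p.1 p.2)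
      (g.norm_coe_le_norm _) (norm_nonneg _) C.coe_nonneg
  · exact ((h.hasDerivAt_density_apply p.1 (hτ ht) p.2).continuousAt.mul
      (g.continuous.continuousAt.comp (continuousAt_const.prodMk
        (h.hasDerivAt_momentumVector (hτ ht) p).continuousAt))).continuousWithinAt

lemma hasDerivWithinAt_current (j : Fin 3) {χ : T3 → ℝ} (hχ : TorusContDiff 1 χ) {t : ℝ}
    (ht : t ∈ Icc 0 T) :
    HasDerivWithinAt (fun s => ∫ z, z.2 j * χ z.1 ∂(v s).kineticMeasure μ)
      (∫ z, ((∑ i, z.2 i * z.2 j * torusPartial i χ z.1) -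
        torusPartial j (poissonPotential (average μ (v t).density)) z.1 * χ z.1)
          ∂(v t).kineticMeasure μ) (Icc 0 T) t := by
  have hχ₀ : Continuous χ := hχ.continuous
  have hχ₁ (i : Fin 3) : Continuous (torusPartial i χ) :=
    (TorusContDiff.torusPartial (n := 0) hχ i).continuous
  have htτ : |t| < τ := abs_lt_of_mem_Icc hT ht
  have hcurrent {s : ℝ} (hs : s ∈ Icc 0 T) := h.integral_kineticMeasure hT hpos hs
    (g := fun z => z.2 j * χ z.1) (by fun_prop)
  refine ((h.hasDerivAt_integral_testFunction (contDiff_phaseLift_momentum_mul hχ j)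
    htτ).hasDerivWithinAt.congr (fun s hs => hcurrent hs) (hcurrent ht)).congr_deriv ?_
  simp only [h.torusPartial_poissonPotential htτ, phaseDeriv_characteristic_momentum_mul hχ]
  rw [h.integral_kineticMeasure hT hpos ht (g := fun z =>
    (∑ i, z.2 i * z.2 j * torusPartial i χ z.1) -
      gradPotential j (average μ (v t).density) z.1 * χ z.1) (by fun_prop)]
  simp only [FluidState.forceField, ContinuousMap.coe_mk, neg_mul, sub_eq_add_neg]
  rfl

lemma integral_vlasov (hT₀ : 0 ≤ T) {ψ : ℝ → T3 → R3 → ℝ} (hψ : IsTestFunction T ψ) :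
    ∫ t in Ico 0 T, ∫ z : T3 × R3, (deriv (fun s => ψ s z.1 z.2) t +
        ∑ i, z.2 i * torusPartial i (fun y => ψ t y z.2) z.1 +
        fderiv ℝ (ψ t z.1) z.2 ((v t).forceField μ z.1)) ∂(v t).kineticMeasure μ =
      -∫ z, ψ 0 z.1 z.2 ∂(v 0).kineticMeasure μ := by
  have hΨ := hψ.contDiff_phaseLift
  obtain ⟨-, T', hT', R, hvanish⟩ := hψ
  have hτ {t : ℝ} (ht : t ∈ Icc 0 T) : |t| < τ := abs_lt_of_mem_Icc hT ht
  let G (s : ℝ) : ℝ :=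
    ∫ p, (v s).density p.1 p.2 * ψ s p.2 ((v s).momentumVector p) ∂μ.prod torusMeasure
  let G' (s : ℝ) : ℝ := ∫ p, (v s).density p.1 p.2 * phaseDeriv ψ s p.2 ((v s).momentumVector p)
    (1, ((v s).momentumVector p).ofLp, (v s).forceField μ p.2) ∂μ.prod torusMeasure
  have hderiv {t : ℝ} (ht : t ∈ Icc 0 T) : HasDerivAt G (G' t) t :=
    h.hasDerivAt_integral_testFunction hΨ (hτ ht)
  have hkinetic {t : ℝ} (ht : t ∈ Icc 0 T) : ∫ z : T3 × R3, (deriv (fun s => ψ s z.1 z.2) t +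
        ∑ i, z.2 i * torusPartial i (fun y => ψ t y z.2) z.1 +
        fderiv ℝ (ψ t z.1) z.2 ((v t).forceField μ z.1)) ∂(v t).kineticMeasure μ = G' t := by
    simp only [← phaseDeriv_characteristic hΨ]
    refine h.integral_kineticMeasure hT hpos ht (g := fun z =>
      phaseDeriv ψ t z.1 z.2 (1, z.2.ofLp, (v t).forceField μ z.1)) ?_
    have hphase := (continuous_phaseDeriv hΨ).comp (Continuous.prodMk_right t)
    exact (hphase.clm_apply (by fun_prop)).measurable
  obtain ⟨K, hK⟩ := (h.measurablePrecompact_characteristicDeriv hΨ).exists_norm_integral_le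
    (ν := μ.prod torusMeasure)
  have hfinal : G T = 0 := by simp [G, hvanish T hT₀ _ _ (Or.inl hT'.le)]
  have hψ₀ : Continuous fun z : T3 × R3 => ψ 0 z.1 z.2 :=
    (continuous_of_continuous_comp_torusCover (F := fun q => ψ q.1 q.2.1 q.2.2)
      hΨ.continuous).comp (Continuous.prodMk_right 0)
  rw [setIntegral_congr_fun measurableSet_Ico fun t ht => hkinetic (Ico_subset_Icc_self ht),
    integral_Ico_eq_sub_of_hasDerivAt_of_norm_le hT₀ (fun t ht => hderiv ht)
      (fun t ht => hK t (mem_ball_zero_iff.2 (hτ ht))),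
    hfinal, zero_sub, h.integral_kineticMeasure hT hpos (left_mem_Icc.2 hT₀) hψ₀.measurable]

variable (hmass : ∫ θ, ∫ x, (v 0).density θ x ∂torusMeasure ∂μ = 1)

include hmass

theorem isWeakSolution (hT₀ : 0 < T) :
    IsWeakSolution T ((v 0).kineticMeasure μ) (fun t => (v t).kineticMeasure μ)
      fun t => poissonPotential (average μ (v t).density) := by
  have hr : 0 < r := h.radius_pos
  have hτ {t : ℝ} (ht : t ∈ Ico 0 T) : |t| < τ := abs_lt_of_mem_Icc hT (Ico_subset_Icc_self ht)
  have hnonneg {t : ℝ} (ht : t ∈ Ico 0 T) (θ : M) : ∀ x, 0 ≤ (v t).density θ x :=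
    h.density_nonneg hT (hpos θ) t (Ico_subset_Icc_self ht)
  have hmass_t {t : ℝ} (ht : t ∈ Ico 0 T) :
      ∫ x, average μ (v t).density x ∂torusMeasure = 1 := (h.integral_average (hτ ht)).trans hmass
  have hP2 {t : ℝ} (ht : t ∈ Ico 0 T) : IsP2 ((v t).kineticMeasure μ) :=
    (h.isBounded t (hτ ht)).isP2_kineticMeasure (hnonneg ht) hr.le (hmass_t ht)
  have hforce : ContinuousOn (fun t => (v t).forceField μ) (Icc 0 T) := fun t ht =>
    (h.continuousAt_forceField (abs_lt_of_mem_Icc hT ht)).continuousWithinAt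
  exact
    { initial_mem := hP2 (left_mem_Ico.2 hT₀)
      mem t ht := hP2 ht
      initial := rfl
      continuous g :=
        (h.continuousOn_integral_kineticMeasure hT hpos g).mono Ico_subset_Icc_self
      contDiff_potential t ht :=
        torusContDiff_of_wienerNorm_ne_top 1 hr (h.poissonPotential_ne_top (hτ ht))
      vlasov := by
        refine ⟨fun t => (v t).forceField μ, fun t ht x j => ?_,
          hforce.integrableOn_Icc.mono_set Ico_subset_Icc_self,
          fun ψ hψ => h.integral_vlasov hT hpos hT₀.le hψ⟩
        rw [h.torusPartial_poissonPotential (hτ ht)]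
        rfl
      poisson t ht χ hχ := by
        rw [neg_integral_poissonPotential_mul_torusLaplacian hr (h.average_ne_top (hτ ht))
          (hχ.of_le ENat.LEInfty.out), hmass_t ht, one_mul,
          (h.isBounded t (hτ ht)).integral_kineticMeasure_comp_fst (hnonneg ht) hr.le]
      current t ht j χ hχ := (h.hasDerivWithinAt_current hT hpos j (hχ.of_le ENat.LEInfty.out)
        (Ico_subset_Icc_self ht)).mono Ico_subset_Icc_self }

theorem isSuitableSolution (hT₀ : 0 < T) :
    IsSuitableSolution T ((v 0).kineticMeasure μ) (fun t => (v t).kineticMeasure μ)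
      fun t => poissonPotential (average μ (v t).density) := by
  have hr : 0 < r := h.radius_pos
  have hτ {t : ℝ} (ht : t ∈ Ico 0 T) : |t| < τ := abs_lt_of_mem_Icc hT (Ico_subset_Icc_self ht)
  have hnonneg {t : ℝ} (ht : t ∈ Ico 0 T) (θ : M) : ∀ x, 0 ≤ (v t).density θ x :=
    h.density_nonneg hT (hpos θ) t (Ico_subset_Icc_self ht)
  refine ⟨h.isWeakSolution hT hpos hmass hT₀, ⟨C, ?_⟩, ⟨NNReal.sqrt (3 * C ^ 2) ^ 4, ?_⟩⟩ <;>
    filter_upwards [ae_restrict_mem measurableSet_Ico] with t ht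
  · exact (h.isBounded t (hτ ht)).exists_density_kineticMeasure (hnonneg ht) hr.le
  · exact (h.isBounded t (hτ ht)).lintegral_kineticMeasure_enorm_pow_le (hnonneg ht) hr.le
      ((h.integral_average (hτ ht)).trans hmass) 4

end LocalSolution

/-! ### Local existence in terms of the norms of `B_δ` -/

section LocalExistence

variable {M : Type*} [MeasurableSpace M]

lemma exists_localSolution_of_log (μ : Measure M) [IsProbabilityMeasure μ] {δ₀ δ₁ : ℝ}
    (hδ₁ : 1 < δ₁) (hδ₁₀ : δ₁ < δ₀) {B : ℝ≥0} {v₀ : FluidState M (Fin 3)}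
    (hv₀ : v₀.IsBounded (Real.log δ₀) B) :
    ∃ τ > 0, ∃ v, LocalSolution μ τ (Real.log δ₁) (2 * B) v ∧ v 0 = v₀ := by
  have hlog₁ : 0 < Real.log δ₁ := Real.log_pos hδ₁
  have hlog : Real.log δ₁ < Real.log δ₀ := Real.log_lt_log (zero_lt_one.trans hδ₁) hδ₁₀
  lift Real.log δ₀ to ℝ≥0 using (hlog₁.trans hlog).le with r₀
  lift Real.log δ₁ to ℝ≥0 using hlog₁.le with r₁
  have hlt : r₁ < r₀ := mod_cast hlog
  simpa [NNReal.coe_sub hlt.le] using exists_localSolution μ (tsub_pos_of_lt hlt)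
    (tsub_lt_self (mod_cast hlog₁.trans hlog) (mod_cast hlog₁)) hv₀

variable {δ : ℝ} (hδ : 0 < δ)

include hδ

lemma isBoundedFamily_of_bNorm_le {C : ℝ} {g : M → C(T3, ℝ)}
    (hmeas : ∀ x, Measurable fun θ => g θ x) (hg : ∀ θ, MemB δ (g θ) ∧ bNorm δ (g θ) ≤ C) :
    IsBoundedFamily (Real.log δ) C.toNNReal g where
  measurable := hmeas
  wienerNorm_le θ := (wienerNorm_eq_ofReal_bNorm hδ (hg θ).1).trans_le
    (ENNReal.ofReal_le_ofReal (hg θ).2)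

lemma IsBoundedFamily.bNorm_le {C : ℝ≥0} {g : M → C(T3, ℝ)}
    (hg : IsBoundedFamily (Real.log δ) C g) (θ : M) : bNorm δ (g θ) ≤ C := by
  rw [bNorm_eq_toReal hδ]
  exact ENNReal.toReal_mono ENNReal.coe_ne_top (hg.wienerNorm_le θ)

end LocalExistence

end VlasovPoisson

end

theorem mainTheorem3 {M : Type*} [MeasurableSpace M] (μ : Measure M) [IsProbabilityMeasure μ]
    (δ₀ δ₁ C₀ : ℝ) (hδ₁ : 1 < δ₁) (hδ : δ₁ < δ₀) (hC₀ : 0 < C₀)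
    (ρ0 : M → C(VlasovPoisson.T3, ℝ)) (ξ0 : M → Fin 3 → C(VlasovPoisson.T3, ℝ))
    (hρ_meas : ∀ x, Measurable fun θ => ρ0 θ x)
    (hξ_meas : ∀ j x, Measurable fun θ => ξ0 θ j x)
    (hρ : ∀ θ, VlasovPoisson.MemB δ₀ (ρ0 θ) ∧ VlasovPoisson.bNorm δ₀ (ρ0 θ) ≤ C₀)
    (hξ : ∀ θ j, VlasovPoisson.MemB δ₀ (ξ0 θ j) ∧ VlasovPoisson.bNorm δ₀ (ξ0 θ j) ≤ C₀)
    (hmass : ∫ θ, ∫ x, ρ0 θ x ∂VlasovPoisson.torusMeasure ∂μ = 1) :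
    ∃ T₀ > 0, ∃ (ρ : M → ℝ → C(VlasovPoisson.T3, ℝ))
      (ξ : M → ℝ → Fin 3 → C(VlasovPoisson.T3, ℝ)) (φ : ℝ → C(VlasovPoisson.T3, ℝ)),
      (∀ θ, VlasovPoisson.ContinuousInB T₀ δ₁ (ρ θ)) ∧
      (∀ θ j, VlasovPoisson.ContinuousInB T₀ δ₁ fun t => ξ θ t j) ∧
      (∃ C : ℝ, ∀ θ, ∀ t ∈ Icc 0 T₀, VlasovPoisson.bNorm δ₁ (ρ θ t) ≤ C ∧
        ∀ j, VlasovPoisson.bNorm δ₁ (ξ θ t j) ≤ C) ∧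
      VlasovPoisson.IsMultifluidSolution μ T₀ ρ0 ξ0 ρ ξ φ ∧
      ((∀ θ x, 0 ≤ ρ0 θ x) →
        (∀ θ, ∀ t ∈ Icc 0 T₀, ∀ x, 0 ≤ ρ θ t x) ∧
        VlasovPoisson.IsSuitableSolution T₀ (VlasovPoisson.multifluidMeasure μ ρ0 ξ0)
          (fun t => VlasovPoisson.multifluidMeasure μ (fun θ => ρ θ t) (fun θ => ξ θ t)) φ) := by
  have hδ₁_pos : 0 < δ₁ := zero_lt_one.trans hδ₁
  have hδ₀_pos : 0 < δ₀ := hδ₁_pos.trans hδ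
  obtain ⟨τ, hτ, v, h, rfl, rfl⟩ : ∃ τ > 0, ∃ v, VlasovPoisson.LocalSolution μ τ (Real.log δ₁)
      (2 * C₀.toNNReal) v ∧ (v 0).density = ρ0 ∧ (v 0).momentum = ξ0 := by
    obtain ⟨τ, hτ, v, h, hv⟩ := VlasovPoisson.exists_localSolution_of_log μ hδ₁ hδ
      (v₀ := ⟨ρ0, ξ0⟩) ⟨VlasovPoisson.isBoundedFamily_of_bNorm_le hδ₀_pos hρ_meas hρ, fun j =>
        VlasovPoisson.isBoundedFamily_of_bNorm_le hδ₀_pos (hξ_meas j) fun θ => hξ θ j⟩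
    exact ⟨τ, hτ, v, h, congrArg _ hv, congrArg _ hv⟩
  have hT : τ / 2 < τ := half_lt_self hτ
  refine ⟨τ / 2, half_pos hτ, fun θ t => (v t).density θ, fun θ t => (v t).momentum θ,
    fun t => VlasovPoisson.poissonPotential (VlasovPoisson.average μ (v t).density),
    fun θ => VlasovPoisson.continuousInB_of_tendsto_wienerNorm hδ₁_pos hT
      (fun t ht => h.density_ne_top θ ht) (h.tendsto_density θ),
    fun θ j => VlasovPoisson.continuousInB_of_tendsto_wienerNorm hδ₁_pos hT
      (fun t ht => h.momentum_ne_top θ ht j) fun t ht => h.tendsto_momentum θ t ht j,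
    ⟨(2 * C₀.toNNReal : ℝ≥0), fun θ t ht => ?_⟩, h.isMultifluidSolution hT hmass,
    fun hpos => ⟨fun θ => h.density_nonneg hT (hpos θ),
      h.isSuitableSolution hT hpos hmass (half_pos hτ)⟩⟩
  have hbounded := h.isBounded t (VlasovPoisson.abs_lt_of_mem_Icc hT ht)
  exact ⟨hbounded.density.bNorm_le hδ₁_pos θ, fun j => (hbounded.momentum j).bNorm_le hδ₁_pos θ⟩
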